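/- For every $n\in\mathbb N$ there are $\sigma_0=\sigma_0(n)>0$, $C=C(n)$ and $C_{n,k}$ ($k\ge 2$), depending only on $n$ and on $n,k$ respectively, such that the following holds. Let $E$ be a separable real Hilbert space, $X\subset E$, $r>0$ and $0<\delta<\sigma_0 r$. Suppose that $X$ is $\delta$-close to $n$-flats at scale $r$, that is, for every $x\in X$ there is an $n$-dimensional affine subspace $A_x\subset E$ through $x$ with $d_H(X\cap B_r(x),\,A_x\cap B_r(x))\le\delta$, where $d_H$ is the Hausdorff distance and $B_r(x)$ the ball of radius $r$ about $x$ in $E$. Then there is an $n$-dimensional smooth submanifold $M\subset E$ which is a closed subset of $E$ such that: 1. $d_H(X,M)\le 5\delta$. 2. The second fundamental form of $M$ at every point has norm at most $C\delta r^{-2}$. 3. The normal injectivity radius of $M$ is at least $r/3$. (It is the supremum of all $\rho>0$ such that the normal exponential map $(p,v)\mapsto p+v$ is a diffeomorphism of the $\rho$-neighborhood of the null section of the normal bundle of $M$ onto an open subset of $E$.) 4. Let $U_{r/3}(M)$ be the set of points of $E$ at distance less than $r/3$ from $M$. Every $x\in U_{r/3}(M)$ has a unique nearest point $P_M(x)$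 in $M$; the map $P_M\colon U_{r/3}(M)\to M$ is smooth, satisfies $|P_M(x)-P_M(y)|\le C|x-y|$ for all $x,y\in U_{r/3}(M)$, and its $k$-th differential satisfies $\|d^k_xP_M\|<C_{n,k}\,\delta\, r^{-k}$ for all $k\ge 2$ and all $x\in U_{r/3}(M)$. -/

import Mathlib

open scoped Topology ENNReal ContDiff

/-- `X` is `δ`-close to `n`-flats at scale `r`: every `x ∈ X` lies on an `n`-dimensional affine
subspace `A` such that `X` and `A`, inside the ball of radius `r` about `x`, are at Hausdorff
distance at most `δ`. -/
def IsCloseToFlats {E : Type*} [NormedAddCommGroup E] [InnerProductSpace ℝ E]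
    (n : ℕ) (δ r : ℝ) (X : Set E) : Prop :=
  ∀ x ∈ X, ∃ A : AffineSubspace ℝ E, x ∈ A ∧
    FiniteDimensional ℝ A.direction ∧ Module.finrank ℝ A.direction = n ∧
    Metric.hausdorffEDist (X ∩ Metric.ball x r) ((A : Set E) ∩ Metric.ball x r) ≤
      ENNReal.ofReal δ

/-- `M` is a smooth (embedded, boundaryless) `n`-dimensional submanifold of `E`: near each of its
points, some smooth diffeomorphism between open subsets of `E` carries `M` to an
`n`-dimensional linear subspace. -/
def IsSmoothSubmanifold {E : Type*} [NormedAddCommGroup E] [InnerProductSpace ℝ E]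
    (n : ℕ) (M : Set E) : Prop :=
  ∀ p ∈ M, ∃ (Φ : OpenPartialHomeomorph E E) (V : Submodule ℝ E),
    p ∈ Φ.source ∧ ContDiffOn ℝ ∞ Φ Φ.source ∧ ContDiffOn ℝ ∞ Φ.symm Φ.target ∧
    FiniteDimensional ℝ V ∧ Module.finrank ℝ V = n ∧
    ∀ x ∈ Φ.source, (x ∈ M ↔ Φ x ∈ V)

/-- `γ` is (the germ at time `0` of) a smooth curve in `M`. -/
def IsSmoothCurveIn {E : Type*} [NormedAddCommGroup E] [InnerProductSpace ℝ E]
    (M : Set E) (γ : ℝ → E) : Prop :=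
  ContDiffAt ℝ ∞ γ 0 ∧ ∀ᶠ t in 𝓝 (0 : ℝ), γ t ∈ M

/-- The tangent space of `M` at `p`: the velocities of smooth curves in `M` through `p`.
(For a submanifold these velocities already form a linear subspace, so the span adds nothing.) -/
def tangentSpaceAt {E : Type*} [NormedAddCommGroup E] [InnerProductSpace ℝ E]
    (M : Set E) (p : E) : Submodule ℝ E :=
  Submodule.span ℝ {v | ∃ γ : ℝ → E, IsSmoothCurveIn M γ ∧ γ 0 = p ∧ deriv γ 0 = v}

/-- `B` is the second fundamental form of `M` at `p`: for a smooth curve `γ` in `M` through `p`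
with velocity `u` and a smooth field `W` along `γ`, tangent to `M`, with `W 0 = w`,
the value `B u w` is the component of the derivative of `W` normal to `M`. -/
def IsSecondFundamentalForm {E : Type*} [NormedAddCommGroup E] [InnerProductSpace ℝ E]
    [CompleteSpace E] (M : Set E) (p : E)
    (B : tangentSpaceAt M p →ₗ[ℝ] tangentSpaceAt M p →ₗ[ℝ] E) : Prop :=
  ∀ (u w : tangentSpaceAt M p) (γ W : ℝ → E),
    IsSmoothCurveIn M γ → γ 0 = p → deriv γ 0 = u →
    ContDiffAt ℝ ∞ W 0 → (∀ᶠ t in 𝓝 (0 : ℝ), W t ∈ tangentSpaceAt M (γ t)) → W 0 = w →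
    B u w = (tangentSpaceAt M p)ᗮ.starProjection (deriv W 0)

/-- The open `ρ`-neighbourhood of the null section in the normal bundle of `M`, where the normal
bundle is viewed as a subset of `E × E`. -/
def normalTube {E : Type*} [NormedAddCommGroup E] [InnerProductSpace ℝ E]
    (M : Set E) (ρ : ℝ) : Set (E × E) :=
  {z | z.1 ∈ M ∧ z.2 ∈ (tangentSpaceAt M z.1)ᗮ ∧ ‖z.2‖ < ρ}

/-- The normal exponential map. -/
def normalExp {E : Type*} [NormedAddCommGroup E] (z : E × E) : E := z.1 + z.2

/-- The normal exponential map (which is the restriction of a smooth map of `E × E`) is a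
diffeomorphism of the `ρ`-neighbourhood of the null section onto an open subset of `E`:
its image is open and it has a smooth inverse there. -/
def IsNormalExpDiffeo {E : Type*} [NormedAddCommGroup E] [InnerProductSpace ℝ E]
    (M : Set E) (ρ : ℝ) : Prop :=
  IsOpen (normalExp '' normalTube M ρ) ∧
    ∃ g : E → E × E, ContDiffOn ℝ ∞ g (normalExp '' normalTube M ρ) ∧
      ∀ z ∈ normalTube M ρ, g (normalExp z) = z

/-- The normal injectivity radius of `M`. -/
noncomputable def normalInjectivityRadius {E : Type*} [NormedAddCommGroup E]
    [InnerProductSpace ℝ E] (M : Set E) : ℝ≥0∞ :=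
  ⨆ (ρ : ℝ) (_ : 0 < ρ ∧ IsNormalExpDiffeo M ρ), ENNReal.ofReal ρ

/-- On `U`, the map `P` is the normal projection to `M`: every `x ∈ U` has a unique nearest point
in `M`, namely `P x`. -/
def IsNormalProjectionOn {E : Type*} [NormedAddCommGroup E]
    (M U : Set E) (P : E → E) : Prop :=
  ∀ x ∈ U, P x ∈ M ∧ ∀ q ∈ M, q ≠ P x → dist x (P x) < dist x q

/-!
The manifold is obtained by gluing the approximating flats one separated family at a time.

By rescaling, `r = 1`. Since `X` is close to `n`-dimensional flats, it has a fine net which is a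
union of `N` sparse families, `N` depending on `n` only (`exists_separated_families`). Each family
gives a smooth map of `E` (`stepMap`): near each of its points `s` it moves points towards the
flat at `s`, all the way near `s` and not at all further away. The set `M` (`gluedSet`) is the
image of a neighbourhood of `X` under the composition of these `N` maps (`iterMap`).

Flats at nearby points of `X` differ by `O(δ)` as affine subspaces. Hence, restricted to the flat
at a point `q ∈ X`, the composition differs from the inclusion by a map (`displacement`) which is
`O(δ)` together with all its derivatives, with constants depending on `n` and the order only
(`IsGluing.jetBound_displacement`). For the explicit constant in the Hausdorff distance one needs
more: a convexity argument shows that the flat at `q` is moved by at most about `2 δ` in the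
normal direction, whatever the number of steps, and the motion along the flat is quadratic in `δ`
(`IsGluing.norm_iterMap_sub_self_le`). Conversely, each point of `M` near `q` was carried onto
some flat at the step which treats a net point nearby, so it is also the image of a point of the
flat at `q` (`IsGluing.exists_flat_of_mem_gluedSet`). So near `q` the set `M` is the image of the
flat at `q` under a map `O(δ)`-close to the inclusion.

A point of this image is critical for the distance from `x` exactly when its parameter solves a
fixed point equation (`footEquation`) which is again `O(δ)` with all derivatives. It has a
solution, which is the unique nearest point as `M` is almost flat, and the solution `s` depends
smoothly on `x`. From the linear equation `Ds = ∂₁κ + ∂₂κ ∘ Ds`, with `∂₂κ` small, all its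
derivatives are `O(δ)`, by induction on the order (`exists_jetBound_of_eq_fixedPoint`). Thus the
nearest point projection `P` is smooth and differs by `O(δ)`, with all derivatives, from the
projection onto the flat at `q` (`exists_local_projection`).

The geometry of `M` is read off from `P` (`IsTubularProjection`). Its differential at `p ∈ M` is
the orthogonal projection onto the tangent space, of rank `n`. The map
`x ↦ DP(p) (P x - p) + (1 - DP(p)) (x - P x)` is a chart at `p`, the second fundamental form is the restriction of `D²P`, and
`x ↦ (P x, x - P x)` inverts the normal exponential map.
-/

/-! ### Bounds for derivatives of all orders -/

section Jets

variable {D E F G : Type*} [NormedAddCommGroup D] [NormedSpace ℝ D]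
  [NormedAddCommGroup E] [NormedSpace ℝ E] [NormedAddCommGroup F] [NormedSpace ℝ F]
  [NormedAddCommGroup G] [NormedSpace ℝ G]

theorem ContDiffAt.exists_isOpen_contDiffOn {f : E → F} {x : E} {n : ℕ}
    (hf : ContDiffAt ℝ n f x) {V : Set E} (hV : V ∈ 𝓝 x) :
    ∃ s : Set E, IsOpen s ∧ x ∈ s ∧ s ⊆ V ∧ ContDiffOn ℝ n f s := by
  obtain ⟨u, hu, hf'⟩ := hf.contDiffOn (m := n) le_rfl (by simp)
  obtain ⟨s, hs, hso, hxs⟩ := mem_nhds_iff.1 (Filter.inter_mem hu hV)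
  exact ⟨s, hso, hxs, fun y hy => (hs hy).2, hf'.mono fun y hy => (hs hy).1⟩

/-- Pointwise form of `norm_iteratedFDerivWithin_comp_le`, for maps smooth near a point only. -/
theorem norm_iteratedFDeriv_comp_le_of_contDiffAt {g : F → G} {f : E → F} {x : E} {n : ℕ}
    (hg : ContDiffAt ℝ n g (f x)) (hf : ContDiffAt ℝ n f x) {C R : ℝ}
    (hC : ∀ i, i ≤ n → ‖iteratedFDeriv ℝ i g (f x)‖ ≤ C)
    (hR : ∀ i, 1 ≤ i → i ≤ n → ‖iteratedFDeriv ℝ i f x‖ ≤ R ^ i) :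
    ‖iteratedFDeriv ℝ n (g ∘ f) x‖ ≤ n.factorial * C * R ^ n := by
  obtain ⟨t, ht, hxt, -, hgt⟩ := hg.exists_isOpen_contDiffOn Filter.univ_mem
  obtain ⟨s, hs, hxs, hst, hfs⟩ := hf.exists_isOpen_contDiffOn
    (hf.continuousAt.preimage_mem_nhds (ht.mem_nhds hxt))
  have := norm_iteratedFDerivWithin_comp_le (n := n) hgt hfs le_rfl ht.uniqueDiffOn
    hs.uniqueDiffOn hst hxs (C := C) (D := R)
    (fun i hi => by rw [iteratedFDerivWithin_of_isOpen i ht hxt]; exact hC i hi)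
    (fun i h1 hi => by rw [iteratedFDerivWithin_of_isOpen i hs hxs]; exact hR i h1 hi)
  rwa [iteratedFDerivWithin_of_isOpen n hs hxs] at this

theorem norm_iteratedFDeriv_bilinear_le_of_contDiffAt (B : E →L[ℝ] F →L[ℝ] G) (hB : ‖B‖ ≤ 1)
    {f : D → E} {g : D → F} {x : D} {n : ℕ}
    (hf : ContDiffAt ℝ n f x) (hg : ContDiffAt ℝ n g x) :
    ‖iteratedFDeriv ℝ n (fun y => B (f y) (g y)) x‖ ≤ ∑ i ∈ Finset.range (n + 1),
      (n.choose i : ℝ) * ‖iteratedFDeriv ℝ i f x‖ * ‖iteratedFDeriv ℝ (n - i) g x‖ := by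
  obtain ⟨t, ht, hxt, -, hgt⟩ := hg.exists_isOpen_contDiffOn Filter.univ_mem
  obtain ⟨s, hs, hxs, hst, hfs⟩ := hf.exists_isOpen_contDiffOn (ht.mem_nhds hxt)
  have := B.norm_iteratedFDerivWithin_le_of_bilinear_of_le_one hfs (hgt.mono hst)
    hs.uniqueDiffOn hxs (n := n) le_rfl hB
  simpa only [iteratedFDerivWithin_of_isOpen _ hs hxs] using this

/-- `JetBound m C f x` says that `f` is smooth at `x` and that, for `k ≥ m`, its `k`-th derivative
at `x` has norm at most `C k`. With `m = 1` the value of `f` itself is left unrestricted. -/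
def JetBound (m : ℕ) (C : ℕ → ℝ) (f : E → F) (x : E) : Prop :=
  ContDiffAt ℝ ∞ f x ∧ ∀ k, m ≤ k → ‖iteratedFDeriv ℝ k f x‖ ≤ C k

/-- The constants in the bound for the derivatives of a product (Leibniz rule). -/
def leibnizBound (C C' : ℕ → ℝ) (k : ℕ) : ℝ :=
  ∑ i ∈ Finset.range (k + 1), (k.choose i : ℝ) * C i * C' (k - i)

/-- The constants in the bound for the derivatives of a composition `g ∘ f`, where `C` bounds the
derivatives of `g` and `C'` those of `f`. -/
def chainBound (C C' : ℕ → ℝ) (k : ℕ) : ℝ :=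
  k.factorial * (∑ i ∈ Finset.range (k + 1), |C i|) *
    (1 + ∑ i ∈ Finset.range (k + 1), |C' i|) ^ k

theorem leibnizBound_mul_left (C C' : ℕ → ℝ) (t : ℝ) (k : ℕ) :
    leibnizBound (fun k => C k * t) C' k = leibnizBound C C' k * t := by
  simp only [leibnizBound, Finset.sum_mul]
  exact Finset.sum_congr rfl fun i _ => by ring

theorem leibnizBound_mul_right (C C' : ℕ → ℝ) (t : ℝ) (k : ℕ) :
    leibnizBound C (fun k => C' k * t) k = leibnizBound C C' k * t := by
  simp only [leibnizBound, Finset.sum_mul]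
  exact Finset.sum_congr rfl fun i _ => by ring

theorem chainBound_mul (C C' : ℕ → ℝ) {t : ℝ} (ht : 0 ≤ t) (k : ℕ) :
    chainBound (fun k => C k * t) C' k = chainBound C C' k * t := by
  simp only [chainBound, abs_mul, abs_of_nonneg ht, ← Finset.sum_mul]
  ring

theorem le_sum_abs_range (C : ℕ → ℝ) {i k : ℕ} (h : i ≤ k) :
    C i ≤ ∑ j ∈ Finset.range (k + 1), |C j| :=
  (le_abs_self _).trans (Finset.single_le_sum (f := fun j => |C j|) (fun _ _ => abs_nonneg _)
    (Finset.mem_range.2 (Nat.lt_succ_of_le h)))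

namespace JetBound

variable {m : ℕ} {C C' : ℕ → ℝ} {f g : E → F} {x : E}

theorem contDiffAt (h : JetBound m C f x) : ContDiffAt ℝ ∞ f x := h.1

theorem contDiffAt_nat (h : JetBound m C f x) (k : ℕ) : ContDiffAt ℝ k f x :=
  h.1.of_le (by exact_mod_cast le_top)

theorem differentiableAt (h : JetBound m C f x) : DifferentiableAt ℝ f x :=
  h.1.differentiableAt (by simp)

theorem congr (h : JetBound m C f x) (hfg : g =ᶠ[𝓝 x] f) : JetBound m C g x :=
  ⟨h.1.congr_of_eventuallyEq hfg, fun k hk => by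
    rw [(hfg.iteratedFDeriv ℝ k).eq_of_nhds]; exact h.2 k hk⟩

theorem mono (h : JetBound m C f x) (hC : ∀ k, m ≤ k → C k ≤ C' k) : JetBound m C' f x :=
  ⟨h.1, fun k hk => (h.2 k hk).trans (hC k hk)⟩

theorem of_le {m' : ℕ} (h : JetBound m C f x) (hm : m ≤ m') : JetBound m' C f x :=
  ⟨h.1, fun k hk => h.2 k (hm.trans hk)⟩

theorem nonneg (h : JetBound m C f x) {k : ℕ} (hk : m ≤ k) : 0 ≤ C k :=
  (norm_nonneg _).trans (h.2 k hk)

theorem norm_le (h : JetBound 0 C f x) : ‖f x‖ ≤ C 0 := by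
  simpa using h.2 0 le_rfl

theorem norm_fderiv_le (h : JetBound m C f x) (hm : m ≤ 1) : ‖fderiv ℝ f x‖ ≤ C 1 := by
  have := h.2 1 hm
  rwa [← norm_iteratedFDeriv_fderiv, norm_iteratedFDeriv_zero] at this

theorem add (hf : JetBound m C f x) (hg : JetBound m C' g x) :
    JetBound m (fun k => C k + C' k) (fun y => f y + g y) x := by
  refine ⟨hf.1.add hg.1, fun k hk => ?_⟩
  have := iteratedFDeriv_add_apply (hf.contDiffAt_nat k) (hg.contDiffAt_nat k)
  change iteratedFDeriv ℝ k (fun y => f y + g y) x = _ at this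
  rw [this]
  exact (norm_add_le _ _).trans (add_le_add (hf.2 k hk) (hg.2 k hk))

theorem clm_comp (hf : JetBound m C f x) (L : F →L[ℝ] G) (hL : ‖L‖ ≤ 1) :
    JetBound m C (fun y => L (f y)) x := by
  refine ⟨L.contDiff.contDiffAt.comp x hf.1, fun k hk => ?_⟩
  refine (L.norm_iteratedFDeriv_comp_left (hf.contDiffAt_nat k) le_rfl).trans ?_
  exact (mul_le_mul hL (hf.2 k hk) (norm_nonneg _) zero_le_one).trans_eq (one_mul _)

theorem neg (hf : JetBound m C f x) : JetBound m C (fun y => -f y) x := by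
  refine hf.clm_comp (-ContinuousLinearMap.id ℝ F) ?_
  rw [norm_neg]
  exact ContinuousLinearMap.norm_id_le

theorem sub (hf : JetBound m C f x) (hg : JetBound m C' g x) :
    JetBound m (fun k => C k + C' k) (fun y => f y - g y) x := by
  simpa only [sub_eq_add_neg] using hf.add hg.neg

theorem bilinear {f : D → E} {g : D → F} {x : D} (hf : JetBound 0 C f x) (hg : JetBound 0 C' g x)
    (B : E →L[ℝ] F →L[ℝ] G) (hB : ‖B‖ ≤ 1) :
    JetBound 0 (leibnizBound C C') (fun y => B (f y) (g y)) x := by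
  refine ⟨B.isBoundedBilinearMap.contDiff.contDiffAt.comp x (hf.1.prodMk hg.1), fun k _ => ?_⟩
  refine (norm_iteratedFDeriv_bilinear_le_of_contDiffAt B hB (hf.contDiffAt_nat k)
    (hg.contDiffAt_nat k)).trans (Finset.sum_le_sum fun i _ => ?_)
  have h1 := hf.2 i (zero_le)
  have h2 := hg.2 (k - i) (zero_le)
  have h3 := hf.nonneg (zero_le : 0 ≤ i)
  gcongr

theorem smul {a : E → ℝ} (ha : JetBound 0 C a x) (hf : JetBound 0 C' f x) :
    JetBound 0 (leibnizBound C C') (fun y => a y • f y) x :=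
  ha.bilinear hf (ContinuousLinearMap.lsmul ℝ ℝ) ContinuousLinearMap.opNorm_lsmul_le

theorem comp {g : F → G} (hg : JetBound 0 C g (f x)) (hf : JetBound 1 C' f x) :
    JetBound 0 (chainBound C C') (fun y => g (f y)) x := by
  refine ⟨hg.1.comp x hf.1, fun k _ => ?_⟩
  refine norm_iteratedFDeriv_comp_le_of_contDiffAt (hg.contDiffAt_nat k) (hf.contDiffAt_nat k)
    (fun i hi => (hg.2 i zero_le).trans (le_sum_abs_range C hi)) fun i h1 hi => ?_
  have h0 : 0 ≤ ∑ j ∈ Finset.range (k + 1), |C' j| := Finset.sum_nonneg fun _ _ => abs_nonneg _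
  calc _ ≤ C' i := hf.2 i h1
    _ ≤ 1 + ∑ j ∈ Finset.range (k + 1), |C' j| := by linarith [le_sum_abs_range C' hi]
    _ ≤ _ := le_self_pow₀ (by linarith) (by omega)

theorem fderiv (hf : JetBound m C f x) :
    JetBound m (fun k => C (k + 1)) (fderiv ℝ f) x := by
  refine ⟨hf.1.fderiv_right (by simp), fun k hk => ?_⟩
  rw [norm_iteratedFDeriv_fderiv]
  exact hf.2 (k + 1) (by omega)

end JetBound

theorem iteratedFDeriv_const_add_clm (L : E →L[ℝ] F) (c : F) (x : E) {k : ℕ} (hk : 2 ≤ k) :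
    iteratedFDeriv ℝ k (fun y => c + L y) x = 0 := by
  obtain ⟨k, rfl⟩ := Nat.exists_eq_add_of_le' hk
  rw [← norm_eq_zero, ← norm_iteratedFDeriv_fderiv]
  have : fderiv ℝ (fun y => c + L y) = fun _ => L := by
    ext1 y
    rw [fderiv_const_add]
    exact L.fderiv
  rw [this, iteratedFDeriv_const_of_ne (by omega)]
  simp

theorem jetBound_affine (L : E →L[ℝ] F) (c : F) (x : E) {K : ℝ} (h0 : ‖c + L x‖ ≤ K)
    (h1 : ‖L‖ ≤ K) : JetBound 0 (fun _ => K) (fun y => c + L y) x := by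
  refine ⟨contDiffAt_const.add L.contDiff.contDiffAt, fun k _ => ?_⟩
  rcases k with _ | _ | k
  · simpa using h0
  · rw [zero_add, ← norm_iteratedFDeriv_fderiv, norm_iteratedFDeriv_zero, fderiv_const_add]
    simpa using h1
  · rw [iteratedFDeriv_const_add_clm L c x (by omega), norm_zero]
    exact (norm_nonneg _).trans h1

theorem jetBound_one_affine (L : E →L[ℝ] F) (c : F) (x : E) {K : ℝ}
    (h1 : ‖L‖ ≤ K) : JetBound 1 (fun _ => K) (fun y => c + L y) x := by
  refine ⟨contDiffAt_const.add L.contDiff.contDiffAt, fun k hk => ?_⟩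
  rcases k with _ | _ | k
  · omega
  · rw [zero_add, ← norm_iteratedFDeriv_fderiv, norm_iteratedFDeriv_zero, fderiv_const_add]
    simpa using h1
  · rw [iteratedFDeriv_const_add_clm L c x (by omega), norm_zero]
    exact (norm_nonneg _).trans h1

end Jets

/-! ### Fixed point equations depending on parameters -/

section Implicit

universe u v

theorem exists_fixedPoint_of_norm_fderiv_le {F : Type*} [NormedAddCommGroup F] [NormedSpace ℝ F]
    [CompleteSpace F] {φ : F → F} {R : ℝ} (hR : 0 ≤ R)
    (hd : ∀ s ∈ Metric.closedBall (0 : F) R, DifferentiableAt ℝ φ s)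
    (hb : ∀ s ∈ Metric.closedBall (0 : F) R, ‖fderiv ℝ φ s‖ ≤ 1 / 2)
    (hm : ∀ s ∈ Metric.closedBall (0 : F) R, ‖φ s‖ ≤ R) :
    ∃ s ∈ Metric.closedBall (0 : F) R, φ s = s := by
  have hmaps : Set.MapsTo φ (Metric.closedBall 0 R) (Metric.closedBall 0 R) := fun s hs => by
    simpa using hm s hs
  have hlip : LipschitzOnWith (1 / 2 : NNReal) φ (Metric.closedBall 0 R) :=
    (convex_closedBall (0 : F) R).lipschitzOnWith_of_nnnorm_fderiv_le hd fun s hs => by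
      rw [← NNReal.coe_le_coe]
      simpa using hb s hs
  have hc : ContractingWith (1 / 2 : NNReal) (hmaps.restrict φ _ _) := by
    refine ⟨by rw [← NNReal.coe_lt_coe]; norm_num, ?_⟩
    exact LipschitzOnWith.mapsToRestrict hmaps hlip
  obtain ⟨y, hy, hfix, -⟩ := ContractingWith.exists_fixedPoint'
    (Metric.isClosed_closedBall.isComplete) hmaps hc (x := 0) (by simpa using hR) (edist_ne_top _ _)
  exact ⟨y, hy, hfix⟩

/-- A continuous solution `s` of `s y = κ (y, s y)` is smooth, by the inverse function theorem
applied to `(y, v) ↦ (y, v - κ (y, v))`. -/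
theorem contDiffAt_of_eventually_eq_fixedPoint {E F : Type*} [NormedAddCommGroup E]
    [NormedSpace ℝ E] [CompleteSpace E] [NormedAddCommGroup F] [NormedSpace ℝ F] [CompleteSpace F]
    {κ : E × F → F} {s : E → F} {x : E} (hκ : ContDiffAt ℝ ∞ κ (x, s x))
    (hd : ‖fderiv ℝ κ (x, s x)‖ < 1) (hs : ContinuousAt s x)
    (he : ∀ᶠ y in 𝓝 x, s y = κ (y, s y)) : ContDiffAt ℝ ∞ s x := by
  set N : E × F →L[ℝ] E × F := (ContinuousLinearMap.inr ℝ E F).comp (fderiv ℝ κ (x, s x)) with hN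
  have hN1 : ‖N‖ < 1 := by
    refine lt_of_le_of_lt (ContinuousLinearMap.opNorm_comp_le _ _) (lt_of_le_of_lt ?_ hd)
    exact mul_le_of_le_one_left (norm_nonneg _) (ContinuousLinearMap.norm_inr_le_one ℝ E F)
  set H : E × F → E × F := fun z => z - ContinuousLinearMap.inr ℝ E F (κ z) with hH
  let e : (E × F) ≃L[ℝ] (E × F) := ContinuousLinearEquiv.unitsEquiv ℝ (E × F) (Units.oneSub N hN1)
  have hHc : ContDiffAt ℝ ∞ H (x, s x) :=
    contDiffAt_id.sub ((ContinuousLinearMap.inr ℝ E F).contDiff.contDiffAt.comp _ hκ)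
  have hHd : HasFDerivAt H (e : E × F →L[ℝ] E × F) (x, s x) :=
    (hasFDerivAt_id _).sub ((ContinuousLinearMap.inr ℝ E F).hasFDerivAt.comp _
      (hκ.differentiableAt (by simp)).hasFDerivAt)
  have hinv := hHc.to_localInverse hHd (by simp)
  have hleft := (hHc.hasStrictFDerivAt' hHd (by simp)).eventually_left_inverse
  have hcont : ContinuousAt (fun y => (y, s y)) x := continuousAt_id.prodMk hs
  have hHx : H (x, s x) = (x, 0) := by
    have := he.self_of_nhds
    simp [hH, ← this]
  rw [hHx] at hinv
  have : ContDiffAt ℝ ∞ (fun y : E => (hHc.localInverse hHd (by simp) (y, (0 : F))).2) x :=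
    contDiffAt_snd.comp _ (hinv.comp x (contDiffAt_id.prodMk contDiffAt_const))
  refine this.congr_of_eventuallyEq ?_
  filter_upwards [hcont.eventually hleft, he] with y hy hy'
  have hHy : H (y, s y) = (y, 0) := by simp [hH, ← hy']
  rw [hHy] at hy
  exact (congrArg Prod.snd hy).symm

/-- The derivative of a solution `s` of `s y = κ (y, s y)` satisfies the linear equation
`Ds = ∂₁κ + ∂₂κ ∘ Ds`. -/
theorem fderiv_eq_of_eventually_eq_fixedPoint {E F : Type*} [NormedAddCommGroup E]
    [NormedSpace ℝ E] [NormedAddCommGroup F] [NormedSpace ℝ F]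
    {κ : E × F → F} {s : E → F} {x : E} (hκ : ContDiffAt ℝ ∞ κ (x, s x))
    (hs : ContDiffAt ℝ ∞ s x) (he : ∀ᶠ y in 𝓝 x, s y = κ (y, s y)) :
    ∀ᶠ y in 𝓝 x, fderiv ℝ s y =
      (fderiv ℝ κ (y, s y)).comp (ContinuousLinearMap.inl ℝ E F) +
      ((fderiv ℝ κ (y, s y)).comp (ContinuousLinearMap.inr ℝ E F)).comp (fderiv ℝ s y) := by
  have hcont : ContinuousAt (fun y => (y, s y)) x := continuousAt_id.prodMk hs.continuousAt
  have h1 : ∀ᶠ z in 𝓝 (x, s x), ContDiffAt ℝ (1 : ℕ) κ z :=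
    (hκ.of_le (by exact_mod_cast le_top)).eventually (by simp)
  have h2 : ∀ᶠ y in 𝓝 x, ContDiffAt ℝ (1 : ℕ) s y :=
    (hs.of_le (by exact_mod_cast le_top)).eventually (by simp)
  filter_upwards [hcont.eventually h1, h2, he.eventually_nhds] with y hy1 hy2 hy3
  have hk : DifferentiableAt ℝ κ (y, s y) := hy1.differentiableAt (by simp)
  have hsd : DifferentiableAt ℝ s y := hy2.differentiableAt (by simp)
  have hp : HasFDerivAt (fun y => (y, s y))
      ((ContinuousLinearMap.id ℝ E).prod (fderiv ℝ s y)) y :=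
    (hasFDerivAt_id y).prodMk hsd.hasFDerivAt
  have h3 : HasFDerivAt s ((fderiv ℝ κ (y, s y)).comp
      ((ContinuousLinearMap.id ℝ E).prod (fderiv ℝ s y))) y :=
    (HasFDerivAt.comp y hk.hasFDerivAt hp).congr_of_eventuallyEq hy3
  conv_lhs => rw [h3.fderiv]
  ext v
  simp [← map_add]

/-- One step of the induction on the order of differentiation: bounds for the derivatives of `s` up
to order `k` give a bound in order `k + 1`. -/
theorem norm_iteratedFDeriv_succ_le_of_eq_fixedPoint {E : Type u} {F : Type v}
    [NormedAddCommGroup E] [NormedSpace ℝ E] [NormedAddCommGroup F] [NormedSpace ℝ F]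
    {κ : E × F → F} {s : E → F} {x : E} {C : ℕ → ℝ} {t K : ℝ} {k : ℕ} (ht1 : t ≤ 1)
    (ht : 0 ≤ t) (hC1 : C 1 * t ≤ 1 / 2)
    (hκ : JetBound 0 (fun k => C k * t) κ (x, s x)) (hs : ContDiffAt ℝ ∞ s x)
    (he : ∀ᶠ y in 𝓝 x, s y = κ (y, s y)) (hK0 : 0 ≤ K)
    (hK : ∀ i ≤ k, ‖iteratedFDeriv ℝ i s x‖ ≤ K * t) :
    ‖iteratedFDeriv ℝ (k + 1) s x‖ ≤
      2 * (chainBound (fun k => C (k + 1)) (fun _ => 1 + K) k +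
        ∑ i ∈ Finset.range k, (k.choose (i + 1) : ℝ) *
          chainBound (fun k => C (k + 1)) (fun _ => 1 + K) (i + 1) * K) * t := by
  set W : E → (E × F →L[ℝ] F) := fun y => fderiv ℝ κ (y, s y) with hW
  set Q : ℕ → ℝ := chainBound (fun k => C (k + 1)) (fun _ => 1 + K) with hQ
  have hsn : ∀ k : ℕ, ContDiffAt ℝ k s x := fun k => hs.of_le (by exact_mod_cast le_top)
  have hgraph : ContDiffAt ℝ ∞ (fun y => (y, s y)) x := contDiffAt_id.prodMk hs
  have hWs : ContDiffAt ℝ ∞ W x :=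
    (hκ.1.fderiv_right (m := ∞) (by simp)).comp x hgraph
  have hWn : ∀ k : ℕ, ContDiffAt ℝ k W x := fun k => hWs.of_le (by exact_mod_cast le_top)
  have hDs : ContDiffAt ℝ ∞ (fderiv ℝ s) x := hs.fderiv_right (by simp)
  have hDsn : ∀ k : ℕ, ContDiffAt ℝ k (fderiv ℝ s) x := fun k =>
    hDs.of_le (by exact_mod_cast le_top)
  -- the derivatives of `y ↦ (y, s y)`
  have hgr : ∀ j, 1 ≤ j → j ≤ k → ‖iteratedFDeriv ℝ j (fun y => (y, s y)) x‖ ≤ 1 + K := by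
    intro j h1 hj
    have e1 : (fun y : E => (y, s y)) =
        (fun y => (0 + ContinuousLinearMap.inl ℝ E F y) + ContinuousLinearMap.inr ℝ E F (s y)) := by
      ext y <;> simp
    have h2 : ContDiffAt ℝ j (fun y : E => ContinuousLinearMap.inr ℝ E F (s y)) x :=
      (ContinuousLinearMap.inr ℝ E F).contDiff.contDiffAt.comp x (hsn j)
    have h3 := jetBound_one_affine (ContinuousLinearMap.inl ℝ E F) 0 x
      (ContinuousLinearMap.norm_inl_le_one ℝ E F)
    have h4 := iteratedFDeriv_add_apply (h3.contDiffAt_nat j) h2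
    rw [e1]
    change iteratedFDeriv ℝ j (fun y => _) x = _ at h4
    rw [show (fun y => 0 + ContinuousLinearMap.inl ℝ E F y + ContinuousLinearMap.inr ℝ E F (s y))
      = ((fun y => 0 + ContinuousLinearMap.inl ℝ E F y) +
        (fun y => ContinuousLinearMap.inr ℝ E F (s y))) from rfl]
    refine (h4 ▸ norm_add_le _ _).trans (add_le_add (h3.2 j h1) ?_)
    refine ((ContinuousLinearMap.inr ℝ E F).norm_iteratedFDeriv_comp_left (hsn j) le_rfl).trans ?_
    calc _ ≤ 1 * (K * t) := mul_le_mul (ContinuousLinearMap.norm_inr_le_one ℝ E F) (hK j hj)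
          (norm_nonneg _) zero_le_one
      _ ≤ K := by nlinarith
  -- the derivatives of `W`
  have hWb : ∀ i ≤ k, ‖iteratedFDeriv ℝ i W x‖ ≤ Q i * t := by
    intro i hi
    have hd := hκ.fderiv
    have := norm_iteratedFDeriv_comp_le_of_contDiffAt (n := i) (g := fderiv ℝ κ)
      (f := fun y => (y, s y)) (hd.contDiffAt_nat i)
      (hgraph.of_le (by exact_mod_cast le_top)) (R := 1 + ∑ j ∈ Finset.range (i + 1), |1 + K|)
      (fun j hj => (hd.2 j zero_le).trans
        (le_sum_abs_range (fun k => C (k + 1) * t) hj)) (fun j h1 hj => by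
          refine (hgr j h1 (hj.trans hi)).trans ?_
          have h5 : 1 + K ≤ 1 + ∑ j ∈ Finset.range (i + 1), |1 + K| := by
            linarith [le_sum_abs_range (fun _ => 1 + K) (le_refl i)]
          exact h5.trans (le_self_pow₀ (by linarith) (by omega)))
    rw [← chainBound_mul _ _ ht]
    exact this
  have hWinl : ‖iteratedFDeriv ℝ k (fun y => (W y).comp (ContinuousLinearMap.inl ℝ E F)) x‖ ≤
      Q k * t := by
    refine (((ContinuousLinearMap.compL ℝ E (E × F) F).flip
      (ContinuousLinearMap.inl ℝ E F)).norm_iteratedFDeriv_comp_left (hWn k) le_rfl).trans ?_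
    refine (mul_le_mul ?_ (hWb k le_rfl) (norm_nonneg _) zero_le_one).trans_eq (one_mul _)
    refine ContinuousLinearMap.opNorm_le_bound _ zero_le_one fun T => ?_
    refine (ContinuousLinearMap.opNorm_comp_le _ _).trans ?_
    rw [mul_comm]
    exact mul_le_mul_of_nonneg_right (ContinuousLinearMap.norm_inl_le_one ℝ E F) (norm_nonneg _)
  have hflip : ‖(ContinuousLinearMap.compL ℝ F (E × F) F).flip
      (ContinuousLinearMap.inr ℝ E F)‖ ≤ 1 := by
    refine ContinuousLinearMap.opNorm_le_bound _ zero_le_one fun T => ?_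
    refine (ContinuousLinearMap.opNorm_comp_le _ _).trans ?_
    rw [mul_comm]
    exact mul_le_mul_of_nonneg_right (ContinuousLinearMap.norm_inr_le_one ℝ E F) (norm_nonneg _)
  have hinr : ∀ i : ℕ, ContDiffAt ℝ i (fun y => (W y).comp (ContinuousLinearMap.inr ℝ E F)) x :=
    fun i => ((ContinuousLinearMap.compL ℝ F (E × F) F).flip
      (ContinuousLinearMap.inr ℝ E F)).contDiff.contDiffAt.comp x (hWn i)
  have hinl : ∀ i : ℕ, ContDiffAt ℝ i (fun y => (W y).comp (ContinuousLinearMap.inl ℝ E F)) x :=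
    fun i => ((ContinuousLinearMap.compL ℝ E (E × F) F).flip
      (ContinuousLinearMap.inl ℝ E F)).contDiff.contDiffAt.comp x (hWn i)
  have hWinr : ∀ i ≤ k,
      ‖iteratedFDeriv ℝ i (fun y => (W y).comp (ContinuousLinearMap.inr ℝ E F)) x‖ ≤
        ‖iteratedFDeriv ℝ i W x‖ := by
    intro i hi
    refine (((ContinuousLinearMap.compL ℝ F (E × F) F).flip
      (ContinuousLinearMap.inr ℝ E F)).norm_iteratedFDeriv_comp_left (hWn i) le_rfl).trans ?_
    exact (mul_le_mul_of_nonneg_right hflip (norm_nonneg _)).trans_eq (one_mul _)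
  have heq := fderiv_eq_of_eventually_eq_fixedPoint hκ.1 hs he
  set a := ‖iteratedFDeriv ℝ (k + 1) s x‖ with ha
  have ha0 : 0 ≤ a := norm_nonneg _
  have h0 : ‖iteratedFDeriv ℝ 0 W x‖ ≤ 1 / 2 := by
    rw [norm_iteratedFDeriv_zero]
    exact (hκ.norm_fderiv_le zero_le_one).trans hC1
  have hmain : a ≤ Q k * t + (1 / 2 * a + ∑ i ∈ Finset.range k,
      (k.choose (i + 1) : ℝ) * (Q (i + 1) * t) * K) := by
    have e2 : a = ‖iteratedFDeriv ℝ k (fderiv ℝ s) x‖ := norm_iteratedFDeriv_fderiv.symm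
    refine e2.trans_le ?_
    rw [(Filter.EventuallyEq.iteratedFDeriv ℝ heq k).eq_of_nhds]
    have h6 := iteratedFDeriv_add_apply (x := x) (i := k) (hinl k) ((hinr k).clm_comp (hDsn k))
    change iteratedFDeriv ℝ k (fun y => _) x = _ at h6
    refine (h6 ▸ norm_add_le _ _).trans (add_le_add hWinl ?_)
    refine (norm_iteratedFDeriv_bilinear_le_of_contDiffAt (ContinuousLinearMap.compL ℝ E F F)
      (ContinuousLinearMap.norm_compL_le ℝ E F F) (hinr k) (hDsn k)).trans ?_
    rw [Finset.sum_range_succ', add_comm]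
    refine add_le_add ?_ (Finset.sum_le_sum fun i hi => ?_)
    · simp only [Nat.choose_zero_right, Nat.cast_one, one_mul, Nat.sub_zero]
      rw [← e2]
      exact mul_le_mul_of_nonneg_right ((hWinr 0 zero_le).trans h0) ha0
    · rw [Finset.mem_range] at hi
      have h7 := (hWinr (i + 1) (by omega)).trans (hWb (i + 1) (by omega))
      have h8 : ‖iteratedFDeriv ℝ (k - (i + 1)) (fderiv ℝ s) x‖ ≤ K := by
        rw [norm_iteratedFDeriv_fderiv]
        exact (hK _ (by omega)).trans (mul_le_of_le_one_right hK0 ht1)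
      have h9 : 0 ≤ Q (i + 1) * t := (norm_nonneg _).trans h7
      gcongr
  have h10 : ∑ i ∈ Finset.range k, (k.choose (i + 1) : ℝ) * (Q (i + 1) * t) * K =
      (∑ i ∈ Finset.range k, (k.choose (i + 1) : ℝ) * Q (i + 1) * K) * t := by
    rw [Finset.sum_mul]
    exact Finset.sum_congr rfl fun i _ => by ring
  rw [h10] at hmain
  linarith

/-- A solution `s` of the fixed point equation `s y = κ (y, s y)` inherits from `κ` bounds for its
derivatives of all orders, proportional to the same small factor `t`. -/
theorem exists_jetBound_of_eq_fixedPoint (C : ℕ → ℝ) : ∃ K : ℕ → ℝ, ∀ (E : Type u) (F : Type v)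
    [NormedAddCommGroup E] [NormedSpace ℝ E] [NormedAddCommGroup F] [NormedSpace ℝ F]
    (κ : E × F → F) (s : E → F) (x : E) (t : ℝ), 0 ≤ t → t ≤ 1 → C 1 * t ≤ 1 / 2 →
    JetBound 0 (fun k => C k * t) κ (x, s x) → ContDiffAt ℝ ∞ s x →
    (∀ᶠ y in 𝓝 x, s y = κ (y, s y)) → JetBound 0 (fun k => K k * t) s x := by
  have key : ∀ k : ℕ, ∃ K : ℝ, 0 ≤ K ∧ ∀ (E : Type u) (F : Type v)
      [NormedAddCommGroup E] [NormedSpace ℝ E] [NormedAddCommGroup F] [NormedSpace ℝ F]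
      (κ : E × F → F) (s : E → F) (x : E) (t : ℝ), 0 ≤ t → t ≤ 1 → C 1 * t ≤ 1 / 2 →
      JetBound 0 (fun k => C k * t) κ (x, s x) → ContDiffAt ℝ ∞ s x →
      (∀ᶠ y in 𝓝 x, s y = κ (y, s y)) → ∀ i ≤ k, ‖iteratedFDeriv ℝ i s x‖ ≤ K * t := by
    intro k
    induction k with
    | zero =>
      refine ⟨|C 0|, abs_nonneg _, fun E F _ _ _ _ κ s x t ht ht1 hC1 hκ hs he i hi => ?_⟩
      obtain rfl : i = 0 := by omega
      rw [norm_iteratedFDeriv_zero, he.self_of_nhds]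
      exact hκ.norm_le.trans (mul_le_mul_of_nonneg_right (le_abs_self _) ht)
    | succ k ih =>
      obtain ⟨K, hK0, hK⟩ := ih
      refine ⟨max K (2 * (chainBound (fun k => C (k + 1)) (fun _ => 1 + K) k +
        ∑ i ∈ Finset.range k, (k.choose (i + 1) : ℝ) *
          chainBound (fun k => C (k + 1)) (fun _ => 1 + K) (i + 1) * K)), le_max_of_le_left hK0,
        fun E F _ _ _ _ κ s x t ht ht1 hC1 hκ hs he i hi => ?_⟩
      rcases Nat.lt_or_ge k i with h | h
      · obtain rfl : i = k + 1 := by omega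
        exact (norm_iteratedFDeriv_succ_le_of_eq_fixedPoint ht1 ht hC1 hκ hs he hK0
          (hK E F κ s x t ht ht1 hC1 hκ hs he)).trans
          (mul_le_mul_of_nonneg_right (le_max_right _ _) ht)
      · exact (hK E F κ s x t ht ht1 hC1 hκ hs he i h).trans
          (mul_le_mul_of_nonneg_right (le_max_left _ _) ht)
  choose K _ hK using key
  exact ⟨K, fun E F _ _ _ _ κ s x t ht ht1 hC1 hκ hs he =>
    ⟨hs, fun k _ => hK k E F κ s x t ht ht1 hC1 hκ hs he k le_rfl⟩⟩

end Implicit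

/-! ### Separated families and approximating flats -/

section Separated

/-- A maximal `ε`-separated subset of `R` is an `ε`-net of `R`. -/
theorem exists_separated_net {α : Type*} [PseudoMetricSpace α] (R : Set α) {ε : ℝ} (hε : 0 < ε) :
    ∃ T ⊆ R, (∀ s ∈ T, ∀ s' ∈ T, s ≠ s' → ε ≤ dist s s') ∧ ∀ x ∈ R, ∃ s ∈ T, dist x s < ε := by
  obtain ⟨T, hT⟩ := zorn_subset
    {T : Set α | T ⊆ R ∧ ∀ s ∈ T, ∀ s' ∈ T, s ≠ s' → ε ≤ dist s s'} (by
    intro c hc hchain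
    refine ⟨⋃₀ c, ⟨Set.sUnion_subset fun t ht => (hc ht).1, ?_⟩, fun t ht =>
      Set.subset_sUnion_of_mem ht⟩
    rintro s ⟨t, ht, hst⟩ s' ⟨t', ht', hst'⟩ hne
    rcases hchain.total ht ht' with h | h
    · exact (hc ht').2 s (h hst) s' hst' hne
    · exact (hc ht).2 s hst s' (h hst') hne)
  refine ⟨T, hT.prop.1, hT.prop.2, fun x hx => ?_⟩
  by_contra! hcon
  have hxT : x ∉ T := fun h => by
    have := hcon x h
    rw [dist_self] at this
    linarith
  refine hxT (hT.le_of_ge (y := insert x T) ⟨Set.insert_subset hx hT.prop.1, ?_⟩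
    (Set.subset_insert x T) (Set.mem_insert x T))
  rintro s (rfl | hs) s' (rfl | hs') hne
  · exact absurd rfl hne
  · exact hcon s' hs'
  · rw [dist_comm]; exact hcon s hs
  · exact hT.prop.2 s hs s' hs' hne

/-- Among sufficiently many points of a ball in `n`-dimensional Euclidean space, two are close. -/
theorem exists_dist_lt_of_norm_le (n : ℕ) {R ε : ℝ} (hε : 0 < ε) : ∃ N : ℕ,
    ∀ p : Fin N → EuclideanSpace ℝ (Fin n), (∀ i, ‖p i‖ ≤ R) →
      ∃ i j, i < j ∧ dist (p i) (p j) < ε := by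
  obtain ⟨t, ht, hcov⟩ := Metric.totallyBounded_iff.1
    (isCompact_closedBall (0 : EuclideanSpace ℝ (Fin n)) R).totallyBounded (ε / 2) (by linarith)
  refine ⟨ht.toFinset.card + 1, fun p hp => ?_⟩
  have hc : ∀ i, ∃ y ∈ ht.toFinset, dist (p i) y < ε / 2 := fun i => by
    have := hcov (show p i ∈ Metric.closedBall 0 R by simpa using hp i)
    simpa using this
  choose y hy hd using hc
  obtain ⟨i, -, j, -, hij, he⟩ := Finset.exists_ne_map_eq_of_card_lt_of_maps_to
    (s := Finset.univ) (t := ht.toFinset) (by simp) (f := y) (fun i _ => hy i)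
  have hdist : dist (p i) (p j) < ε := by
    have h1 := hd i
    have h2 := hd j
    rw [← he, dist_comm] at h2
    linarith [dist_triangle (p i) (y i) (p j)]
  rcases lt_or_gt_of_ne hij with h | h
  · exact ⟨i, j, h, hdist⟩
  · exact ⟨j, i, h, by rwa [dist_comm]⟩

end Separated

section Flats

universe u

variable {E : Type u} [NormedAddCommGroup E] [InnerProductSpace ℝ E]

/-- The orthogonal projection onto the affine subspace through `q` with direction `V`. -/
noncomputable def flatProj (V : Submodule ℝ E) [FiniteDimensional ℝ V] (q y : E) : E :=
  q + V.starProjection (y - q)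

/-- Near each of its points `q`, up to the scale `1`, the set `X` is `η`-close to the
`n`-dimensional affine subspace through `q` with direction `V q`. This is closeness to flats at
scale `1` with a choice of flats, in terms of points. -/
structure IsFlatApprox (n : ℕ) (η : ℝ) (X : Set E) (V : E → Submodule ℝ E)
    [∀ q, FiniteDimensional ℝ (V q)] : Prop where
  finrank_eq : ∀ q ∈ X, Module.finrank ℝ (V q) = n
  near_flat : ∀ q ∈ X, ∀ x ∈ X, ‖x - q‖ < 1 → ‖(x - q) - (V q).starProjection (x - q)‖ < η
  near_set : ∀ q ∈ X, ∀ v ∈ V q, ‖v‖ < 1 → ∃ x ∈ X, ‖x - (q + v)‖ < η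

theorem exists_isFlatApprox {n : ℕ} {δ η : ℝ} {X : Set E} (hδη : δ < η) (hη : 0 < η)
    (h : IsCloseToFlats n δ 1 X) : ∃ (V : E → Submodule ℝ E)
      (_ : ∀ q, FiniteDimensional ℝ (V q)), IsFlatApprox n η X V := by
  choose! A hA hfd hrk hd using h
  have hlt : ENNReal.ofReal δ < ENNReal.ofReal η := (ENNReal.ofReal_lt_ofReal_iff hη).2 hδη
  obtain ⟨V, hVfd, hV⟩ : ∃ V : E → Submodule ℝ E, (∀ q, FiniteDimensional ℝ (V q)) ∧
      ∀ q ∈ X, V q = (A q).direction := by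
    have : ∀ q, ∃ W : Submodule ℝ E, FiniteDimensional ℝ W ∧ (q ∈ X → W = (A q).direction) := by
      intro q
      by_cases hq : q ∈ X
      · exact ⟨_, hfd q hq, fun _ => rfl⟩
      · exact ⟨⊥, inferInstance, fun h => absurd h hq⟩
    choose V hV using this
    exact ⟨V, fun q => (hV q).1, fun q => (hV q).2⟩
  refine ⟨V, hVfd, ⟨fun q hq => ?_, fun q hq x hx hxq => ?_, fun q hq v hv hv1 => ?_⟩⟩
  · rw [hV q hq]; exact hrk q hq
  · obtain ⟨a, ⟨haA, -⟩, hae⟩ := Metric.exists_edist_lt_of_hausdorffEDist_lt (x := x)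
      (show x ∈ X ∩ Metric.ball q 1 from ⟨hx, by simpa [dist_eq_norm] using hxq⟩)
      ((hd q hq).trans_lt hlt)
    have hax : ‖x - a‖ < η := by
      rwa [edist_dist, ENNReal.ofReal_lt_ofReal_iff hη, dist_eq_norm] at hae
    have haV : a - q ∈ V q := by
      rw [hV q hq]
      exact AffineSubspace.vsub_mem_direction haA (hA q hq)
    refine lt_of_le_of_lt ?_ hax
    rw [(V q).starProjection_minimal (x - q)]
    refine (ciInf_le ⟨0, ?_⟩ (⟨a - q, haV⟩ : V q)).trans (by simp)
    rintro _ ⟨w, rfl⟩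
    exact norm_nonneg _
  · rw [hV q hq] at hv
    have hmem : q + v ∈ (A q : Set E) := by
      rw [add_comm]; exact AffineSubspace.vadd_mem_of_mem_direction hv (hA q hq)
    obtain ⟨x, ⟨hx, -⟩, hae⟩ := Metric.exists_edist_lt_of_hausdorffEDist_lt (x := q + v)
      (show q + v ∈ (A q : Set E) ∩ Metric.ball q 1 from ⟨hmem, by simpa [dist_eq_norm] using hv1⟩)
      (by rw [Metric.hausdorffEDist_comm]; exact (hd q hq).trans_lt hlt)
    refine ⟨x, hx, ?_⟩
    rwa [edist_dist, ENNReal.ofReal_lt_ofReal_iff hη, dist_eq_norm, norm_sub_rev] at hae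

variable {n : ℕ} {η : ℝ} {X : Set E} {V : E → Submodule ℝ E} [∀ q, FiniteDimensional ℝ (V q)]

theorem norm_sub_starProjection_le (W : Submodule ℝ E) [FiniteDimensional ℝ W] (v : E) :
    ‖v - W.starProjection v‖ ≤ ‖v‖ := by
  have := Wᗮ.norm_starProjection_apply_le v
  rwa [W.starProjection_orthogonal_val] at this

theorem starProjection_idem (W : Submodule ℝ E) [FiniteDimensional ℝ W] (v : E) :
    W.starProjection (W.starProjection v) = W.starProjection v :=
  W.starProjection_eq_self_iff.2 (W.starProjection_apply_mem v)

theorem flatProj_flatProj (W : Submodule ℝ E) [FiniteDimensional ℝ W] (q y : E) :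
    flatProj W q (flatProj W q y) = flatProj W q y := by
  simp [flatProj, starProjection_idem]

theorem norm_flatProj_sub_le (W : Submodule ℝ E) [FiniteDimensional ℝ W] (q y : E) :
    ‖flatProj W q y - q‖ ≤ ‖y - q‖ := by
  simpa [flatProj] using W.norm_starProjection_apply_le (y - q)

/-- If every vector of `W'` is almost in `W` and conversely, the projections are close. -/
theorem norm_starProjection_sub_le {W W' : Submodule ℝ E} [FiniteDimensional ℝ W]
    [FiniteDimensional ℝ W'] {c : ℝ} (hc : 0 ≤ c)
    (h : ∀ v ∈ W', ‖v - W.starProjection v‖ ≤ c * ‖v‖)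
    (h' : ∀ v ∈ W, ‖v - W'.starProjection v‖ ≤ c * ‖v‖) :
    ‖W'.starProjection - W.starProjection‖ ≤ 2 * c := by
  refine ContinuousLinearMap.opNorm_le_bound _ (by linarith) fun u => ?_
  have h1 : ‖W'.starProjection u - W.starProjection (W'.starProjection u)‖ ≤ c * ‖u‖ :=
    (h _ (W'.starProjection_apply_mem u)).trans
      (mul_le_mul_of_nonneg_left (W'.norm_starProjection_apply_le u) hc)
  have h2 : ‖W.starProjection (u - W'.starProjection u)‖ ≤ c * ‖u‖ := by
    set w := W.starProjection (u - W'.starProjection u) with hw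
    rcases eq_or_ne w 0 with h0 | h0
    · rw [h0, norm_zero]; positivity
    have hpos : 0 < ‖w‖ := norm_pos_iff.2 h0
    have hwW : w ∈ W := W.starProjection_apply_mem _
    have e1 : ‖w‖ ^ 2 = inner ℝ (w - W'.starProjection w) u := by
      rw [← real_inner_self_eq_norm_sq]
      conv_lhs => rw [hw]
      rw [W.inner_starProjection_left_eq_right, W.starProjection_eq_self_iff.2 hwW,
        inner_sub_left, inner_sub_left, W'.inner_starProjection_left_eq_right,
        real_inner_comm, real_inner_comm (W'.starProjection w) u]
    have e2 : ‖w‖ ^ 2 ≤ c * ‖w‖ * ‖u‖ := by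
      rw [e1]
      exact (real_inner_le_norm _ _).trans
        (mul_le_mul_of_nonneg_right (h' w hwW) (norm_nonneg _))
    have e3 : ‖w‖ * ‖w‖ ≤ ‖w‖ * (c * ‖u‖) := by nlinarith
    exact le_of_mul_le_mul_left e3 hpos
  have e : (W'.starProjection - W.starProjection) u =
      (W'.starProjection u - W.starProjection (W'.starProjection u)) -
        W.starProjection (u - W'.starProjection u) := by
    simp
  rw [e]
  exact (norm_sub_le _ _).trans (by linarith)

namespace IsFlatApprox

theorem norm_sub_starProjection_le_of_mem (h : IsFlatApprox n η X V) (hη : η < 1 / 100)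
    {q q' : E} (hq : q ∈ X) (hq' : q' ∈ X) (hqq : ‖q - q'‖ ≤ 97 / 100) {v : E} (hv : v ∈ V q') :
    ‖v - (V q).starProjection v‖ ≤ 150 * η * ‖v‖ := by
  rcases eq_or_ne v 0 with h0 | h0
  · simp [h0]
  have hpos : 0 < ‖v‖ := norm_pos_iff.2 h0
  set w : E := (1 / 50 / ‖v‖) • v with hw
  have hwn : ‖w‖ = 1 / 50 := by
    rw [hw, norm_smul, Real.norm_of_nonneg (by positivity)]; field_simp
  obtain ⟨x, hx, hxw⟩ := h.near_set q' hq' w ((V q').smul_mem _ hv) (by rw [hwn]; norm_num)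
  have h1 : ‖x - q‖ < 1 := by
    have e : x - q = (x - (q' + w)) + w - (q - q') := by abel
    have := norm_sub_le ((x - (q' + w)) + w) (q - q')
    have := norm_add_le (x - (q' + w)) w
    rw [e]; linarith
  have h2 := h.near_flat q hq x hx h1
  have h3 := h.near_flat q hq q' hq' (by rw [norm_sub_rev]; linarith)
  have h4 := norm_sub_starProjection_le (V q) (x - (q' + w))
  have e : w - (V q).starProjection w = ((x - q) - (V q).starProjection (x - q)) -
      ((q' - q) - (V q).starProjection (q' - q)) -
      ((x - (q' + w)) - (V q).starProjection (x - (q' + w))) := by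
    simp only [map_sub, map_add]; abel
  have h5 : ‖w - (V q).starProjection w‖ ≤ 3 * η := by
    rw [e]
    refine (norm_sub_le _ _).trans ?_
    have := norm_sub_le ((x - q) - (V q).starProjection (x - q))
      ((q' - q) - (V q).starProjection (q' - q))
    linarith
  have e2 : v - (V q).starProjection v = (50 * ‖v‖) • (w - (V q).starProjection w) := by
    have : v = (50 * ‖v‖) • w := by
      rw [hw, smul_smul, show 50 * ‖v‖ * (1 / 50 / ‖v‖) = 1 by field_simp, one_smul]
    conv_lhs => rw [this]
    rw [map_smul, smul_sub]
  rw [e2, norm_smul, Real.norm_of_nonneg (by positivity)]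
  nlinarith

theorem norm_starProjection_sub_le (h : IsFlatApprox n η X V) (hη : η < 1 / 100) (hη0 : 0 ≤ η)
    {q q' : E} (hq : q ∈ X) (hq' : q' ∈ X) (hqq : ‖q - q'‖ ≤ 97 / 100) :
    ‖(V q').starProjection - (V q).starProjection‖ ≤ 300 * η := by
  refine (_root_.norm_starProjection_sub_le (c := 150 * η) (by linarith) (fun v hv =>
    h.norm_sub_starProjection_le_of_mem hη hq hq' hqq hv) fun v hv =>
    h.norm_sub_starProjection_le_of_mem hη hq' hq (by rwa [norm_sub_rev]) hv).trans_eq (by ring)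

/-- The projections onto the flats at two points of `X` nearby differ little. -/
theorem norm_flatProj_sub_flatProj_le (h : IsFlatApprox n η X V) (hη : η < 1 / 100)
    (hη0 : 0 ≤ η) {q q' : E} (hq : q ∈ X) (hq' : q' ∈ X) (hqq : ‖q - q'‖ ≤ 97 / 100) (y : E)
    (hy : ‖y - q'‖ ≤ 1) :
    ‖flatProj (V q') q' y - flatProj (V q) q y‖ ≤ 301 * η := by
  have e : flatProj (V q') q' y - flatProj (V q) q y =
      ((q' - q) - (V q).starProjection (q' - q)) +
      ((V q').starProjection - (V q).starProjection) (y - q') := by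
    simp only [flatProj, map_sub, sub_apply]; abel
  have h1 := h.near_flat q hq q' hq' (by rw [norm_sub_rev]; linarith)
  have h2 := ((V q').starProjection - (V q).starProjection).le_opNorm (y - q')
  have h3 := h.norm_starProjection_sub_le hη hη0 hq hq' hqq
  rw [e]
  refine (norm_add_le _ _).trans ?_
  have : ‖(V q').starProjection - (V q).starProjection‖ * ‖y - q'‖ ≤ 300 * η * 1 := by gcongr
  linarith

end IsFlatApprox

/-- `X` has an `ε`-net which is a union of boundedly many `10 ε`-separated sets, `ε = 1 / 100`.
These are built greedily: each is a maximal separated subset of what the previous ones leave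
uncovered. A point still uncovered after `N` steps would have close to it `N` points of `X`,
pairwise not close, which is impossible for large `N` since they lie near an `n`-dimensional flat.
-/
theorem exists_separated_families (n : ℕ) : ∃ N : ℕ, ∀ (E : Type u) [NormedAddCommGroup E]
    [InnerProductSpace ℝ E] (X : Set E) (V : E → Submodule ℝ E) [∀ q, FiniteDimensional ℝ (V q)]
    (η : ℝ), η < 1 / 400 → IsFlatApprox n η X V →
    ∃ S : ℕ → Set E, (∀ c, S c ⊆ X) ∧
      (∀ c, ∀ s ∈ S c, ∀ s' ∈ S c, s ≠ s' → 1 / 10 ≤ dist s s') ∧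
      ∀ x ∈ X, ∃ c < N, ∃ s ∈ S c, dist x s < 1 / 100 := by
  obtain ⟨N, hN⟩ := exists_dist_lt_of_norm_le n (R := 1) (ε := 1 / 200) (by norm_num)
  refine ⟨N, fun E _ _ X V _ η hη h => ?_⟩
  choose T hTsub hTsep hTnet using fun R : Set E =>
    exists_separated_net R (ε := 1 / 10) (by norm_num)
  let R : ℕ → Set E := fun c => Nat.rec X (fun _ R => {x ∈ R | ∀ s ∈ T R, 1 / 100 ≤ dist x s}) c
  have hRsucc : ∀ c, R (c + 1) = {x ∈ R c | ∀ s ∈ T (R c), 1 / 100 ≤ dist x s} := fun c => rfl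
  have hRanti : Antitone R := antitone_nat_of_succ_le fun c x hx => by
    rw [hRsucc] at hx; exact hx.1
  have hRX : ∀ c, R c ⊆ X := fun c => hRanti (Nat.zero_le c)
  refine ⟨fun c => T (R c), fun c => (hTsub _).trans (hRX c), fun c => hTsep _, fun x hx => ?_⟩
  by_contra! hcon
  have hxR : ∀ c ≤ N, x ∈ R c := by
    intro c
    induction c with
    | zero => exact fun _ => hx
    | succ c ih => exact fun hc => ⟨ih (by omega), hcon c (by omega)⟩
  have hs : ∀ i : Fin N, ∃ s ∈ T (R i), dist x s < 1 / 10 := fun i =>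
    hTnet _ x (hxR i i.2.le)
  choose s hs hxs using hs
  have hsX : ∀ i, s i ∈ X := fun i => hRX i (hTsub _ (hs i))
  let L : V x ≃ₗᵢ[ℝ] EuclideanSpace ℝ (Fin n) :=
    ((stdOrthonormalBasis ℝ (V x)).reindex (finCongr (h.finrank_eq x hx))).repr
  have hxs' : ∀ i, ‖s i - x‖ < 1 / 10 := fun i => by
    rw [← dist_eq_norm, dist_comm]; exact hxs i
  obtain ⟨i, j, hij, hd⟩ := hN (fun i => L ((V x).orthogonalProjectionOnto (s i - x))) fun i => by
    rw [L.norm_map]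
    exact ((V x).norm_orthogonalProjectionOnto_apply_le _).trans (by linarith [hxs' i])
  rw [L.dist_map, dist_eq_norm, ← map_sub] at hd
  have hd' : ‖(V x).starProjection (s i - x - (s j - x))‖ < 1 / 200 := hd
  have hsep : 1 / 100 ≤ dist (s j) (s i) := by
    have h1 : s j ∈ R (i + 1) := hRanti (show (i : ℕ) + 1 ≤ j from hij) (hTsub _ (hs j))
    exact h1.2 _ (hs i)
  have h1 := h.near_flat x hx _ (hsX i) (by linarith [hxs' i])
  have h2 := h.near_flat x hx _ (hsX j) (by linarith [hxs' j])
  have e : s j - s i = (s j - x - (V x).starProjection (s j - x)) -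
      (s i - x - (V x).starProjection (s i - x)) -
        (V x).starProjection (s i - x - (s j - x)) := by
    simp only [map_sub]; abel
  rw [dist_eq_norm, e] at hsep
  have h3 := norm_sub_le ((s j - x - (V x).starProjection (s j - x)) -
      (s i - x - (V x).starProjection (s i - x))) ((V x).starProjection (s i - x - (s j - x)))
  have h4 := norm_sub_le (s j - x - (V x).starProjection (s j - x))
      (s i - x - (V x).starProjection (s i - x))
  linarith

end Flats

/-! ### Step maps -/

section StepMaps

universe u

/-- A smooth cutoff function of the squared distance: it is `1` up to distance `3 / 100` and
vanishes from distance `4 / 100` on. -/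
noncomputable def cutoff (t : ℝ) : ℝ := Real.smoothTransition ((16 / 10000 - t) / (7 / 10000))

theorem contDiff_cutoff : ContDiff ℝ ∞ cutoff :=
  Real.smoothTransition.contDiff.comp ((contDiff_const.sub contDiff_id).div_const _)

theorem cutoff_eq_one {t : ℝ} (h : t ≤ 9 / 10000) : cutoff t = 1 :=
  Real.smoothTransition.one_of_one_le (by rw [le_div_iff₀ (by norm_num)]; linarith)

theorem cutoff_eq_zero {t : ℝ} (h : 16 / 10000 ≤ t) : cutoff t = 0 :=
  Real.smoothTransition.zero_of_nonpos (div_nonpos_of_nonpos_of_nonneg (by linarith) (by norm_num))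

theorem exists_cutoff_jetBound : ∃ C : ℕ → ℝ, ∀ t ∈ Set.Icc (0 : ℝ) 1, JetBound 0 C cutoff t := by
  have : ∀ k : ℕ, ∃ C : ℝ, ∀ t ∈ Set.Icc (0 : ℝ) 1, ‖iteratedFDeriv ℝ k cutoff t‖ ≤ C := fun k =>
    isCompact_Icc.exists_bound_of_continuousOn
      (contDiff_cutoff.continuous_iteratedFDeriv (by exact_mod_cast le_top)).continuousOn
  choose C hC using this
  exact ⟨C, fun t ht => ⟨contDiff_cutoff.contDiffAt, fun k _ => hC k t ht⟩⟩

variable {E : Type u} [NormedAddCommGroup E] [InnerProductSpace ℝ E]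

/-- The smooth bump about `s`. -/
noncomputable def bump {E : Type*} [NormedAddCommGroup E] (s y : E) : ℝ := cutoff (‖y - s‖ ^ 2)

theorem bump_nonneg {E : Type*} [NormedAddCommGroup E] (s y : E) : 0 ≤ bump s y :=
  Real.smoothTransition.nonneg _

theorem bump_le_one {E : Type*} [NormedAddCommGroup E] (s y : E) : bump s y ≤ 1 :=
  Real.smoothTransition.le_one _

theorem bump_eq_one {E : Type*} [NormedAddCommGroup E] {s y : E} (h : ‖y - s‖ ≤ 3 / 100) :
    bump s y = 1 :=
  cutoff_eq_one (by nlinarith [norm_nonneg (y - s)])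

theorem bump_eq_zero {E : Type*} [NormedAddCommGroup E] {s y : E} (h : 4 / 100 ≤ ‖y - s‖) :
    bump s y = 0 :=
  cutoff_eq_zero (by nlinarith [norm_nonneg (y - s)])

theorem chainBound_nonneg (C C' : ℕ → ℝ) (k : ℕ) : 0 ≤ chainBound C C' k := by
  have h1 : 0 ≤ ∑ i ∈ Finset.range (k + 1), |C i| := Finset.sum_nonneg fun _ _ => abs_nonneg _
  have h2 : 0 ≤ ∑ i ∈ Finset.range (k + 1), |C' i| := Finset.sum_nonneg fun _ _ => abs_nonneg _
  unfold chainBound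
  positivity

theorem leibnizBound_nonneg {C C' : ℕ → ℝ} (h : ∀ k, 0 ≤ C k) (h' : ∀ k, 0 ≤ C' k) (k : ℕ) :
    0 ≤ leibnizBound C C' k :=
  Finset.sum_nonneg fun _ _ => mul_nonneg (mul_nonneg (Nat.cast_nonneg _) (h _)) (h' _)

/-- Bounds for the derivatives of a bump, independent of its centre and of the space. -/
noncomputable def bumpBound : ℕ → ℝ :=
  chainBound exists_cutoff_jetBound.choose (leibnizBound (fun _ => 1) fun _ => 1)

theorem bumpBound_nonneg (k : ℕ) : 0 ≤ bumpBound k := chainBound_nonneg _ _ _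

theorem jetBound_bump {s y : E} (h : ‖y - s‖ ≤ 1) : JetBound 0 bumpBound (bump s) y := by
  have h1 : JetBound 0 (fun _ => 1) (fun z : E => -s + ContinuousLinearMap.id ℝ E z) y :=
    jetBound_affine _ _ _ (by simpa [add_comm, ← sub_eq_add_neg] using h)
      ContinuousLinearMap.norm_id_le
  have hB : ‖innerSL ℝ (E := E)‖ ≤ 1 := by
    refine ContinuousLinearMap.opNorm_le_bound _ zero_le_one fun v => ?_
    rw [innerSL_apply_norm, one_mul]
  have h2 := (h1.bilinear h1 (innerSL ℝ) hB).of_le zero_le_one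
  have e : ∀ z : E, innerSL ℝ (-s + ContinuousLinearMap.id ℝ E z)
      (-s + ContinuousLinearMap.id ℝ E z) = ‖z - s‖ ^ 2 := fun z => by
    rw [ContinuousLinearMap.id_apply, neg_add_eq_sub, innerSL_apply_apply,
      real_inner_self_eq_norm_sq]
  simp only [e] at h2
  exact (exists_cutoff_jetBound.choose_spec _
    ⟨by positivity, by nlinarith [norm_nonneg (y - s)]⟩).comp h2

variable (V : E → Submodule ℝ E) [∀ q, FiniteDimensional ℝ (V q)] (S : Set E)

open Classical in
/-- The weight at `y` of the family of flats at the points of `S`: at most one of these points is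
near `y`, and the weight is the bump centred there. -/
noncomputable def stepWeight (y : E) : ℝ :=
  if h : ∃ s ∈ S, ‖y - s‖ < 1 / 20 then bump h.choose y else 0

open Classical in
/-- Near a point `s` of the separated set `S`, move `y` towards the flat at `s` by the fraction
`bump s y` of its distance. -/
noncomputable def stepMap (y : E) : E :=
  if h : ∃ s ∈ S, ‖y - s‖ < 1 / 20 then
    y + bump h.choose y • (flatProj (V h.choose) h.choose y - y) else y

/-- What `stepMap` does besides moving `y` towards the flat at the reference point `q`. -/
noncomputable def stepError (q y : E) : E :=
  stepMap V S y - y + stepWeight S y • (y - flatProj (V q) q y)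

variable {V S}

theorem stepMap_eq (q y : E) : stepMap V S y =
    y - stepWeight S y • (y - flatProj (V q) q y) + stepError V S q y := by
  simp [stepError]

theorem choose_eq_of_norm_sub_lt {E : Type*} [NormedAddCommGroup E] {S : Set E}
    (hS : ∀ s ∈ S, ∀ s' ∈ S, s ≠ s' → 1 / 10 ≤ dist s s')
    {s y : E} (hs : s ∈ S) (hy : ‖y - s‖ < 1 / 20)
    (h : ∃ s ∈ S, ‖y - s‖ < 1 / 20) : h.choose = s := by
  by_contra hne
  have h1 := hS _ h.choose_spec.1 s hs hne
  have h2 := h.choose_spec.2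
  rw [dist_eq_norm] at h1
  have h3 := norm_sub_le (y - s) (y - h.choose)
  rw [show y - s - (y - h.choose) = h.choose - s by abel] at h3
  linarith

theorem stepWeight_of_mem {E : Type*} [NormedAddCommGroup E] {S : Set E}
    (hS : ∀ s ∈ S, ∀ s' ∈ S, s ≠ s' → 1 / 10 ≤ dist s s')
    {s y : E} (hs : s ∈ S) (hy : ‖y - s‖ < 1 / 20) :
    stepWeight S y = bump s y := by
  have h : ∃ s ∈ S, ‖y - s‖ < 1 / 20 := ⟨s, hs, hy⟩
  rw [stepWeight, dif_pos h, choose_eq_of_norm_sub_lt hS hs hy h]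

theorem stepMap_of_mem (hS : ∀ s ∈ S, ∀ s' ∈ S, s ≠ s' → 1 / 10 ≤ dist s s')
    {s y : E} (hs : s ∈ S) (hy : ‖y - s‖ < 1 / 20) :
    stepMap V S y = y + bump s y • (flatProj (V s) s y - y) := by
  have h : ∃ s ∈ S, ‖y - s‖ < 1 / 20 := ⟨s, hs, hy⟩
  simp only [stepMap, dif_pos h, choose_eq_of_norm_sub_lt hS hs hy h]

theorem stepMap_of_norm_sub_le (hS : ∀ s ∈ S, ∀ s' ∈ S, s ≠ s' → 1 / 10 ≤ dist s s')
    {s y : E} (hs : s ∈ S) (hy : ‖y - s‖ ≤ 3 / 100) :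
    stepMap V S y = flatProj (V s) s y := by
  rw [stepMap_of_mem hS hs (by linarith), bump_eq_one hy]
  simp

theorem eventually_stepMap (hS : ∀ s ∈ S, ∀ s' ∈ S, s ≠ s' → 1 / 10 ≤ dist s s')
    (y : E) :
    (∃ s ∈ S, ‖y - s‖ < 1 / 20 ∧ ∀ᶠ z in 𝓝 y, stepWeight S z = bump s z ∧
      stepMap V S z = z + bump s z • (flatProj (V s) s z - z)) ∨
    ∀ᶠ z in 𝓝 y, stepWeight S z = 0 ∧ stepMap V S z = z := by
  by_cases h : ∃ s ∈ S, ‖y - s‖ < 1 / 20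
  · obtain ⟨s, hs, hy⟩ := h
    refine Or.inl ⟨s, hs, hy, ?_⟩
    have : Metric.ball s (1 / 20) ∈ 𝓝 y :=
      Metric.isOpen_ball.mem_nhds (by simpa [dist_eq_norm] using hy)
    filter_upwards [this] with z hz
    have hz' : ‖z - s‖ < 1 / 20 := by simpa [dist_eq_norm] using hz
    exact ⟨stepWeight_of_mem hS hs hz', stepMap_of_mem hS hs hz'⟩
  · right
    filter_upwards [Metric.ball_mem_nhds y (show (0 : ℝ) < 1 / 100 by norm_num)] with z hz
    have hz' : ‖z - y‖ < 1 / 100 := by simpa [dist_eq_norm] using hz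
    by_cases hex : ∃ s ∈ S, ‖z - s‖ < 1 / 20
    · obtain ⟨s, hs, hzs⟩ := hex
      have h1 : 1 / 20 ≤ ‖y - s‖ := by
        by_contra hlt
        exact h ⟨s, hs, not_le.1 hlt⟩
      have h2 := norm_sub_le (z - s) (z - y)
      rw [show z - s - (z - y) = y - s by abel] at h2
      have h0 : bump s z = 0 := bump_eq_zero (by linarith)
      rw [stepWeight_of_mem hS hs hzs, stepMap_of_mem hS hs hzs, h0]
      simp
    · rw [stepWeight, stepMap, dif_neg hex, dif_neg hex]
      simp

theorem stepWeight_nonneg {E : Type*} [NormedAddCommGroup E] {S : Set E} (y : E) :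
    0 ≤ stepWeight S y := by
  unfold stepWeight
  split_ifs
  · exact bump_nonneg _ _
  · exact le_rfl

theorem stepWeight_le_one {E : Type*} [NormedAddCommGroup E] {S : Set E} (y : E) :
    stepWeight S y ≤ 1 := by
  unfold stepWeight
  split_ifs
  · exact bump_le_one _ _
  · exact zero_le_one

theorem jetBound_zero {F : Type*} [NormedAddCommGroup F] [NormedSpace ℝ F] {C : ℕ → ℝ}
    (hC : ∀ k, 0 ≤ C k) (x : E) : JetBound 0 C (fun _ : E => (0 : F)) x := by
  refine ⟨contDiffAt_const, fun k _ => ?_⟩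
  rw [iteratedFDeriv_fun_zero]
  simpa using hC k

theorem jetBound_stepWeight (hS : ∀ s ∈ S, ∀ s' ∈ S, s ≠ s' → 1 / 10 ≤ dist s s') (y : E) :
    JetBound 0 bumpBound (stepWeight S) y := by
  -- the flats play no role here
  rcases eventually_stepMap (V := fun _ => ⊥) hS y with ⟨s, -, hy, he⟩ | he
  · exact (jetBound_bump (by linarith)).congr (he.mono fun z hz => hz.1)
  · exact (jetBound_zero bumpBound_nonneg y).congr (he.mono fun z hz => hz.1)

/-- Bounds for the derivatives of `stepError`, up to the factor `η`. -/
noncomputable def errorBound : ℕ → ℝ := leibnizBound bumpBound fun _ => 301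

theorem errorBound_nonneg (k : ℕ) : 0 ≤ errorBound k :=
  leibnizBound_nonneg bumpBound_nonneg (fun _ => by norm_num) k

variable {n : ℕ} {η : ℝ} {X : Set E}

theorem jetBound_stepError (h : IsFlatApprox n η X V) (hη : η < 1 / 100) (hη0 : 0 ≤ η)
    (hSX : S ⊆ X) (hS : ∀ s ∈ S, ∀ s' ∈ S, s ≠ s' → 1 / 10 ≤ dist s s') {q y : E} (hq : q ∈ X)
    (hy : ‖y - q‖ < 91 / 100) : JetBound 0 (fun k => errorBound k * η) (stepError V S q) y := by
  rcases eventually_stepMap (V := V) hS y with ⟨s, hs, hys, he⟩ | he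
  · have hqs : ‖q - s‖ ≤ 97 / 100 := by
      have := norm_sub_le (y - s) (y - q)
      rw [show y - s - (y - q) = q - s by abel] at this
      linarith
    set c : E := (s - (V s).starProjection s) - (q - (V q).starProjection q) with hc
    have e : ∀ z, c + ((V s).starProjection - (V q).starProjection) z =
        flatProj (V s) s z - flatProj (V q) q z := fun z => by
      simp only [hc, flatProj, map_sub, sub_apply]; abel
    have h1 : JetBound 0 (fun _ => 301 * η)
        (fun z => c + ((V s).starProjection - (V q).starProjection) z) y := by
      refine jetBound_affine _ _ _ ?_ ?_
      · rw [e]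
        exact h.norm_flatProj_sub_flatProj_le hη hη0 hq (hSX hs) hqs y (by linarith)
      · exact (h.norm_starProjection_sub_le hη hη0 hq (hSX hs) hqs).trans (by linarith)
    have h2 := ((jetBound_bump (s := s) (y := y) (by linarith)).smul h1).mono
      (C' := fun k => errorBound k * η) fun k _ => (leibnizBound_mul_right _ (fun _ => 301) η k).le
    refine h2.congr (he.mono fun z hz => ?_)
    simp only [stepError, hz.1, hz.2, e]
    module
  · refine (jetBound_zero (fun k => mul_nonneg (errorBound_nonneg k) hη0) y).congr
      (he.mono fun z hz => ?_)
    simp [stepError, hz.1, hz.2]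

theorem sub_flatProj (W : Submodule ℝ E) [FiniteDimensional ℝ W] (q y : E) :
    y - flatProj W q y = (y - q) - W.starProjection (y - q) := by
  rw [flatProj]; abel

/-- A step increases the distance to a point `q ∈ X` by `O(η)` at most. -/
theorem norm_stepMap_sub_le (h : IsFlatApprox n η X V) (hη : η < 1 / 100) (hη0 : 0 ≤ η)
    (hSX : S ⊆ X) (hS : ∀ s ∈ S, ∀ s' ∈ S, s ≠ s' → 1 / 10 ≤ dist s s') {q y : E} (hq : q ∈ X)
    (hy : ‖y - q‖ < 91 / 100) : ‖stepMap V S y - q‖ ≤ ‖y - q‖ + errorBound 0 * η := by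
  have h1 := (jetBound_stepError h hη hη0 hSX hS hq hy).norm_le
  have e : stepMap V S y - q = ((1 - stepWeight S y) • (y - q) +
      stepWeight S y • (V q).starProjection (y - q)) + stepError V S q y := by
    rw [stepMap_eq q y, sub_flatProj]
    module
  have h2 := norm_add_le ((1 - stepWeight S y) • (y - q))
    (stepWeight S y • (V q).starProjection (y - q))
  rw [norm_smul, norm_smul, Real.norm_of_nonneg (sub_nonneg.2 (stepWeight_le_one y)),
    Real.norm_of_nonneg (stepWeight_nonneg y)] at h2
  have h3 := mul_le_mul_of_nonneg_left ((V q).norm_starProjection_apply_le (y - q))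
    (stepWeight_nonneg (S := S) y)
  rw [e]
  refine (norm_add_le _ _).trans (add_le_add ?_ h1)
  linarith

/-- A step does not increase the distance to the flat at `q` beyond `2 η`: all flats nearby stay
within `2 η` of this flat. -/
theorem norm_stepMap_sub_flatProj_le (h : IsFlatApprox n η X V) (hη : η < 1 / 100)
    (hSX : S ⊆ X) (hS : ∀ s ∈ S, ∀ s' ∈ S, s ≠ s' → 1 / 10 ≤ dist s s') {q y : E} (hq : q ∈ X)
    (hy : ‖y - q‖ < 91 / 100) (hyn : ‖y - flatProj (V q) q y‖ ≤ 2 * η) :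
    ‖stepMap V S y - flatProj (V q) q (stepMap V S y)‖ ≤ 2 * η := by
  rcases (eventually_stepMap (V := V) hS y) with ⟨s, hs, hys, he⟩ | he
  · rw [he.self_of_nhds.2]
    set w := (V s).starProjection (y - s) with hw
    have hwn : ‖w‖ < 1 / 20 := ((V s).norm_starProjection_apply_le _).trans_lt hys
    obtain ⟨x, hx, hxw⟩ := h.near_set s (hSX hs) w ((V s).starProjection_apply_mem _)
      (by linarith)
    have hxq : ‖x - q‖ < 1 := by
      have h4 := norm_sub_starProjection_le (V s) (y - s)
      rw [← hw] at h4
      have e' : x - q = (x - (s + w)) + (y - q) - ((y - s) - w) := by abel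
      have h5 := norm_sub_le ((x - (s + w)) + (y - q)) ((y - s) - w)
      have h6 := norm_add_le (x - (s + w)) (y - q)
      rw [e']; linarith
    have h1 := h.near_flat q hq x hx hxq
    have h2 := norm_sub_starProjection_le (V q) (x - (s + w))
    set t := bump s y with ht
    have e : y + t • (flatProj (V s) s y - y) - flatProj (V q) q (y + t • (flatProj (V s) s y - y))
        = (1 - t) • (y - flatProj (V q) q y) + t • (((x - q) - (V q).starProjection (x - q)) -
          ((x - (s + w)) - (V q).starProjection (x - (s + w)))) := by
      simp only [sub_flatProj]
      rw [show flatProj (V s) s y = s + w from rfl]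
      simp only [map_sub, map_add, map_smul]
      module
    rw [e]
    have ht0 : 0 ≤ t := bump_nonneg _ _
    have ht1 : t ≤ 1 := bump_le_one _ _
    have h3 : ‖((x - q) - (V q).starProjection (x - q)) -
          ((x - (s + w)) - (V q).starProjection (x - (s + w)))‖ ≤ 2 * η :=
      (norm_sub_le _ _).trans (by linarith)
    refine (norm_add_le _ _).trans ?_
    rw [norm_smul, norm_smul, Real.norm_of_nonneg ht0, Real.norm_of_nonneg (sub_nonneg.2 ht1)]
    nlinarith [norm_nonneg (y - flatProj (V q) q y)]
  · rw [he.self_of_nhds.2]; exact hyn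

/-- A step moves points close to `X` along the flat at `q` by a quadratically small amount only. -/
theorem norm_starProjection_stepMap_sub_le (h : IsFlatApprox n η X V) (hη : η < 1 / 100)
    (hη0 : 0 ≤ η) (hSX : S ⊆ X) (hS : ∀ s ∈ S, ∀ s' ∈ S, s ≠ s' → 1 / 10 ≤ dist s s') {q x y : E}
    (hq : q ∈ X) (hx : x ∈ X) {a : ℝ} (hxy : ‖y - x‖ ≤ a) (ha : a ≤ 1 / 2)
    (hy : ‖y - q‖ < 91 / 100) :
    ‖(V q).starProjection (stepMap V S y - y)‖ ≤ 300 * η * (a + η) := by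
  have ha0 : 0 ≤ a := (norm_nonneg _).trans hxy
  rcases (eventually_stepMap (V := V) hS y) with ⟨s, hs, hys, he⟩ | he
  · rw [he.self_of_nhds.2]
    have hqs : ‖q - s‖ ≤ 97 / 100 := by
      have := norm_sub_le (y - s) (y - q)
      rw [show y - s - (y - q) = q - s by abel] at this
      linarith
    have hxs : ‖x - s‖ < 1 := by
      have := norm_sub_le (y - s) (y - x)
      rw [show y - s - (y - x) = x - s by abel] at this
      linarith
    set u := y - flatProj (V s) s y with hu
    have h1 : ‖u‖ ≤ a + η := by
      have e : u = ((x - s) - (V s).starProjection (x - s)) +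
          ((y - x) - (V s).starProjection (y - x)) := by
        rw [hu, sub_flatProj]; simp only [map_sub]; abel
      have h2 := h.near_flat s (hSX hs) x hx hxs
      have h3 := norm_sub_starProjection_le (V s) (y - x)
      rw [e]
      exact (norm_add_le _ _).trans (by linarith)
    have h2 : (V s).starProjection u = 0 := by
      rw [hu, sub_flatProj, map_sub, starProjection_idem, sub_self]
    have e : (V q).starProjection (y + bump s y • (flatProj (V s) s y - y) - y) =
        bump s y • ((V s).starProjection - (V q).starProjection) u := by
      rw [sub_apply, h2, zero_sub, add_sub_cancel_left, map_smul, ← map_neg, hu,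
        neg_sub]
    rw [e, norm_smul, Real.norm_of_nonneg (bump_nonneg _ _)]
    have h3 := ((V s).starProjection - (V q).starProjection).le_opNorm u
    have h4 := h.norm_starProjection_sub_le hη hη0 hq (hSX hs) hqs
    have h5 : ‖(V s).starProjection - (V q).starProjection‖ * ‖u‖ ≤ 300 * η * (a + η) := by gcongr
    calc _ ≤ 1 * ‖((V s).starProjection - (V q).starProjection) u‖ :=
          mul_le_mul_of_nonneg_right (bump_le_one _ _) (norm_nonneg _)
      _ ≤ _ := by linarith
  · rw [he.self_of_nhds.2]
    simp only [sub_self, map_zero, norm_zero]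
    positivity

end StepMaps

/-! ### The glued set -/

section Gluing

universe u

variable {E : Type u} [NormedAddCommGroup E] [InnerProductSpace ℝ E]

/-- The composition of the first `c` step maps. -/
noncomputable def iterMap (V : E → Submodule ℝ E) [∀ q, FiniteDimensional ℝ (V q)]
    (S : ℕ → Set E) : ℕ → E → E
  | 0 => fun y => y
  | c + 1 => fun y => stepMap V (S c) (iterMap V S c y)

/-- The displacement of `iterMap` on the flat at `q`, as a function on the whole space that factors
through the projection onto this flat. -/
noncomputable def displacement (V : E → Submodule ℝ E) [∀ q, FiniteDimensional ℝ (V q)]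
    (S : ℕ → Set E) (c : ℕ) (q b : E) : E :=
  iterMap V S c (flatProj (V q) q b) - flatProj (V q) q b

/-- Bounds for the derivatives of `displacement`, up to the factor `η`. -/
noncomputable def displacementBound : ℕ → ℕ → ℝ
  | 0 => fun _ => 0
  | c + 1 => fun k => displacementBound c k +
      leibnizBound (chainBound bumpBound fun k => 1 + displacementBound c k)
        (displacementBound c) k +
      chainBound errorBound (fun k => 1 + displacementBound c k) k

theorem displacementBound_nonneg (c k : ℕ) : 0 ≤ displacementBound c k := by
  induction c generalizing k with
  | zero => exact le_rfl
  | succ c ih =>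
    exact add_nonneg (add_nonneg (ih k) (leibnizBound_nonneg (chainBound_nonneg _ _) ih k))
      (chainBound_nonneg _ _ _)

/-- The set obtained by applying all step maps to the `1 / 100`-neighbourhood of `X`. -/
def gluedSet (V : E → Submodule ℝ E) [∀ q, FiniteDimensional ℝ (V q)]
    (S : ℕ → Set E) (N : ℕ) (X : Set E) : Set E :=
  iterMap V S N '' {y | ∃ x ∈ X, ‖y - x‖ < 1 / 100}

/-- The data of the gluing construction: approximating flats, separated families of points of `X`
which together form a net, and an error `η` small in terms of the number of families. By
`small_tangential` all steps together move points of a flat by at most `2 / 5 * η` along it, so that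
their total displacement stays below `3 η`, whatever the number of families. -/
structure IsGluing (n N : ℕ) (η : ℝ) (X : Set E) (V : E → Submodule ℝ E)
    [∀ q, FiniteDimensional ℝ (V q)] (S : ℕ → Set E) : Prop where
  approx : IsFlatApprox n η X V
  subset : ∀ c, S c ⊆ X
  separated : ∀ c, ∀ s ∈ S c, ∀ s' ∈ S c, s ≠ s' → 1 / 10 ≤ dist s s'
  net : ∀ x ∈ X, ∃ c < N, ∃ s ∈ S c, dist x s < 1 / 100
  pos : 0 < η
  small : η ≤ 1 / 100000
  small_value : ∀ c ≤ N, displacementBound c 0 * η ≤ 1 / 1000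
  small_deriv : ∀ c ≤ N, displacementBound c 1 * η ≤ 1 / 1000
  small_error : N * errorBound 0 * η ≤ 1 / 1000
  small_tangential : ∀ c ≤ N, N * (300 * (displacementBound c 0 + 2)) * η ≤ 2 / 5

theorem iterMap_eq_of_le {V : E → Submodule ℝ E} [∀ q, FiniteDimensional ℝ (V q)]
    {S : ℕ → Set E} {c d : ℕ} (hcd : c ≤ d) {y z : E}
    (h : iterMap V S c y = iterMap V S c z) : iterMap V S d y = iterMap V S d z := by
  induction d, hcd using Nat.le_induction with
  | base => exact h
  | succ d _ ih => simp only [iterMap, ih]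

theorem iterMap_eq_add_displacement {V : E → Submodule ℝ E} [∀ q, FiniteDimensional ℝ (V q)]
    {S : ℕ → Set E} (c : ℕ) {q b : E} (hb : flatProj (V q) q b = b) :
    iterMap V S c b = b + displacement V S c q b := by
  rw [displacement, hb]; abel

theorem flatProj_eq_self_iff {W : Submodule ℝ E} [FiniteDimensional ℝ W] {q b : E} :
    flatProj W q b = b ↔ b - q ∈ W := by
  rw [← W.starProjection_eq_self_iff, flatProj, ← eq_sub_iff_add_eq']

theorem jetBound_flatProj (W : Submodule ℝ E) [FiniteDimensional ℝ W] (q b : E) :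
    JetBound 1 (fun _ => 1) (flatProj W q) b := by
  have e : flatProj W q = fun z => (q - W.starProjection q) + W.starProjection z := by
    ext1 z
    simp only [flatProj, map_sub]; abel
  rw [e]
  exact jetBound_one_affine _ _ _ W.starProjection_norm_le

theorem jetBound_sub_starProjection (W : Submodule ℝ E) [FiniteDimensional ℝ W] {f : E → E}
    {C : ℕ → ℝ} {m : ℕ} {b : E} (h : JetBound m C f b) :
    JetBound m C (fun z => f z - W.starProjection (f z)) b := by
  have := h.clm_comp (Wᗮ.starProjection) Wᗮ.starProjection_norm_le
  simpa only [W.starProjection_orthogonal_val] using this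

namespace IsGluing

variable {n N : ℕ} {η : ℝ} {X : Set E} {V : E → Submodule ℝ E}
  [∀ q, FiniteDimensional ℝ (V q)] {S : ℕ → Set E}

theorem lt_one_hundredth (G : IsGluing n N η X V S) : η < 1 / 100 := by linarith [G.small]

theorem norm_iterMap_sub_le (G : IsGluing n N η X V S) {q y : E} (hq : q ∈ X)
    (hy : ‖y - q‖ < 9 / 10) {c : ℕ} (hc : c ≤ N) :
    ‖iterMap V S c y - q‖ ≤ ‖y - q‖ + 1 / 1000 := by
  have key : ∀ c ≤ N, ‖iterMap V S c y - q‖ ≤ ‖y - q‖ + c * errorBound 0 * η ∧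
      c * errorBound 0 * η ≤ 1 / 1000 := by
    intro c
    induction c with
    | zero => intro _; simp [iterMap]
    | succ c ih =>
      intro hc
      obtain ⟨h1, h2⟩ := ih (by omega)
      have h3 := norm_stepMap_sub_le G.approx G.lt_one_hundredth G.pos.le (G.subset c)
        (G.separated c) hq
        (y := iterMap V S c y) (by linarith)
      refine ⟨?_, le_trans ?_ G.small_error⟩
      · rw [iterMap]
        push_cast
        linarith
      · have h4 := errorBound_nonneg 0
        have h5 := G.pos
        gcongr
  obtain ⟨h1, h2⟩ := key c hc
  linarith

theorem jetBound_displacement (G : IsGluing n N η X V S) {q b : E} (hq : q ∈ X)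
    (hb : ‖flatProj (V q) q b - q‖ < 9 / 10) {c : ℕ} (hc : c ≤ N) :
    JetBound 0 (fun k => displacementBound c k * η) (displacement V S c q) b := by
  induction c with
  | zero =>
    have : displacement V S 0 q = fun _ => 0 := by
      ext1 z; simp [displacement, iterMap]
    rw [this]
    exact jetBound_zero (fun k => by simp [displacementBound]) b
  | succ c ih =>
    have ih := ih (by omega)
    set y : E → E := fun b => flatProj (V q) q b + displacement V S c q b with hy
    have hyi : ∀ b, y b = iterMap V S c (flatProj (V q) q b) := fun b => by
      simp only [hy, displacement, add_sub_cancel]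
    have hyb : ‖y b - q‖ < 91 / 100 := by
      rw [hyi]
      have := G.norm_iterMap_sub_le hq hb (show c ≤ N by omega)
      linarith
    have hyj : JetBound 1 (fun k => 1 + displacementBound c k) y b :=
      ((jetBound_flatProj (V q) q b).add (ih.of_le zero_le_one)).mono fun k _ => by
        have := mul_le_of_le_one_right (displacementBound_nonneg c k)
          (show η ≤ 1 by linarith [G.small])
        linarith
    have hw := (jetBound_stepWeight (G.separated c) (y b)).comp hyj
    have he := (jetBound_stepError G.approx G.lt_one_hundredth G.pos.le (G.subset c)
      (G.separated c) hq
      hyb).comp hyj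
    have hn := jetBound_sub_starProjection (V q) ih
    have := (ih.sub (hw.smul hn)).add he
    have e : displacement V S (c + 1) q = fun z => displacement V S c q z -
        stepWeight (S c) (y z) • (displacement V S c q z -
          (V q).starProjection (displacement V S c q z)) + stepError V (S c) q (y z) := by
      ext1 z
      have h1 : y z - flatProj (V q) q (y z) = displacement V S c q z -
          (V q).starProjection (displacement V S c q z) := by
        have h2 : y z - q = (V q).starProjection (z - q) + displacement V S c q z := by
          rw [hy]; simp only [flatProj]; abel
        rw [sub_flatProj, h2, map_add, starProjection_idem]
        abel
      rw [← h1]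
      change stepMap V (S c) (iterMap V S c (flatProj (V q) q z)) - flatProj (V q) q z = _
      rw [← hyi, stepMap_eq q (y z)]
      have h3 : displacement V S c q z = y z - flatProj (V q) q z := by
        simp only [hy, add_sub_cancel_left]
      rw [h3]
      abel
    rw [e]
    refine this.mono fun k _ => ?_
    rw [leibnizBound_mul_right, chainBound_mul _ _ G.pos.le]
    exact (le_of_eq (by simp only [displacementBound]; ring))

theorem norm_displacement_le (G : IsGluing n N η X V S) {q b : E} (hq : q ∈ X)
    (hb : ‖flatProj (V q) q b - q‖ < 9 / 10) {c : ℕ} (hc : c ≤ N) :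
    ‖displacement V S c q b‖ ≤ 1 / 1000 :=
  (G.jetBound_displacement hq hb hc).norm_le.trans (G.small_value c hc)

theorem norm_iterMap_sub_flatProj_le (G : IsGluing n N η X V S) {q a : E} (hq : q ∈ X)
    (ha : flatProj (V q) q a = a) (haq : ‖a - q‖ < 9 / 10) {c : ℕ} (hc : c ≤ N) :
    ‖iterMap V S c a - flatProj (V q) q (iterMap V S c a)‖ ≤ 2 * η := by
  induction c with
  | zero =>
    rw [iterMap, ha, sub_self, norm_zero]
    linarith [G.pos]
  | succ c ih =>
    have := G.norm_iterMap_sub_le hq haq (show c ≤ N by omega)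
    exact norm_stepMap_sub_flatProj_le G.approx G.lt_one_hundredth (G.subset c) (G.separated c) hq
      (by linarith) (ih (by omega))

theorem norm_starProjection_iterMap_sub_le (G : IsGluing n N η X V S) {q a : E} (hq : q ∈ X)
    (ha : flatProj (V q) q a = a) (haq : ‖a - q‖ < 9 / 10) {c : ℕ} (hc : c ≤ N) :
    ‖(V q).starProjection (iterMap V S c a - a)‖ ≤ c * (2 / 5 * η / N) := by
  obtain ⟨x, hx, hxa⟩ := G.approx.near_set q hq (a - q) (flatProj_eq_self_iff.1 ha) (by linarith)
  rw [add_sub_cancel] at hxa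
  induction c with
  | zero => simp [iterMap]
  | succ c ih =>
    have hcN : c ≤ N := by omega
    have h1 := G.norm_iterMap_sub_le hq haq hcN
    have hj := G.jetBound_displacement (b := a) hq (by rwa [ha]) hcN
    have h2 : ‖iterMap V S c a - x‖ ≤ displacementBound c 0 * η + η := by
      have e : iterMap V S c a - x = displacement V S c q a - (x - a) := by
        rw [iterMap_eq_add_displacement c ha]; abel
      rw [e]
      exact (norm_sub_le _ _).trans (add_le_add hj.norm_le hxa.le)
    have h3 := norm_starProjection_stepMap_sub_le G.approx G.lt_one_hundredth G.pos.le (G.subset c)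
      (G.separated c) hq hx h2 (by linarith [G.small_value c hcN, G.small]) (by linarith)
    have h4 : 300 * η * (displacementBound c 0 * η + η + η) ≤ 2 / 5 * η / N := by
      have hN : (0 : ℝ) < N := by
        have : 0 < N := by omega
        exact_mod_cast this
      rw [le_div_iff₀ hN]
      have := mul_le_mul_of_nonneg_right (G.small_tangential c hcN) G.pos.le
      linarith
    have e : iterMap V S (c + 1) a - a = (stepMap V (S c) (iterMap V S c a) - iterMap V S c a) +
        (iterMap V S c a - a) := by
      rw [iterMap]; abel
    rw [e, map_add]
    refine (norm_add_le _ _).trans ?_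
    push_cast
    linarith [ih hcN]

theorem norm_iterMap_sub_self_le (G : IsGluing n N η X V S) {q a : E} (hq : q ∈ X)
    (ha : flatProj (V q) q a = a) (haq : ‖a - q‖ < 9 / 10) :
    ‖iterMap V S N a - a‖ ≤ 12 / 5 * η := by
  have h1 := G.norm_iterMap_sub_flatProj_le hq ha haq le_rfl
  have h2 := G.norm_starProjection_iterMap_sub_le hq ha haq le_rfl
  have h3 : (N : ℝ) * (2 / 5 * η / N) ≤ 2 / 5 * η := by
    rcases Nat.eq_zero_or_pos N with h | h
    · rw [h]; simp [G.pos.le]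
    · have : (0 : ℝ) < N := by exact_mod_cast h
      exact (mul_div_cancel₀ _ this.ne').le
  have e : iterMap V S N a - a = (iterMap V S N a - flatProj (V q) q (iterMap V S N a)) +
      (V q).starProjection (iterMap V S N a - a) := by
    have : a - q = (V q).starProjection (a - q) :=
      ((V q).starProjection_eq_self_iff.2 (flatProj_eq_self_iff.1 ha)).symm
    rw [map_sub] at this
    simp only [flatProj, map_sub]
    rw [← sub_eq_zero]
    have h5 : a = q + (V q).starProjection a - (V q).starProjection q := by
      rw [← sub_eq_zero, ← sub_eq_zero.2 this]; abel
    nth_rewrite 2 [h5]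
    abel
  rw [e]
  exact (norm_add_le _ _).trans (by linarith)

/-- The image of the unit ball of the flat at `q` belongs to the glued set. -/
theorem iterMap_mem_gluedSet (G : IsGluing n N η X V S) {q a : E} (hq : q ∈ X)
    (ha : flatProj (V q) q a = a) (haq : ‖a - q‖ < 1) :
    iterMap V S N a ∈ gluedSet V S N X := by
  obtain ⟨x, hx, hxa⟩ := G.approx.near_set q hq (a - q) (flatProj_eq_self_iff.1 ha) (by linarith)
  rw [add_sub_cancel, norm_sub_rev] at hxa
  exact ⟨a, ⟨x, hx, by linarith [G.small]⟩, rfl⟩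

theorem exists_norm_sub_le_of_mem_gluedSet (G : IsGluing n N η X V S) {y : E}
    (hy : y ∈ gluedSet V S N X) : ∃ q ∈ X, ‖y - q‖ < 2 / 100 := by
  obtain ⟨x, ⟨q, hq, hxq⟩, rfl⟩ := hy
  refine ⟨q, hq, ?_⟩
  have := G.norm_iterMap_sub_le hq (y := x) (by linarith) le_rfl
  linarith

/-- Near `q ∈ X` the glued set is the image of the flat at `q`. A point `x` near `X` is within `3 /
100` of a point `s` of some family `S c` when the step `c` is made, so this step carries it onto the
flat at `s`. Since `iterMap` is close to the identity on the flat at `q`, some point of that flat is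
carried to the same point by the first `c + 1` steps. -/
theorem exists_flat_of_mem_gluedSet [CompleteSpace E] (G : IsGluing n N η X V S) {q y : E}
    (hq : q ∈ X) (hy : y ∈ gluedSet V S N X) (hyq : ‖y - q‖ < 8 / 10) :
    ∃ b, flatProj (V q) q b = b ∧ ‖b - q‖ < 89 / 100 ∧ iterMap V S N b = y := by
  obtain ⟨x, ⟨q', hq', hxq'⟩, rfl⟩ := hy
  obtain ⟨c, hc, s, hs, hqs⟩ := G.net q' hq'
  have hsX := G.subset c hs
  rw [dist_eq_norm] at hqs
  have h1 := G.norm_iterMap_sub_le hq' (y := x) (by linarith) le_rfl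
  have hsq : ‖s - q‖ < 83 / 100 := by
    have e : s - q = (iterMap V S N x - q) - (iterMap V S N x - q') - (q' - s) := by abel
    have h2 := norm_sub_le ((iterMap V S N x - q) - (iterMap V S N x - q')) (q' - s)
    have h3 := norm_sub_le (iterMap V S N x - q) (iterMap V S N x - q')
    rw [e]; linarith
  have hxs : ‖x - s‖ < 2 / 100 := by
    have h2 := norm_add_le (x - q') (q' - s)
    rw [sub_add_sub_cancel] at h2
    linarith
  have hx1 := G.norm_iterMap_sub_le hsX (y := x) (by linarith) hc.le
  set x₂ := iterMap V S (c + 1) x with hx₂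
  have hx2 : x₂ = flatProj (V s) s (iterMap V S c x) :=
    stepMap_of_norm_sub_le (G.separated c) hs (by linarith)
  have hx2s : ‖x₂ - s‖ ≤ 21 / 1000 := by
    rw [hx2]
    exact (norm_flatProj_sub_le _ _ _).trans (by linarith)
  have hx2q : ‖x₂ - q‖ ≤ 86 / 100 := by
    have h2 := norm_add_le (x₂ - s) (s - q)
    rw [sub_add_sub_cancel] at h2
    linarith
  set t := (V q).starProjection (x₂ - q) with ht
  have htn : ‖t‖ ≤ 86 / 100 := ((V q).norm_starProjection_apply_le _).trans hx2q
  have htV : (V q).starProjection t = t := starProjection_idem _ _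
  have hdom : ∀ u ∈ Metric.closedBall (0 : E) (1 / 1000),
      ‖flatProj (V q) q (q + t + u) - q‖ < 87 / 100 := fun u hu => by
    have hu' : ‖u‖ ≤ 1 / 1000 := by simpa using hu
    have h2 := norm_flatProj_sub_le (V q) q (q + t + u)
    rw [show q + t + u - q = t + u by abel] at h2
    linarith [norm_add_le t u]
  have hj : ∀ u ∈ Metric.closedBall (0 : E) (1 / 1000), JetBound 0
      (fun k => displacementBound (c + 1) k * η) (displacement V S (c + 1) q) (q + t + u) :=
    fun u hu => G.jetBound_displacement hq (by linarith [hdom u hu]) hc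
  -- `u` is the tangential correction
  obtain ⟨u, hu, hfix⟩ := exists_fixedPoint_of_norm_fderiv_le
    (φ := fun u => -(V q).starProjection (displacement V S (c + 1) q (q + t + u)))
    (R := 1 / 1000) (by norm_num)
    (fun u hu => by
      have := (hj u hu).differentiableAt
      exact ((V q).starProjection.differentiableAt.comp u
        (this.comp u (differentiableAt_id.const_add (q + t)))).neg)
    (fun u hu => by
      have h2 := (hj u hu).differentiableAt.hasFDerivAt
      have h3 : HasFDerivAt (fun u => displacement V S (c + 1) q (q + t + u))
          (fderiv ℝ (displacement V S (c + 1) q) (q + t + u)) u := by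
        have := h2.comp u ((hasFDerivAt_id u).const_add (q + t))
        rwa [ContinuousLinearMap.comp_id] at this
      have h4 := ((V q).starProjection.hasFDerivAt.comp u h3).neg
      have h5 : HasFDerivAt (fun u => -(V q).starProjection
        (displacement V S (c + 1) q (q + t + u))) _ u := h4
      rw [h5.fderiv, norm_neg]
      refine (ContinuousLinearMap.opNorm_comp_le _ _).trans ?_
      have h6 := ((hj u hu).norm_fderiv_le zero_le_one).trans (G.small_deriv (c + 1) hc)
      have h7 := (V q).starProjection_norm_le
      nlinarith [norm_nonneg (fderiv ℝ (displacement V S (c + 1) q) (q + t + u))])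
    (fun u hu => by
      rw [norm_neg]
      exact ((V q).norm_starProjection_apply_le _).trans
        (G.norm_displacement_le hq (by linarith [hdom u hu]) hc))
  have hu' : ‖u‖ ≤ 1 / 1000 := by simpa using hu
  have huV : (V q).starProjection u = u := by
    rw [← hfix, map_neg, starProjection_idem]
  set b := q + t + u with hb
  have hbfix : flatProj (V q) q b = b := by
    rw [flatProj, hb, show q + t + u - q = t + u by abel, map_add, htV, huV, add_assoc]
  have hbq : ‖b - q‖ < 87 / 100 := by
    have := hdom u hu
    rwa [hbfix] at this
  have hdisp := iterMap_eq_add_displacement (S := S) (c + 1) hbfix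
  have hdisp' := iterMap_eq_add_displacement (S := S) c hbfix
  have hdc : ‖displacement V S c q b‖ ≤ 1 / 1000 :=
    G.norm_displacement_le hq (by rw [hbfix]; linarith) hc.le
  have hqs' : ‖q - s‖ ≤ 97 / 100 := by rw [norm_sub_rev]; linarith
  have hbs : ‖iterMap V S c b - s‖ ≤ 3 / 100 := by
    have h2 := G.approx.norm_flatProj_sub_flatProj_le G.lt_one_hundredth G.pos.le hq hsX hqs' x₂
      (by linarith)
    rw [hx2, flatProj_flatProj, ← hx2] at h2
    have e : iterMap V S c b - s = (x₂ - s) - (x₂ - flatProj (V q) q x₂) + u +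
        displacement V S c q b := by
      rw [hdisp', hb, flatProj, ← ht]; abel
    rw [e]
    have h3 := norm_add_le ((x₂ - s) - (x₂ - flatProj (V q) q x₂) + u) (displacement V S c q b)
    have h4 := norm_add_le ((x₂ - s) - (x₂ - flatProj (V q) q x₂)) u
    have h5 := norm_sub_le (x₂ - s) (x₂ - flatProj (V q) q x₂)
    linarith [G.small]
  have hb2 : iterMap V S (c + 1) b = flatProj (V s) s (iterMap V S c b) :=
    stepMap_of_norm_sub_le (G.separated c) hs hbs
  refine ⟨b, hbfix, by linarith, iterMap_eq_of_le hc ?_⟩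
  rw [← hx₂, ← sub_eq_zero]
  set w := iterMap V S (c + 1) b - x₂ with hw
  have hws : (V s).starProjection w = w := by
    rw [hw, hb2, hx2, flatProj, flatProj, add_sub_add_left_eq_sub, map_sub, starProjection_idem,
      starProjection_idem]
  have hwq : (V q).starProjection w = 0 := by
    have e : w = (t - (x₂ - q)) + u + displacement V S (c + 1) q b := by
      rw [hw, hdisp, hb]; abel
    rw [e, map_add, map_add, map_sub, htV, ← ht, sub_self, zero_add, huV]
    nth_rewrite 1 [← hfix]
    rw [neg_add_cancel]
  have h6 := ((V s).starProjection - (V q).starProjection).le_opNorm w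
  rw [sub_apply, hws, hwq, sub_zero] at h6
  have h7 := G.approx.norm_starProjection_sub_le G.lt_one_hundredth G.pos.le hq hsX hqs'
  by_contra hne
  have hpos : 0 < ‖w‖ := norm_pos_iff.2 hne
  nlinarith [G.small]

theorem hausdorffEDist_gluedSet_le [CompleteSpace E] (G : IsGluing n N η X V S) :
    Metric.hausdorffEDist X (gluedSet V S N X) ≤ ENNReal.ofReal (4 * η) := by
  refine Metric.hausdorffEDist_le_of_mem_edist (fun q hq => ?_) fun y hy => ?_
  · have hfix : flatProj (V q) q q = q := by simp [flatProj]
    refine ⟨iterMap V S N q, G.iterMap_mem_gluedSet hq hfix (by simp), ?_⟩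
    rw [edist_dist, dist_comm, dist_eq_norm]
    refine ENNReal.ofReal_le_ofReal ((G.norm_iterMap_sub_self_le hq hfix (by norm_num)).trans ?_)
    linarith [G.pos]
  · obtain ⟨q, hq, hyq⟩ := G.exists_norm_sub_le_of_mem_gluedSet hy
    obtain ⟨b, hb, hbq, rfl⟩ := G.exists_flat_of_mem_gluedSet hq hy (by linarith)
    obtain ⟨x, hx, hxb⟩ := G.approx.near_set q hq (b - q) (flatProj_eq_self_iff.1 hb) (by linarith)
    rw [add_sub_cancel, norm_sub_rev] at hxb
    refine ⟨x, hx, ?_⟩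
    rw [edist_dist, dist_eq_norm]
    refine ENNReal.ofReal_le_ofReal ?_
    have h1 := norm_add_le (iterMap V S N b - b) (b - x)
    rw [sub_add_sub_cancel] at h1
    linarith [G.norm_iterMap_sub_self_le hq hb (by linarith), G.pos]

theorem isClosed_gluedSet [CompleteSpace E] (G : IsGluing n N η X V S) :
    IsClosed (gluedSet V S N X) := by
  refine isClosed_of_closure_subset fun y hy => ?_
  obtain ⟨y', hy', hyy'⟩ := Metric.mem_closure_iff.1 hy (1 / 100) (by norm_num)
  obtain ⟨q, hq, hyq⟩ := G.exists_norm_sub_le_of_mem_gluedSet hy'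
  have hball : y ∈ Metric.ball q (8 / 10) := by
    have := dist_triangle y y' q
    rw [dist_eq_norm y' q] at this
    rw [Metric.mem_ball]
    linarith
  -- near `q` the set is contained in this compact subset
  set K : Set E := (fun v : V q => iterMap V S N (q + v)) '' Metric.closedBall 0 (89 / 100) with hK
  have hfix : ∀ v : V q, flatProj (V q) q (q + v) = q + v := fun v =>
    flatProj_eq_self_iff.2 (by simp)
  have hKc : IsCompact K := by
    refine (isCompact_closedBall _ _).image_of_continuousOn fun v hv => ?_
    have hvn : ‖v‖ ≤ 89 / 100 := by simpa using hv
    have h1 := (G.jetBound_displacement (b := q + v) hq (by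
      rw [hfix, add_sub_cancel_left, Submodule.norm_coe]; linarith) le_rfl).contDiffAt.continuousAt
    have h2 : ContinuousAt (fun v : V q => q + (v : E)) v := by fun_prop
    have h3 : ContinuousAt (fun v : V q => (q + (v : E)) + displacement V S N q (q + v)) v :=
      h2.add (ContinuousAt.comp (g := displacement V S N q) h1 h2)
    refine ContinuousAt.continuousWithinAt (h3.congr (Filter.Eventually.of_forall fun v => ?_))
    exact (iterMap_eq_add_displacement N (hfix v)).symm
  have hKsub : gluedSet V S N X ∩ Metric.ball q (8 / 10) ⊆ K := by
    rintro z ⟨hz, hzq⟩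
    obtain ⟨b, hb, hbq, rfl⟩ := G.exists_flat_of_mem_gluedSet hq hz
      (by rw [← dist_eq_norm]; exact hzq)
    refine ⟨⟨b - q, flatProj_eq_self_iff.1 hb⟩, ?_, by simp⟩
    simpa using hbq.le
  have hyK : y ∈ K := by
    refine hKc.isClosed.closure_subset_iff.2 hKsub ?_
    rw [Set.inter_comm]
    exact Metric.isOpen_ball.inter_closure ⟨hball, hy⟩
  obtain ⟨v, hv, rfl⟩ := hyK
  have hvn : ‖v‖ ≤ 89 / 100 := by simpa using hv
  exact G.iterMap_mem_gluedSet hq (hfix v) (by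
    rw [add_sub_cancel_left, Submodule.norm_coe]; linarith)

end IsGluing

/-- For every dimension there is a number of families and a threshold below which gluing data
exist. Any finite number of further smallness conditions can be imposed through `T`. -/
theorem exists_isGluing (n : ℕ) : ∃ N : ℕ, ∀ T : ℝ, ∃ η₀ : ℝ, 0 < η₀ ∧ ∀ (E : Type u)
    [NormedAddCommGroup E] [InnerProductSpace ℝ E] (X : Set E) (δ η : ℝ), δ < η → 0 < η → η < η₀ →
    IsCloseToFlats n δ 1 X → T * η ≤ 1 / 1000 ∧ ∃ (V : E → Submodule ℝ E)
      (_ : ∀ q, FiniteDimensional ℝ (V q)) (S : ℕ → Set E), IsGluing n N η X V S := by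
  obtain ⟨N, hN⟩ := exists_separated_families.{u} n
  refine ⟨N, fun T => ?_⟩
  set D : ℝ := ∑ c ∈ Finset.range (N + 1), (displacementBound c 0 + displacementBound c 1) with hD
  have hD0 : ∀ c ≤ N, displacementBound c 0 ≤ D ∧ displacementBound c 1 ≤ D := fun c hc => by
    have := Finset.single_le_sum
      (f := fun c => displacementBound c 0 + displacementBound c 1)
      (fun c _ => add_nonneg (displacementBound_nonneg c 0) (displacementBound_nonneg c 1))
      (Finset.mem_range.2 (Nat.lt_succ_of_le hc))
    have h0 := displacementBound_nonneg c 0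
    have h1 := displacementBound_nonneg c 1
    constructor <;> linarith
  have hDnn : 0 ≤ D := (displacementBound_nonneg 0 0).trans (hD0 0 (Nat.zero_le _)).1
  have hEnn := errorBound_nonneg 0
  set B : ℝ := |T| + 100 + D + N * errorBound 0 + N * (300 * (D + 2)) with hB
  have hBpos : 0 < B := by positivity
  have hN0 : (0 : ℝ) ≤ N := Nat.cast_nonneg N
  have hp1 : 0 ≤ N * errorBound 0 := by positivity
  have hp2 : 0 ≤ N * (300 * (D + 2)) := by positivity
  refine ⟨1 / (1000 * B), by positivity, fun E _ _ X δ η hδη hη hηB hX => ?_⟩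
  have hBη : B * η ≤ 1 / 1000 := by
    rw [lt_div_iff₀ (by positivity)] at hηB
    linarith
  have hle : ∀ c : ℝ, c ≤ B → c * η ≤ 1 / 1000 := fun c hc =>
    (mul_le_mul_of_nonneg_right hc hη.le).trans hBη
  have hT := abs_nonneg T
  refine ⟨hle T (by linarith [le_abs_self T]), ?_⟩
  obtain ⟨V, hV, hVX⟩ := exists_isFlatApprox hδη hη hX
  have hη' : η ≤ 1 / 100000 := by linarith [hle 100 (by linarith)]
  obtain ⟨S, hS1, hS2, hS3⟩ := hN E X V η (by linarith) hVX
  refine ⟨V, hV, S, hVX, hS1, hS2, hS3, hη, hη', fun c hc => hle _ ?_, fun c hc => hle _ ?_,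
    hle _ (by linarith), fun c hc => (hle _ ?_).trans (by norm_num)⟩
  · linarith [(hD0 c hc).1]
  · linarith [(hD0 c hc).2]
  · have := (hD0 c hc).1
    have : N * (300 * (displacementBound c 0 + 2)) ≤ N * (300 * (D + 2)) := by gcongr
    linarith

end Gluing

/-! ### Geometry of a set with a smooth nearest point projection -/

section TubularProjection

variable {E : Type*} [NormedAddCommGroup E] [InnerProductSpace ℝ E]

/-- `P` is a smooth nearest point projection of the `ρ`-neighbourhood of `M` onto `M`, its
differentials at points of `M` are close to projections onto `n`-dimensional subspaces, and normal
segments of length less than `ρ` are mapped to their foot points. -/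
structure IsTubularProjection (n : ℕ) (M : Set E) (P : E → E) (ρ : ℝ) : Prop where
  pos : 0 < ρ
  proj : IsNormalProjectionOn M (Metric.thickening ρ M) P
  smooth : ContDiffOn ℝ ∞ P (Metric.thickening ρ M)
  rank : ∀ p ∈ M, ∃ (V : Submodule ℝ E) (_ : FiniteDimensional ℝ V), Module.finrank ℝ V = n ∧
    ‖fderiv ℝ P p - V.starProjection‖ < 1
  normal : ∀ p ∈ M, ∀ v ∈ (fderiv ℝ P p).rangeᗮ, ‖v‖ < ρ → P (p + v) = p

theorem IsNormalProjectionOn.apply_of_mem {E : Type*} [NormedAddCommGroup E] {M U : Set E}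
    {P : E → E} (h : IsNormalProjectionOn M U P) {p : E} (hp : p ∈ M) (hpU : p ∈ U) : P p = p := by
  by_contra hne
  have := (h p hpU).2 p hp (Ne.symm hne)
  rw [dist_self] at this
  exact absurd this (not_lt.2 dist_nonneg)

theorem IsNormalProjectionOn.dist_le {E : Type*} [NormedAddCommGroup E] {M U : Set E} {P : E → E}
    (h : IsNormalProjectionOn M U P) {x q : E} (hx : x ∈ U) (hq : q ∈ M) :
    dist x (P x) ≤ dist x q := by
  by_cases hne : q = P x
  · rw [hne]
  · exact ((h x hx).2 q hq hne).le

/-- A map that fixes the points of `M` fixes the velocities of curves in `M`. -/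
theorem fderiv_apply_deriv_of_isSmoothCurveIn {M : Set E} {P : E → E} {γ : ℝ → E}
    (hPM : ∀ p ∈ M, P p = p) (hP : DifferentiableAt ℝ P (γ 0)) (hγ : IsSmoothCurveIn M γ) :
    fderiv ℝ P (γ 0) (deriv γ 0) = deriv γ 0 := by
  have h1 : HasDerivAt γ (deriv γ 0) 0 := (hγ.1.differentiableAt (by simp)).hasDerivAt
  have h2 : HasDerivAt (P ∘ γ) (fderiv ℝ P (γ 0) (deriv γ 0)) 0 :=
    hP.hasFDerivAt.comp_hasDerivAt 0 h1
  have h3 : P ∘ γ =ᶠ[𝓝 0] γ := hγ.2.mono fun t ht => hPM _ ht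
  exact (h2.congr_of_eventuallyEq h3.symm).unique h1

theorem inner_eq_zero_of_norm_le_norm_add_smul {w u : E} (h : ∀ t : ℝ, ‖w‖ ≤ ‖w + t • u‖) :
    inner ℝ w u = 0 := by
  by_contra hne
  have hu : u ≠ 0 := fun h0 => hne (by rw [h0, inner_zero_right])
  have hpos : 0 < ‖u‖ ^ 2 := by positivity
  have h1 := h (-(inner ℝ w u) / ‖u‖ ^ 2)
  have h2 : ‖w‖ ^ 2 ≤ ‖w + (-(inner ℝ w u) / ‖u‖ ^ 2) • u‖ ^ 2 := by gcongr
  rw [norm_add_sq_real, norm_smul, inner_smul_right, mul_pow, Real.norm_eq_abs, sq_abs] at h2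
  have h3 : 2 * (-(inner ℝ w u) / ‖u‖ ^ 2 * inner ℝ w u) +
      (-(inner ℝ w u) / ‖u‖ ^ 2) ^ 2 * ‖u‖ ^ 2 = -((inner ℝ w u) ^ 2 / ‖u‖ ^ 2) := by
    field_simp; ring
  have h4 : 0 < (inner ℝ w u) ^ 2 / ‖u‖ ^ 2 := by positivity
  linarith

/-- An idempotent close to an orthogonal projection has the same rank. -/
theorem finrank_range_eq_of_norm_sub_lt_one {K : E →L[ℝ] E} (hK : ∀ v, K (K v) = K v)
    (V : Submodule ℝ E) [FiniteDimensional ℝ V] (h : ‖K - V.starProjection‖ < 1) :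
    FiniteDimensional ℝ K.range ∧ Module.finrank ℝ K.range = Module.finrank ℝ V := by
  have key : ∀ u, ‖K u - V.starProjection u‖ = ‖u‖ → u = 0 := fun u hu => by
    by_contra hne
    have h1 := (K - V.starProjection).le_opNorm u
    rw [sub_apply, hu] at h1
    nlinarith [norm_pos_iff.2 hne]
  have hKr : ∀ u ∈ K.range, K u = u := by
    rintro _ ⟨v, rfl⟩
    exact hK v
  let f : K.range →ₗ[ℝ] V :=
    V.orthogonalProjectionOnto.toLinearMap.comp K.range.subtype
  let g : V →ₗ[ℝ] K.range := K.toLinearMap.rangeRestrict.comp V.subtype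
  have hf : Function.Injective f := by
    rw [← LinearMap.ker_eq_bot, LinearMap.ker_eq_bot']
    rintro ⟨u, hu⟩ h0
    have h1 : V.starProjection u = 0 := congrArg (Subtype.val) h0
    exact Subtype.ext (key u (by rw [h1, sub_zero, hKr u hu]))
  have hg : Function.Injective g := by
    rw [← LinearMap.ker_eq_bot, LinearMap.ker_eq_bot']
    rintro ⟨u, hu⟩ h0
    have h1 : K u = 0 := congrArg (Subtype.val) h0
    exact Subtype.ext (key u (by
      rw [h1, zero_sub, norm_neg, V.starProjection_eq_self_iff.2 hu]))
  have hfd : FiniteDimensional ℝ K.range := FiniteDimensional.of_injective f hf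
  exact ⟨hfd, le_antisymm (LinearMap.finrank_le_finrank_of_injective hf)
    (LinearMap.finrank_le_finrank_of_injective hg)⟩

namespace IsTubularProjection

variable {n : ℕ} {M : Set E} {P : E → E} {ρ : ℝ}

theorem mem_thickening (h : IsTubularProjection n M P ρ) {p : E} (hp : p ∈ M) :
    p ∈ Metric.thickening ρ M := Metric.self_subset_thickening h.pos M hp

theorem contDiffAt (h : IsTubularProjection n M P ρ) {x : E} (hx : x ∈ Metric.thickening ρ M) :
    ContDiffAt ℝ ∞ P x :=
  h.smooth.contDiffAt (Metric.isOpen_thickening.mem_nhds hx)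

theorem differentiableAt (h : IsTubularProjection n M P ρ) {x : E}
    (hx : x ∈ Metric.thickening ρ M) : DifferentiableAt ℝ P x :=
  (h.contDiffAt hx).differentiableAt (by simp)

theorem apply_of_mem (h : IsTubularProjection n M P ρ) {p : E} (hp : p ∈ M) : P p = p :=
  h.proj.apply_of_mem hp (h.mem_thickening hp)

theorem apply_mem (h : IsTubularProjection n M P ρ) {x : E} (hx : x ∈ Metric.thickening ρ M) :
    P x ∈ M := (h.proj x hx).1

theorem fderiv_idem (h : IsTubularProjection n M P ρ) {p : E} (hp : p ∈ M) (v : E) :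
    fderiv ℝ P p (fderiv ℝ P p v) = fderiv ℝ P p v := by
  have hd := (h.differentiableAt (h.mem_thickening hp)).hasFDerivAt
  have hd' : HasFDerivAt P (fderiv ℝ P p) (P p) := by rwa [h.apply_of_mem hp]
  have h1 := hd'.comp p hd
  have h2 : P ∘ P =ᶠ[𝓝 p] P := by
    filter_upwards [Metric.isOpen_thickening.mem_nhds (h.mem_thickening hp)] with x hx
    exact h.apply_of_mem (h.apply_mem hx)
  have h3 := (h1.congr_of_eventuallyEq h2.symm).unique hd
  exact congrArg (fun T : E →L[ℝ] E => T v) h3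

theorem fderiv_apply_of_mem_range (h : IsTubularProjection n M P ρ) {p v : E} (hp : p ∈ M)
    (hv : v ∈ (fderiv ℝ P p).range) : fderiv ℝ P p v = v := by
  obtain ⟨u, rfl⟩ := hv
  exact h.fderiv_idem hp u

theorem tangentSpaceAt_eq (h : IsTubularProjection n M P ρ) {p : E} (hp : p ∈ M) :
    tangentSpaceAt M p = (fderiv ℝ P p).range := by
  apply le_antisymm
  · refine Submodule.span_le.2 ?_
    rintro v ⟨γ, hγ, rfl, rfl⟩
    exact ⟨deriv γ 0, fderiv_apply_deriv_of_isSmoothCurveIn (fun p hp => h.apply_of_mem hp)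
      (h.differentiableAt (h.mem_thickening hp)) hγ⟩
  · rintro _ ⟨v, rfl⟩
    have hl : ContDiffAt ℝ ∞ (fun t : ℝ => p + t • v) 0 := by fun_prop
    have h0 : p + (0 : ℝ) • v = p := by simp
    have hP : ContDiffAt ℝ ∞ P (p + (0 : ℝ) • v) := by
      rw [h0]; exact h.contDiffAt (h.mem_thickening hp)
    refine Submodule.subset_span ⟨fun t => P (p + t • v), ⟨hP.comp (0 : ℝ) hl, ?_⟩, ?_, ?_⟩
    · have := hl.continuousAt.preimage_mem_nhds (Metric.isOpen_thickening.mem_nhds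
        (by rw [h0]; exact h.mem_thickening hp))
      filter_upwards [this] with t ht
      exact h.apply_mem ht
    · simp only [h0]; exact h.apply_of_mem hp
    · have h1 : HasDerivAt (fun t : ℝ => p + t • v) v 0 := by
        simpa using ((hasDerivAt_id (0 : ℝ)).smul_const v).const_add p
      have h2 := (hP.differentiableAt (by simp)).hasFDerivAt.comp_hasDerivAt (0 : ℝ) h1
      rw [h0] at h2
      exact h2.deriv

theorem norm_id_sub_fderiv_le (h : IsTubularProjection n M P ρ) {p : E} (hp : p ∈ M) :
    ‖ContinuousLinearMap.id ℝ E - fderiv ℝ P p‖ ≤ 1 := by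
  have hd := (hasFDerivAt_id p).sub (h.differentiableAt (h.mem_thickening hp)).hasFDerivAt
  refine hd.le_of_lip' zero_le_one ?_
  filter_upwards [Metric.isOpen_thickening.mem_nhds (h.mem_thickening hp)] with x hx
  have := h.proj.dist_le hx hp
  rw [dist_eq_norm, dist_eq_norm] at this
  simpa [h.apply_of_mem hp] using this

/-- At a point of `M` the differential of the projection is the orthogonal projection onto the
tangent space. -/
theorem inner_eq_zero (h : IsTubularProjection n M P ρ) {p u w : E} (hp : p ∈ M)
    (hw : fderiv ℝ P p w = 0) (hu : u ∈ (fderiv ℝ P p).range) : inner ℝ w u = 0 := by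
  refine inner_eq_zero_of_norm_le_norm_add_smul fun t => ?_
  have h1 := (ContinuousLinearMap.id ℝ E - fderiv ℝ P p).le_of_opNorm_le
    (h.norm_id_sub_fderiv_le hp) (w + t • u)
  simpa [hw, h.fderiv_apply_of_mem_range hp hu] using h1

theorem fderiv_apply_of_mem_orthogonal (h : IsTubularProjection n M P ρ) {p v : E} (hp : p ∈ M)
    (hv : v ∈ (fderiv ℝ P p).rangeᗮ) : fderiv ℝ P p v = 0 := by
  have h1 : fderiv ℝ P p (v - fderiv ℝ P p v) = 0 := by
    rw [map_sub, h.fderiv_idem hp, sub_self]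
  have hmem : fderiv ℝ P p v ∈ (fderiv ℝ P p).range := ⟨v, rfl⟩
  have h2 := h.inner_eq_zero hp h1 hmem
  rw [inner_sub_left, Submodule.inner_left_of_mem_orthogonal hmem hv, zero_sub, neg_eq_zero,
    inner_self_eq_zero] at h2
  exact h2

theorem starProjection_orthogonal_apply [CompleteSpace E] (h : IsTubularProjection n M P ρ)
    {p : E} (hp : p ∈ M) (v : E) :
    (tangentSpaceAt M p)ᗮ.starProjection v = v - fderiv ℝ P p v := by
  refine Submodule.eq_starProjection_of_mem_of_inner_eq_zero ?_ fun w hw => ?_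
  · rw [h.tangentSpaceAt_eq hp, Submodule.mem_orthogonal']
    exact fun u hu => h.inner_eq_zero hp (by rw [map_sub, h.fderiv_idem hp, sub_self]) hu
  · rw [sub_sub_cancel]
    rw [h.tangentSpaceAt_eq hp] at hw
    exact Submodule.inner_right_of_mem_orthogonal (K := (fderiv ℝ P p).range) ⟨v, rfl⟩ hw

/-- The segment from a point to its projection is normal to `M`. -/
theorem sub_mem_orthogonal (h : IsTubularProjection n M P ρ) {x : E}
    (hx : x ∈ Metric.thickening ρ M) : x - P x ∈ (fderiv ℝ P (P x)).rangeᗮ := by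
  set p := P x with hpx
  have hp : p ∈ M := h.apply_mem hx
  rw [Submodule.mem_orthogonal']
  rintro _ ⟨w, rfl⟩
  have hd := (h.differentiableAt (h.mem_thickening hp)).hasFDerivAt
  have hmin : IsLocalMin (fun y => ‖x - P y‖ ^ 2) p := by
    filter_upwards [Metric.isOpen_thickening.mem_nhds (h.mem_thickening hp)] with y hy
    have := h.proj.dist_le hx (h.apply_mem hy)
    rw [dist_eq_norm, dist_eq_norm] at this
    simp only [h.apply_of_mem hp]
    gcongr
  have h2 := (hd.const_sub x).norm_sq
  have h3 := hmin.hasFDerivAt_eq_zero h2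
  have h4 := congrArg (fun T : E →L[ℝ] ℝ => T w) h3
  simp only [h.apply_of_mem hp] at h4
  simp at h4
  change inner ℝ (x - p) (fderiv ℝ P p w) = 0
  rw [inner_sub_left]
  linarith

/-- The second fundamental form is the restriction of the second differential of the projection. -/
theorem exists_isSecondFundamentalForm [CompleteSpace E] (h : IsTubularProjection n M P ρ) {p : E}
    (hp : p ∈ M) {c : ℝ} (hc : ‖iteratedFDeriv ℝ 2 P p‖ ≤ c) :
    ∃ B : tangentSpaceAt M p →ₗ[ℝ] tangentSpaceAt M p →ₗ[ℝ] E,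
      IsSecondFundamentalForm M p B ∧ ∀ u w : tangentSpaceAt M p, ‖B u w‖ ≤ c * ‖u‖ * ‖w‖ := by
  have hsm : ContDiffAt ℝ ∞ (fderiv ℝ P) p :=
    (h.contDiffAt (h.mem_thickening hp)).fderiv_right (by simp)
  have hd2 : HasFDerivAt (fderiv ℝ P) (fderiv ℝ (fderiv ℝ P) p) p :=
    (hsm.differentiableAt (by simp)).hasFDerivAt
  have hnorm : ‖fderiv ℝ (fderiv ℝ P) p‖ ≤ c := by
    rw [← norm_iteratedFDeriv_fderiv, ← norm_iteratedFDeriv_fderiv, norm_iteratedFDeriv_zero] at hc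
    exact hc
  refine ⟨LinearMap.mk₂ ℝ (fun u w => fderiv ℝ (fderiv ℝ P) p u w) (by simp) (by simp) (by simp)
    (by simp), ?_, fun u w => ?_⟩
  · intro u w γ W hγ hγ0 hγu hW hWt hW0
    have hW1 : HasDerivAt W (deriv W 0) 0 := (hW.differentiableAt (by simp)).hasDerivAt
    have hγ1 : HasDerivAt γ (u : E) 0 := by
      rw [← hγu]; exact (hγ.1.differentiableAt (by simp)).hasDerivAt
    have hd2' : HasFDerivAt (fderiv ℝ P) (fderiv ℝ (fderiv ℝ P) p) (γ 0) := by rwa [hγ0]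
    have h1 := (hd2'.comp_hasDerivAt (0 : ℝ) hγ1).clm_apply hW1
    have h2 : (fun t => fderiv ℝ P (γ t) (W t)) =ᶠ[𝓝 0] W := by
      filter_upwards [hWt, hγ.2] with t ht htM
      rw [h.tangentSpaceAt_eq htM] at ht
      exact h.fderiv_apply_of_mem_range htM ht
    have h3 := (HasDerivAt.congr_of_eventuallyEq h1 h2.symm).unique hW1
    rw [h.starProjection_orthogonal_apply hp]
    simp only [Function.comp_apply, hγ0, hW0] at h3
    rw [LinearMap.mk₂_apply, eq_sub_iff_add_eq]
    exact h3
  · rw [LinearMap.mk₂_apply]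
    refine ((fderiv ℝ (fderiv ℝ P) p u).le_opNorm w).trans ?_
    have h1 := (fderiv ℝ (fderiv ℝ P) p).le_opNorm u
    have h2 : ‖fderiv ℝ (fderiv ℝ P) p‖ * ‖(u : E)‖ ≤ c * ‖(u : E)‖ := by gcongr
    exact mul_le_mul_of_nonneg_right (h1.trans h2) (norm_nonneg _)

theorem image_normalTube (h : IsTubularProjection n M P ρ) :
    normalExp '' normalTube M ρ = Metric.thickening ρ M := by
  ext x
  constructor
  · rintro ⟨⟨p, v⟩, ⟨hp, -, hv⟩, rfl⟩
    rw [Metric.mem_thickening_iff]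
    exact ⟨p, hp, by simpa [normalExp, dist_eq_norm] using hv⟩
  · intro hx
    obtain ⟨q, hq, hxq⟩ := Metric.mem_thickening_iff.1 hx
    refine ⟨(P x, x - P x), ⟨h.apply_mem hx, ?_, ?_⟩, by simp [normalExp]⟩
    · rw [h.tangentSpaceAt_eq (h.apply_mem hx)]
      exact h.sub_mem_orthogonal hx
    · rw [← dist_eq_norm]
      exact (h.proj.dist_le hx hq).trans_lt hxq

theorem le_normalInjectivityRadius (h : IsTubularProjection n M P ρ) :
    ENNReal.ofReal ρ ≤ normalInjectivityRadius M := by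
  refine le_iSup₂_of_le ρ ⟨h.pos, ?_, fun x => (P x, x - P x), ?_, ?_⟩ le_rfl
  · rw [h.image_normalTube]; exact Metric.isOpen_thickening
  · rw [h.image_normalTube]; exact h.smooth.prodMk (contDiffOn_id.sub h.smooth)
  · rintro ⟨p, v⟩ ⟨hp, hv, hvn⟩
    simp only at hp hv hvn
    rw [h.tangentSpaceAt_eq hp] at hv
    simp [normalExp, h.normal p hp v hv hvn]

/-- With `K` the differential of the projection at `p`, a chart straightening `M` near `p` is
`x ↦ K (P x - p) + (1 - K) (x - P x)`. -/
theorem isSmoothSubmanifold [CompleteSpace E] (h : IsTubularProjection n M P ρ) :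
    IsSmoothSubmanifold n M := by
  intro p hp
  set K := fderiv ℝ P p with hK
  have hpU := h.mem_thickening hp
  set f : E → E := fun x => K (P x - p) + (x - P x - K (x - P x)) with hf
  have hfU : ∀ x ∈ Metric.thickening ρ M, ContDiffAt ℝ ∞ f x := fun x hx => by
    have hPx := h.contDiffAt hx
    exact (K.contDiff.contDiffAt.comp x (hPx.sub contDiffAt_const)).add
      ((contDiffAt_id.sub hPx).sub (K.contDiff.contDiffAt.comp x (contDiffAt_id.sub hPx)))
  have hfd : HasFDerivAt f (ContinuousLinearEquiv.refl ℝ E : E →L[ℝ] E) p := by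
    have hd : HasFDerivAt P K p := (h.differentiableAt hpU).hasFDerivAt
    have h1 := (hasFDerivAt_id p).sub hd
    have h2 := (K.hasFDerivAt.comp p (hd.sub_const p)).add (h1.sub (K.hasFDerivAt.comp p h1))
    refine h2.congr_fderiv ?_
    ext v
    have := h.fderiv_idem hp v
    rw [← hK] at this
    simp [this]
  let φ := (hfU p hpU).toOpenPartialHomeomorph f hfd (by simp)
  have hφ : (φ : E → E) = f := rfl
  have hpφ : p ∈ φ.source := (hfU p hpU).mem_toOpenPartialHomeomorph_source hfd (by simp)
  have hcont : ContinuousAt (fderiv ℝ f) p :=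
    ((hfU p hpU).fderiv_right (m := ∞) (by simp)).continuousAt
  have hcont' : ContinuousAt (fun x => fderiv ℝ P (P x)) p := by
    have : ContinuousAt (fderiv ℝ P) (P p) := by
      rw [h.apply_of_mem hp]
      exact ((h.contDiffAt hpU).fderiv_right (m := ∞) (by simp)).continuousAt
    exact ContinuousAt.comp (g := fderiv ℝ P) this (h.contDiffAt hpU).continuousAt
  have hev : ∀ᶠ x in 𝓝 p, x ∈ Metric.thickening ρ M ∧
      ‖fderiv ℝ f x - ContinuousLinearMap.id ℝ E‖ < 1 ∧ ‖fderiv ℝ P (P x) - K‖ < 1 := by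
    refine Filter.Eventually.and (Metric.isOpen_thickening.mem_nhds hpU)
      (Filter.Eventually.and ?_ ?_)
    · have h1 := hcont.sub (continuousAt_const (y := ContinuousLinearMap.id ℝ E))
      refine h1.norm.eventually_lt continuousAt_const ?_
      rw [Pi.sub_apply, hfd.fderiv]
      simp
    · have h1 := hcont'.sub (continuousAt_const (y := K))
      refine h1.norm.eventually_lt continuousAt_const ?_
      simp [h.apply_of_mem hp, hK]
  obtain ⟨s, hs, hso, hps⟩ := mem_nhds_iff.1 hev
  obtain ⟨V, hV, hVn, hVK⟩ := h.rank p hp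
  obtain ⟨hfin, hrk⟩ := finrank_range_eq_of_norm_sub_lt_one (h.fderiv_idem hp) V hVK
  refine ⟨φ.restrOpen s hso, K.range, ⟨hpφ, hps⟩, ?_, ?_, hfin, hrk.trans hVn, ?_⟩
  · rintro x ⟨-, hx⟩
    exact (hfU x (hs hx).1).contDiffWithinAt
  · intro y hy
    have hx : (φ.restrOpen s hso).symm y ∈ (φ.restrOpen s hso).source :=
      (φ.restrOpen s hso).map_target hy
    set x := (φ.restrOpen s hso).symm y with hxy
    have hxs : x ∈ s := hx.2
    have hN : ‖ContinuousLinearMap.id ℝ E - fderiv ℝ f x‖ < 1 := by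
      rw [norm_sub_rev]; exact (hs hxs).2.1
    let e : E ≃L[ℝ] E := ContinuousLinearEquiv.unitsEquiv ℝ E (Units.oneSub _ hN)
    have he : (e : E →L[ℝ] E) = fderiv ℝ f x := by
      change 1 - (ContinuousLinearMap.id ℝ E - fderiv ℝ f x) = _
      exact sub_sub_cancel _ _
    refine ((φ.restrOpen s hso).contDiffAt_symm (f₀' := e) hy ?_ ?_).contDiffWithinAt
    · rw [he]
      exact ((hfU x (hs hxs).1).differentiableAt (by simp)).hasFDerivAt
    · exact hfU x (hs hxs).1
  · rintro x ⟨-, hx⟩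
    change x ∈ M ↔ f x ∈ K.range
    have hxU := (hs hx).1
    constructor
    · intro hxM
      exact ⟨x - p, by simp [hf, h.apply_of_mem hxM]⟩
    · intro hfx
      -- the component of `z` in the kernel of `K` vanishes, so `z` is tangent at `p`; it is also
      -- normal at `P x`
      set z := x - P x with hz
      have h1 : z - K z ∈ K.range := by
        have h2 : z - K z = f x - K (P x - p) := by simp only [hf, hz]; abel
        rw [h2]
        exact K.range.sub_mem hfx ⟨_, rfl⟩
      have h2 : K z = z := by
        have h3 := h.fderiv_apply_of_mem_range hp h1
        rw [← hK, map_sub, show K (K z) = K z from h.fderiv_idem hp z, sub_self] at h3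
        exact (sub_eq_zero.1 h3.symm).symm
      have h3 : fderiv ℝ P (P x) z = 0 :=
        h.fderiv_apply_of_mem_orthogonal (h.apply_mem hxU) (h.sub_mem_orthogonal hxU)
      have h4 : z = 0 := by
        by_contra hne
        have h5 := (fderiv ℝ P (P x) - K).le_opNorm z
        rw [sub_apply, h2, h3, zero_sub, norm_neg] at h5
        nlinarith [(hs hx).2.2, norm_pos_iff.2 hne]
      rw [sub_eq_zero.1 h4]
      exact h.apply_mem hxU

end IsTubularProjection

end TubularProjection

/-! ### The nearest point projection at unit scale -/

section UnitScale

universe u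

variable {E : Type u} [NormedAddCommGroup E] [InnerProductSpace ℝ E]

theorem hasFDerivAt_flatProj (W : Submodule ℝ E) [FiniteDimensional ℝ W] (q x : E) :
    HasFDerivAt (flatProj W q) W.starProjection x := by
  have h : HasFDerivAt (fun y => q + W.starProjection (y - q)) _ x :=
    ((W.starProjection.hasFDerivAt (x := x - q)).comp x ((hasFDerivAt_id x).sub_const q)).const_add
      q
  exact h

/-- Taylor's inequality of second order on a convex set. -/
theorem norm_sub_sub_fderiv_le {F : Type*} [NormedAddCommGroup F] [NormedSpace ℝ F] {e : E → F}
    {s : Set E} (hs : Convex ℝ s) {A : ℝ} (he : ∀ z ∈ s, ContDiffAt ℝ ∞ e z)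
    (hA : ∀ z ∈ s, ‖fderiv ℝ (fderiv ℝ e) z‖ ≤ A) {a b : E} (ha : a ∈ s) (hb : b ∈ s) :
    ‖e b - e a - fderiv ℝ e a (b - a)‖ ≤ A * ‖b - a‖ ^ 2 := by
  have hA0 : 0 ≤ A := (norm_nonneg (fderiv ℝ (fderiv ℝ e) a)).trans (hA a ha)
  have h1 : ∀ z ∈ s, ‖fderiv ℝ e z - fderiv ℝ e a‖ ≤ A * ‖z - a‖ := fun z hz =>
    hs.norm_image_sub_le_of_norm_fderiv_le (f := fderiv ℝ e)
      (fun z hz => ((he z hz).fderiv_right (m := ∞) (by simp)).differentiableAt (by simp)) hA ha hz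
  have hs' : Convex ℝ (s ∩ Metric.closedBall a ‖b - a‖) := hs.inter (convex_closedBall _ _)
  have h2 := hs'.norm_image_sub_le_of_norm_fderiv_le' (f := e) (φ := fderiv ℝ e a)
    (C := A * ‖b - a‖) (x := a) (y := b)
    (fun z hz => (he z hz.1).differentiableAt (by simp)) (fun z hz => by
      refine (h1 z hz.1).trans ?_
      have : ‖z - a‖ ≤ ‖b - a‖ := by simpa [dist_eq_norm] using hz.2
      gcongr) ⟨ha, by simp⟩ ⟨hb, by simp [dist_eq_norm]⟩
  rwa [mul_assoc, ← sq] at h2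

/-- `(T, v) ↦ T† v` as a bounded bilinear map. -/
noncomputable def adjointApply (E : Type*) [NormedAddCommGroup E] [InnerProductSpace ℝ E]
    [CompleteSpace E] : (E →L[ℝ] E) →L[ℝ] E →L[ℝ] E :=
  LinearMap.mkContinuous₂ (LinearMap.mk₂ ℝ (fun T v => ContinuousLinearMap.adjoint T v)
    (by simp) (by simp) (by simp) (by simp)) 1 fun T v => by
      rw [LinearMap.mk₂_apply, one_mul]
      refine (ContinuousLinearMap.le_opNorm _ _).trans_eq ?_
      rw [LinearIsometryEquiv.norm_map]

theorem norm_adjointApply_le [CompleteSpace E] : ‖adjointApply E‖ ≤ 1 :=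
  LinearMap.mkContinuous₂_norm_le _ zero_le_one _

variable (V : E → Submodule ℝ E) [∀ q, FiniteDimensional ℝ (V q)] (S : ℕ → Set E) (N : ℕ)

/-- The map whose fixed points `s` give the critical points of the distance from `x` to the part of
the glued set parametrized by the flat at `q`: the parameter is `b = q + π (x - q) + s` with `π` the
projection onto `V q`, and the fixed point equation expresses that `x` minus the image of `b` is
orthogonal to the image of the differential of the parametrization. -/
noncomputable def footEquation [CompleteSpace E] (q : E) (z : E × E) : E :=
  -(V q).starProjection (displacement V S N q (q + (V q).starProjection (z.1 - q) + z.2)) +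
    adjointApply E (fderiv ℝ (displacement V S N q) (q + (V q).starProjection (z.1 - q) + z.2))
      (z.1 - flatProj (V q) q (q + (V q).starProjection (z.1 - q) + z.2) -
        displacement V S N q (q + (V q).starProjection (z.1 - q) + z.2))

/-- Bounds for the derivatives of `footEquation`, up to the factor `η`. -/
noncomputable def footBound (k : ℕ) : ℝ :=
  chainBound (displacementBound N) (fun _ => 2) k +
    leibnizBound (chainBound (fun k => displacementBound N (k + 1)) fun _ => 2)
      (fun k => 3 + chainBound (displacementBound N) (fun _ => 2) k) k

variable {V S N} {n : ℕ} {η : ℝ} {X : Set E}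

namespace IsGluing

theorem norm_flatProj_parameter_sub_lt {W : Submodule ℝ E} [FiniteDimensional ℝ W] {q x s : E}
    (hx : ‖x - q‖ < 36 / 100) (hs : ‖s‖ ≤ 1 / 100) :
    ‖flatProj W q (q + W.starProjection (x - q) + s) - q‖ < 37 / 100 := by
  refine (norm_flatProj_sub_le _ _ _).trans_lt ?_
  rw [show q + W.starProjection (x - q) + s - q = W.starProjection (x - q) + s by abel]
  have := W.norm_starProjection_apply_le (x - q)
  exact (norm_add_le _ _).trans_lt (by linarith)

theorem jetBound_footEquation [CompleteSpace E] (G : IsGluing n N η X V S) {q x s : E} (hq : q ∈ X)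
    (hx : ‖x - q‖ < 36 / 100) (hs : ‖s‖ ≤ 1 / 100) :
    JetBound 0 (fun k => footBound N k * η) (footEquation V S N q) (x, s) := by
  set π := (V q).starProjection with hπ
  have hπ1 : ‖π‖ ≤ 1 := (V q).starProjection_norm_le
  set L : E × E →L[ℝ] E := π.comp (ContinuousLinearMap.fst ℝ E E) +
    ContinuousLinearMap.snd ℝ E E with hL
  have hL2 : ‖L‖ ≤ 2 := by
    refine (norm_add_le (E := E × E →L[ℝ] E) _ _).trans ?_
    have h1 := ContinuousLinearMap.opNorm_comp_le π (ContinuousLinearMap.fst ℝ E E)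
    have h2 := ContinuousLinearMap.norm_fst_le ℝ E E
    have h3 := ContinuousLinearMap.norm_snd_le ℝ E E
    nlinarith [norm_nonneg π, norm_nonneg (ContinuousLinearMap.fst ℝ E E)]
  set ℓ : E × E → E := fun z => q + π (z.1 - q) + z.2 with hℓ
  have eℓ : ℓ = fun z => (q - π q) + L z := by
    ext1 z
    simp only [hℓ, hL, map_sub, add_apply, ContinuousLinearMap.comp_apply,
      ContinuousLinearMap.coe_fst', ContinuousLinearMap.coe_snd']
    abel
  have hℓj : JetBound 1 (fun _ => 2) ℓ (x, s) := by
    rw [eℓ]; exact jetBound_one_affine _ _ _ hL2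
  have hdom := norm_flatProj_parameter_sub_lt (W := V q) hx hs
  have hej : JetBound 0 (fun k => displacementBound N k * η) (displacement V S N q) (ℓ (x, s)) :=
    G.jetBound_displacement hq (by linarith) le_rfl
  have h1 := hej.comp hℓj
  have h2 := hej.fderiv.comp hℓj
  have h3 : JetBound 0 (fun _ => 3) (fun z : E × E => z.1 - flatProj (V q) q (ℓ z)) (x, s) := by
    have e : (fun z : E × E => z.1 - flatProj (V q) q (ℓ z)) = fun z =>
        (π q - q) + (ContinuousLinearMap.fst ℝ E E - π.comp L) z := by
      ext1 z
      have h4 : π (π q) = π q := starProjection_idem _ _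
      simp only [eℓ, flatProj, map_sub, map_add, sub_apply,
        ContinuousLinearMap.comp_apply, ContinuousLinearMap.coe_fst', ← hπ, h4]
      abel
    have hval : ‖(fun z : E × E => z.1 - flatProj (V q) q (ℓ z)) (x, s)‖ ≤ 3 := by
      have h5 := norm_sub_le (x - q) (flatProj (V q) q (ℓ (x, s)) - q)
      rw [sub_sub_sub_cancel_right] at h5
      change ‖x - flatProj (V q) q (ℓ (x, s))‖ ≤ 3
      change ‖flatProj (V q) q (ℓ (x, s)) - q‖ < 37 / 100 at hdom
      linarith
    rw [e] at hval ⊢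
    refine jetBound_affine _ _ _ hval ((norm_sub_le _ _).trans ?_)
    have h5 := ContinuousLinearMap.opNorm_comp_le π L
    have h6 := ContinuousLinearMap.norm_fst_le ℝ E E
    nlinarith [norm_nonneg π, norm_nonneg L]
  have h4 := h3.sub h1
  have h5 := (h2.bilinear (h4.mono (C' := fun k => 3 + chainBound (displacementBound N)
    (fun _ => 2) k) fun k _ => by
      rw [chainBound_mul _ _ G.pos.le]
      have := mul_le_of_le_one_right (chainBound_nonneg (displacementBound N) (fun _ => 2) k)
        (show η ≤ 1 by linarith [G.small])
      linarith) (adjointApply E) norm_adjointApply_le)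
  refine (((h1.clm_comp π hπ1).neg).add h5).mono fun k _ => ?_
  rw [chainBound_mul _ _ G.pos.le, footBound, add_mul, ← leibnizBound_mul_left]
  refine le_of_eq (congrArg _ ?_)
  exact congrArg (fun C => leibnizBound C _ k) (funext fun k => chainBound_mul _ _ G.pos.le k)

theorem norm_footEquation_sub_le [CompleteSpace E] (G : IsGluing n N η X V S) {q x x' s s' : E}
    (hq : q ∈ X) (h1 : footBound N 1 * η ≤ 1 / 1000)
    (hx : ‖x - q‖ < 36 / 100) (hs : ‖s‖ ≤ 1 / 100) (hx' : ‖x' - q‖ < 36 / 100)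
    (hs' : ‖s'‖ ≤ 1 / 100) :
    ‖footEquation V S N q (x, s) - footEquation V S N q (x', s')‖ ≤
      1 / 2 * max ‖x - x'‖ ‖s - s'‖ := by
  have hconv : Convex ℝ (Metric.ball q (36 / 100) ×ˢ Metric.closedBall (0 : E) (1 / 100)) :=
    (convex_ball _ _).prod (convex_closedBall _ _)
  have hj : ∀ z ∈ Metric.ball q (36 / 100) ×ˢ Metric.closedBall (0 : E) (1 / 100),
      JetBound 0 (fun k => footBound N k * η) (footEquation V S N q) z := by
    rintro ⟨y, t⟩ ⟨hy, ht⟩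
    exact G.jetBound_footEquation hq (by simpa [dist_eq_norm] using hy) (by simpa using ht)
  refine hconv.norm_image_sub_le_of_norm_fderiv_le (f := footEquation V S N q) (C := 1 / 2)
    (fun z hz => (hj z hz).differentiableAt)
    (fun z hz => ((hj z hz).norm_fderiv_le zero_le_one).trans (by linarith)) (x := (x', s'))
    (y := (x, s)) ⟨?_, ?_⟩ ⟨?_, ?_⟩
  · simpa [dist_eq_norm] using hx'
  · simpa using hs'
  · simpa [dist_eq_norm] using hx
  · simpa using hs

theorem exists_eq_footEquation [CompleteSpace E] (G : IsGluing n N η X V S) {q x : E} (hq : q ∈ X)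
    (h0 : footBound N 0 * η ≤ 1 / 1000) (h1 : footBound N 1 * η ≤ 1 / 1000)
    (hx : ‖x - q‖ < 36 / 100) : ∃ s, ‖s‖ ≤ 1 / 100 ∧ s = footEquation V S N q (x, s) := by
  have hj : ∀ s ∈ Metric.closedBall (0 : E) (1 / 100),
      JetBound 0 (fun k => footBound N k * η) (footEquation V S N q) (x, s) := fun s hs =>
    G.jetBound_footEquation hq hx (by simpa using hs)
  have hd : ∀ s ∈ Metric.closedBall (0 : E) (1 / 100),
      HasFDerivAt (fun s => footEquation V S N q (x, s))
        ((fderiv ℝ (footEquation V S N q) (x, s)).comp (ContinuousLinearMap.inr ℝ E E)) s :=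
    fun s hs => HasFDerivAt.comp s (hj s hs).differentiableAt.hasFDerivAt
      (hasFDerivAt_prodMk_right x s)
  obtain ⟨s, hs, he⟩ := exists_fixedPoint_of_norm_fderiv_le
    (φ := fun s => footEquation V S N q (x, s)) (R := 1 / 100) (by norm_num)
    (fun s hs => (hd s hs).differentiableAt)
    (fun s hs => by
      rw [(hd s hs).fderiv]
      refine (ContinuousLinearMap.opNorm_comp_le _ _).trans ?_
      have h2 := ContinuousLinearMap.norm_inr_le_one ℝ E E
      have h3 := (hj s hs).norm_fderiv_le zero_le_one
      nlinarith [norm_nonneg (fderiv ℝ (footEquation V S N q) (x, s))])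
    (fun s hs => (hj s hs).norm_le.trans (by linarith))
  exact ⟨s, by simpa using hs, he.symm⟩

theorem displacement_flatProj (q b : E) :
    displacement V S N q (flatProj (V q) q b) = displacement V S N q b := by
  simp only [displacement, flatProj_flatProj]

/-- A fixed point of `footEquation` gives a critical point of the distance. -/
theorem inner_eq_zero_of_eq_footEquation [CompleteSpace E] (G : IsGluing n N η X V S)
    {q x s b : E} (hq : q ∈ X) (hx : ‖x - q‖ < 36 / 100) (hs : ‖s‖ ≤ 1 / 100)
    (hfix : s = footEquation V S N q (x, s)) (hb : b = q + (V q).starProjection (x - q) + s) :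
    flatProj (V q) q b = b ∧ ∀ v ∈ V q, inner ℝ (x - iterMap V S N b)
      (v + fderiv ℝ (displacement V S N q) b v) = 0 := by
  set π := (V q).starProjection with hπ
  set b' := flatProj (V q) q b with hb'
  have hb'q : ‖b' - q‖ < 37 / 100 := by
    rw [hb', hb]; exact norm_flatProj_parameter_sub_lt hx hs
  have hb'f : flatProj (V q) q b' = b' := flatProj_flatProj _ _ _
  -- the differential at `b` also factors through the projection
  have hcomp : ∀ v, fderiv ℝ (displacement V S N q) b (π v) =
      fderiv ℝ (displacement V S N q) b v := by
    intro v
    have h1 := (G.jetBound_displacement (b := b) hq (by linarith)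
      le_rfl).differentiableAt.hasFDerivAt
    have h2 : HasFDerivAt (flatProj (V q) q) π b := hasFDerivAt_flatProj _ _ _
    have h3 := (G.jetBound_displacement (b := b') hq (by rw [hb'f]; linarith)
      le_rfl).differentiableAt.hasFDerivAt
    have h4 := HasFDerivAt.comp b h3 h2
    have h5 : displacement V S N q ∘ flatProj (V q) q = displacement V S N q :=
      funext fun z => displacement_flatProj q z
    rw [h5] at h4
    have h6 := h4.unique h1
    rw [← h6]
    exact congrArg (fderiv ℝ (displacement V S N q) b') (starProjection_idem _ _)
  set T := fderiv ℝ (displacement V S N q) b with hT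
  set w := x - flatProj (V q) q b - displacement V S N q b with hw
  have hfix' : s = -π (displacement V S N q b) + ContinuousLinearMap.adjoint T w := by
    rw [footEquation, ← hπ, ← hb] at hfix
    exact hfix
  have hTw : ∀ v, inner ℝ (ContinuousLinearMap.adjoint T w) (π v) =
      inner ℝ (ContinuousLinearMap.adjoint T w) v := fun v => by
    rw [ContinuousLinearMap.adjoint_inner_left, ContinuousLinearMap.adjoint_inner_left, hcomp]
  have hsV : π s = s := by
    refine ext_inner_right ℝ fun v => ?_
    rw [hπ, (V q).inner_starProjection_left_eq_right, ← hπ]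
    conv_lhs => rw [hfix', inner_add_left, hTw, inner_neg_left, hπ,
      (V q).inner_starProjection_left_eq_right, starProjection_idem,
      ← (V q).inner_starProjection_left_eq_right, ← hπ]
    conv_rhs => rw [hfix', inner_add_left, inner_neg_left]
  have hbf : flatProj (V q) q b = b := by
    rw [flatProj, ← hπ, hb, show q + π (x - q) + s - q = π (x - q) + s by abel, map_add, hsV,
      show π (π (x - q)) = π (x - q) from starProjection_idem _ _, add_assoc]
  refine ⟨hbf, fun v hv => ?_⟩
  have hxw : x - iterMap V S N b = w := by
    rw [iterMap_eq_add_displacement N hbf, hw, hbf]; abel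
  have hπv : π v = v := (V q).starProjection_eq_self_iff.2 hv
  have hπw : π w = -s - π (displacement V S N q b) := by
    rw [hw, hbf, hb, map_sub, map_sub, map_add, map_add, hsV,
      show π (π (x - q)) = π (x - q) from starProjection_idem _ _, map_sub]
    abel
  rw [hxw, inner_add_right, ← ContinuousLinearMap.adjoint_inner_left]
  nth_rewrite 1 [← hπv]
  rw [hπ, ← (V q).inner_starProjection_left_eq_right, ← hπ, hπw, ← inner_add_left]
  have : -s - π (displacement V S N q b) + ContinuousLinearMap.adjoint T w = 0 := by
    nth_rewrite 1 [hfix']; abel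
  rw [this, inner_zero_left]

/-- A critical point of the distance is the strict minimum: the glued set is almost flat. -/
theorem dist_lt_of_inner_eq_zero [CompleteSpace E] (G : IsGluing n N η X V S) {q x b : E}
    (hq : q ∈ X) (h2 : displacementBound N 2 * η ≤ 1 / 1000)
    (hx : ‖x - q‖ < 36 / 100) (hb : flatProj (V q) q b = b) (hbq : ‖b - q‖ < 9 / 10)
    (hxb : ‖x - iterMap V S N b‖ < 4 / 10)
    (horth : ∀ v ∈ V q, inner ℝ (x - iterMap V S N b)
      (v + fderiv ℝ (displacement V S N q) b v) = 0) :
    ∀ y ∈ gluedSet V S N X, y ≠ iterMap V S N b → dist x (iterMap V S N b) < dist x y := by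
  intro y hy hne
  by_contra! hle
  rw [dist_eq_norm, dist_eq_norm] at hle
  have hyq : ‖y - q‖ < 8 / 10 := by
    have := norm_sub_le (x - q) (x - y)
    rw [show x - q - (x - y) = y - q by abel] at this
    linarith
  obtain ⟨b', hb', hbq', rfl⟩ := G.exists_flat_of_mem_gluedSet hq hy hyq
  set e := displacement V S N q with he
  set p := iterMap V S N b with hp
  set p' := iterMap V S N b' with hp'
  set d := b' - b with hd
  set Ω : Set E := (flatProj (V q) q) ⁻¹' Metric.ball q (9 / 10) with hΩ
  have hΩc : Convex ℝ Ω := by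
    have : Ω = (fun z => (V q).starProjection z) ⁻¹'
        Metric.ball ((V q).starProjection q) (9 / 10) := by
      ext z
      simp only [hΩ, Set.mem_preimage, mem_ball_iff_norm, flatProj, map_sub, add_sub_cancel_left]
    rw [this]
    exact (convex_ball _ _).linear_preimage (V q).starProjection.toLinearMap
  have hmem : ∀ {z}, flatProj (V q) q z = z → ‖z - q‖ < 9 / 10 → z ∈ Ω := fun {z} hz hzq => by
    rw [hΩ, Set.mem_preimage, hz, mem_ball_iff_norm]; exact hzq
  have hj : ∀ z ∈ Ω, JetBound 0 (fun k => displacementBound N k * η) e z := fun z hz =>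
    G.jetBound_displacement hq (by simpa [hΩ, dist_eq_norm] using hz) le_rfl
  have hbΩ := hmem hb hbq
  have hbΩ' := hmem hb' (by linarith)
  have htaylor : ‖e b' - e b - fderiv ℝ e b d‖ ≤ 1 / 1000 * ‖d‖ ^ 2 :=
    norm_sub_sub_fderiv_le hΩc (fun z hz => (hj z hz).contDiffAt) (fun z hz =>
      ((hj z hz).fderiv.norm_fderiv_le zero_le_one).trans h2) hbΩ hbΩ'
  have hlip : ‖e b' - e b‖ ≤ 1 / 1000 * ‖d‖ :=
    hΩc.norm_image_sub_le_of_norm_fderiv_le (fun z hz => (hj z hz).differentiableAt) (fun z hz =>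
      ((hj z hz).norm_fderiv_le zero_le_one).trans (G.small_deriv N le_rfl)) hbΩ hbΩ'
  have hpp : p' - p = d + (e b' - e b) := by
    rw [hp, hp', iterMap_eq_add_displacement N hb, iterMap_eq_add_displacement N hb', hd]
    simp only [← he]
    abel
  have hdV : d ∈ V q := by
    have h3 := (V q).sub_mem (flatProj_eq_self_iff.1 hb') (flatProj_eq_self_iff.1 hb)
    rwa [sub_sub_sub_cancel_right] at h3
  have hinner : inner ℝ (x - p) (p' - p) ≤ 4 / 10 * (1 / 1000 * ‖d‖ ^ 2) := by
    have e1 : p' - p = (d + fderiv ℝ e b d) + (e b' - e b - fderiv ℝ e b d) := by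
      rw [hpp]; abel
    rw [e1, inner_add_right, horth d hdV, zero_add]
    refine (real_inner_le_norm _ _).trans ?_
    gcongr
  have hlow : 999 / 1000 * ‖d‖ ≤ ‖p' - p‖ := by
    have h3 := norm_sub_le (p' - p) (e b' - e b)
    rw [hpp, add_sub_cancel_right, ← hpp] at h3
    linarith
  have hexp : ‖x - p'‖ ^ 2 = ‖x - p‖ ^ 2 - 2 * inner ℝ (x - p) (p' - p) + ‖p' - p‖ ^ 2 := by
    rw [← norm_sub_sq_real, sub_sub_sub_cancel_right]
  have hle2 : ‖x - p'‖ ^ 2 ≤ ‖x - p‖ ^ 2 := by gcongr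
  have hlow2 : (999 / 1000 * ‖d‖) ^ 2 ≤ ‖p' - p‖ ^ 2 := by gcongr
  have hd0 : d = 0 := by
    by_contra hne0
    have := norm_pos_iff.2 hne0
    nlinarith
  have hbb : b' = b := sub_eq_zero.1 hd0
  exact hne (by rw [hp', hp, hbb])

/-- Vectors in the image of the differential of the parametrization are velocities. -/
theorem exists_isSmoothCurveIn (G : IsGluing n N η X V S) {q b v : E} (hq : q ∈ X)
    (hb : flatProj (V q) q b = b) (hbq : ‖b - q‖ < 9 / 10) (hv : v ∈ V q) :
    ∃ γ : ℝ → E, IsSmoothCurveIn (gluedSet V S N X) γ ∧ γ 0 = iterMap V S N b ∧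
      deriv γ 0 = v + fderiv ℝ (displacement V S N q) b v := by
  set l : ℝ → E := fun t => b + t • v with hl
  have hl0 : l 0 = b := by simp [hl]
  have hls : ContDiff ℝ ∞ l := by fun_prop
  have hld : HasDerivAt l v 0 := by
    have := ((hasDerivAt_id (0 : ℝ)).smul_const v).const_add b
    rwa [one_smul] at this
  have hej := G.jetBound_displacement (b := l 0) hq (by rwa [hl0, hb]) (le_refl N)
  have hlf : ∀ t, flatProj (V q) q (l t) = l t := fun t => by
    rw [flatProj_eq_self_iff, hl]
    simp only
    rw [add_sub_right_comm]
    exact (V q).add_mem (flatProj_eq_self_iff.1 hb) ((V q).smul_mem t hv)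
  refine ⟨fun t => l t + displacement V S N q (l t),
    ⟨hls.contDiffAt.add (hej.contDiffAt.comp (0 : ℝ) hls.contDiffAt), ?_⟩, ?_, ?_⟩
  · have : ∀ᶠ t in 𝓝 (0 : ℝ), ‖l t - q‖ < 1 := by
      refine (hls.continuous.sub continuous_const).norm.continuousAt.eventually_lt
        continuousAt_const ?_
      change ‖l 0 - q‖ < 1
      rw [hl0]; linarith
    filter_upwards [this] with t ht
    rw [← iterMap_eq_add_displacement N (hlf t)]
    exact G.iterMap_mem_gluedSet hq (hlf t) ht
  · simp only [hl0, ← iterMap_eq_add_displacement N hb]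
  · have h1 := hld.add (hej.differentiableAt.hasFDerivAt.comp_hasDerivAt (0 : ℝ) hld)
    rw [hl0] at h1
    exact h1.deriv

end IsGluing

/-- Near each point `q` of `X` there is a nearest point projection to the glued set, which differs
from the projection onto the flat at `q` by `O(η)` together with all derivatives. -/
theorem exists_local_projection (N : ℕ) : ∃ B : ℕ → ℝ, ∀ (n : ℕ) (E : Type u)
    [NormedAddCommGroup E] [InnerProductSpace ℝ E] [CompleteSpace E] (η : ℝ) (X : Set E)
    (V : E → Submodule ℝ E) [∀ q, FiniteDimensional ℝ (V q)] (S : ℕ → Set E),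
    IsGluing n N η X V S → footBound N 0 * η ≤ 1 / 1000 → footBound N 1 * η ≤ 1 / 1000 →
    displacementBound N 2 * η ≤ 1 / 1000 → ∀ q ∈ X, ∃ f : E → E, ∀ x, ‖x - q‖ < 36 / 100 →
      f x ∈ gluedSet V S N X ∧ (∀ y ∈ gluedSet V S N X, y ≠ f x → dist x (f x) < dist x y) ∧
      JetBound 0 (fun k => B k * η) (fun z => f z - flatProj (V q) q z) x := by
  obtain ⟨K, hK⟩ := exists_jetBound_of_eq_fixedPoint.{u, u} (footBound N)
  refine ⟨fun k => K k + chainBound (displacementBound N) (fun k => 1 + |K k|) k,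
    fun n E _ _ _ η X V _ S G h0 h1 h2 q hq => ?_⟩
  have hex : ∀ x, ∃ s, ‖x - q‖ < 36 / 100 → ‖s‖ ≤ 1 / 100 ∧ s = footEquation V S N q (x, s) := by
    intro x
    by_cases hx : ‖x - q‖ < 36 / 100
    · obtain ⟨s, hs⟩ := G.exists_eq_footEquation hq h0 h1 hx
      exact ⟨s, fun _ => hs⟩
    · exact ⟨0, fun h => absurd h hx⟩
  choose s hs using hex
  set b : E → E := fun x => q + (V q).starProjection (x - q) + s x with hb
  refine ⟨fun x => iterMap V S N (b x), fun x hx => ?_⟩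
  have hev : ∀ᶠ y in 𝓝 x, ‖y - q‖ < 36 / 100 := by
    filter_upwards [Metric.isOpen_ball.mem_nhds (mem_ball_iff_norm.2 hx)] with y hy
    exact mem_ball_iff_norm.1 hy
  have hcrit : ∀ y, ‖y - q‖ < 36 / 100 → flatProj (V q) q (b y) = b y ∧
      ∀ v ∈ V q, inner ℝ (y - iterMap V S N (b y))
        (v + fderiv ℝ (displacement V S N q) (b y) v) = 0 := fun y hy =>
    G.inner_eq_zero_of_eq_footEquation hq hy (hs y hy).1 (hs y hy).2 rfl
  have hbq : ∀ y, ‖y - q‖ < 36 / 100 → ‖b y - q‖ < 37 / 100 := fun y hy => by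
    have := IsGluing.norm_flatProj_parameter_sub_lt (W := V q) hy (hs y hy).1
    rw [← (hcrit y hy).1]
    exact this
  have hdisp : ‖displacement V S N q (b x)‖ ≤ 1 / 1000 :=
    G.norm_displacement_le hq (by rw [(hcrit x hx).1]; linarith [hbq x hx]) le_rfl
  have hdist : ‖x - iterMap V S N (b x)‖ < 4 / 10 := by
    have e : x - iterMap V S N (b x) = ((x - q) - (V q).starProjection (x - q)) - s x -
        displacement V S N q (b x) := by
      rw [iterMap_eq_add_displacement N (hcrit x hx).1]
      nth_rewrite 1 [hb]
      simp only
      abel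
    rw [e]
    have h3 := norm_sub_le (((x - q) - (V q).starProjection (x - q)) - s x)
      (displacement V S N q (b x))
    have h4 := norm_sub_le ((x - q) - (V q).starProjection (x - q)) (s x)
    have h5 := norm_sub_starProjection_le (V q) (x - q)
    linarith [(hs x hx).1]
  refine ⟨G.iterMap_mem_gluedSet hq (hcrit x hx).1 (by linarith [hbq x hx]),
    G.dist_lt_of_inner_eq_zero hq h2 hx (hcrit x hx).1 (by linarith [hbq x hx]) hdist
      (hcrit x hx).2, ?_⟩
  -- the solution depends continuously, hence smoothly, on `x`
  have hcont : ContinuousAt s x := by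
    rw [Metric.continuousAt_iff]
    intro ε hε
    refine ⟨min ε (36 / 100 - ‖x - q‖), lt_min hε (by linarith), fun {y} hy => ?_⟩
    have hyq : ‖y - q‖ < 36 / 100 := by
      have h3 := norm_add_le (y - x) (x - q)
      rw [sub_add_sub_cancel, ← dist_eq_norm y x] at h3
      linarith [hy.trans_le (min_le_right _ _)]
    have h3 := G.norm_footEquation_sub_le hq h1 hyq (hs y hyq).1 hx (hs x hx).1
    rw [← (hs y hyq).2, ← (hs x hx).2] at h3
    have h4 := hy.trans_le (min_le_left _ _)
    rw [dist_eq_norm] at h4 ⊢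
    rcases le_total ‖y - x‖ ‖s y - s x‖ with h | h
    · rw [max_eq_right h] at h3
      have := norm_nonneg (s y - s x)
      linarith
    · rw [max_eq_left h] at h3
      have := norm_nonneg (y - x)
      linarith
  have hfj := G.jetBound_footEquation hq hx (hs x hx).1
  have heq : ∀ᶠ y in 𝓝 x, s y = footEquation V S N q (y, s y) := hev.mono fun y hy => (hs y hy).2
  have hsm : ContDiffAt ℝ ∞ s x := contDiffAt_of_eventually_eq_fixedPoint hfj.contDiffAt
    ((hfj.norm_fderiv_le zero_le_one).trans_lt (by linarith)) hcont heq
  have hsj := hK E E (footEquation V S N q) s x η G.pos.le (by linarith [G.small])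
    (by linarith) hfj hsm heq
  have hbj : JetBound 1 (fun k => 1 + |K k|) b x := by
    refine ((jetBound_flatProj (V q) q x).add (hsj.of_le zero_le_one)).mono fun k _ => ?_
    have h3 : K k * η ≤ |K k| * η := mul_le_mul_of_nonneg_right (le_abs_self _) G.pos.le
    have h4 : |K k| * η ≤ |K k| * 1 := by
      have := G.small
      gcongr
      linarith
    linarith
  have hej := (G.jetBound_displacement (b := b x) hq (by
    rw [(hcrit x hx).1]; linarith [hbq x hx]) (le_refl N)).comp hbj
  refine ((hsj.add hej).mono fun k _ => ?_).congr (hev.mono fun y hy => ?_)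
  · rw [chainBound_mul _ _ G.pos.le, add_mul]
  · simp only
    rw [iterMap_eq_add_displacement N (hcrit y hy).1]
    nth_rewrite 1 [hb]
    simp only [flatProj]
    abel

/-- At scale `1`: a set which is `δ`-close to flats, `δ` small, is `5 δ`-close to a closed set with
a tubular projection, whose derivatives of order at least `2` are `O(δ)`. -/
theorem exists_isTubularProjection_of_isCloseToFlats_one (n : ℕ) :
    ∃ (σ₀ : ℝ) (B : ℕ → ℝ), 0 < σ₀ ∧ ∀ (E : Type u) [NormedAddCommGroup E]
      [InnerProductSpace ℝ E] [CompleteSpace E] (X : Set E) (δ : ℝ), 0 < δ → δ < σ₀ →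
      IsCloseToFlats n δ 1 X → ∃ (M : Set E) (P : E → E), IsClosed M ∧
        Metric.hausdorffEDist X M ≤ ENNReal.ofReal (5 * δ) ∧
        IsTubularProjection n M P (1 / 3) ∧
        (∀ x ∈ Metric.thickening (1 / 3) M, ∀ y ∈ Metric.thickening (1 / 3) M,
          ‖P x - P y‖ ≤ 200 * ‖x - y‖) ∧
        ∀ k : ℕ, 2 ≤ k → ∀ x ∈ Metric.thickening (1 / 3) M,
          ‖iteratedFDeriv ℝ k P x‖ ≤ B k * δ := by
  obtain ⟨N, hN⟩ := exists_isGluing.{u} n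
  obtain ⟨B, hB⟩ := exists_local_projection.{u} N
  obtain ⟨η₀, hη₀, hG⟩ := hN (|footBound N 0| + |footBound N 1| + displacementBound N 2 + |B 1|)
  -- flats are `η`-close in the strict sense for `η > δ`, and the glued set is `4 η`-close to `X`:
  -- `η = 5 / 4 * δ` meets both requirements
  refine ⟨4 / 5 * η₀, fun k => 5 / 4 * B k, by positivity, fun E _ _ _ X δ hδ hδη hX => ?_⟩
  obtain ⟨hT, V, hV, S, G⟩ := hG E X δ (5 / 4 * δ) (by linarith) (by linarith) (by linarith) hX
  set η := 5 / 4 * δ with hη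
  have hη0 : 0 ≤ η := G.pos.le
  have hle : ∀ c : ℝ, c ≤ |footBound N 0| + |footBound N 1| + displacementBound N 2 + |B 1| →
      c * η ≤ 1 / 1000 := fun c hc => (mul_le_mul_of_nonneg_right hc hη0).trans hT
  have hp0 := abs_nonneg (footBound N 0)
  have hp1 := abs_nonneg (footBound N 1)
  have hp2 := displacementBound_nonneg N 2
  have hp3 := abs_nonneg (B 1)
  have hs0 : footBound N 0 * η ≤ 1 / 1000 := hle _ (by linarith [le_abs_self (footBound N 0)])
  have hs1 : footBound N 1 * η ≤ 1 / 1000 := hle _ (by linarith [le_abs_self (footBound N 1)])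
  have hs2 : displacementBound N 2 * η ≤ 1 / 1000 := hle _ (by linarith)
  have hs3 : B 1 * η ≤ 1 / 1000 := hle _ (by linarith [le_abs_self (B 1)])
  set M := gluedSet V S N X with hM
  set U := Metric.thickening (1 / 3) M with hU
  have hUo : IsOpen U := Metric.isOpen_thickening
  choose! f hf using hB n E η X V S G hs0 hs1 hs2
  have hnear : ∀ x ∈ U, ∃ q ∈ X, ‖x - q‖ < 354 / 1000 := fun x hx => by
    obtain ⟨p, hp, hxp⟩ := Metric.mem_thickening_iff.1 hx
    obtain ⟨q, hq, hpq⟩ := G.exists_norm_sub_le_of_mem_gluedSet hp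
    refine ⟨q, hq, ?_⟩
    rw [dist_eq_norm] at hxp
    have := norm_add_le (x - p) (p - q)
    rw [sub_add_sub_cancel] at this
    linarith
  choose! c hcX hc using hnear
  have hc' : ∀ x ∈ U, ‖x - c x‖ < 36 / 100 := fun x hx => by linarith [hc x hx]
  set P : E → E := fun x => f (c x) x with hP
  have hproj : IsNormalProjectionOn M U P := fun x hx =>
    ⟨(hf _ (hcX x hx) x (hc' x hx)).1, (hf _ (hcX x hx) x (hc' x hx)).2.1⟩
  -- nearest points are unique, so `P` agrees with every local projection
  have huniq : ∀ x ∈ U, ∀ p ∈ M, (∀ y ∈ M, y ≠ p → dist x p < dist x y) → P x = p := by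
    intro x hx p hp hmin
    by_contra hne
    have h1 := hmin _ (hproj x hx).1 hne
    have h2 := (hproj x hx).2 p hp (Ne.symm hne)
    linarith
  have hPf : ∀ q ∈ X, ∀ x ∈ U, ‖x - q‖ < 36 / 100 → P x = f q x := fun q hq x hx hxq =>
    huniq x hx _ (hf q hq x hxq).1 (hf q hq x hxq).2.1
  have hPev : ∀ q ∈ X, ∀ x ∈ U, ‖x - q‖ < 36 / 100 → P =ᶠ[𝓝 x] f q := by
    intro q hq x hx hxq
    filter_upwards [hUo.mem_nhds hx, Metric.isOpen_ball.mem_nhds (mem_ball_iff_norm.2 hxq)]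
      with y hy hyq
    exact hPf q hq y hy (mem_ball_iff_norm.1 hyq)
  have hjet : ∀ q ∈ X, ∀ x ∈ U, ‖x - q‖ < 36 / 100 →
      JetBound 0 (fun k => B k * η) (fun z => P z - flatProj (V q) q z) x :=
    fun q hq x hx hxq => (hf q hq x hxq).2.2.congr
      ((hPev q hq x hx hxq).mono fun z hz => by simp only [hz])
  have hflat : ∀ q x : E, HasFDerivAt (flatProj (V q) q) (V q).starProjection x := fun q x =>
    hasFDerivAt_flatProj _ _ _
  have hflats : ∀ q x : E, ContDiffAt ℝ ∞ (flatProj (V q) q) x := fun q x =>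
    (jetBound_flatProj (V q) q x).contDiffAt
  have hsum : ∀ q : E, P = (fun z => P z - flatProj (V q) q z) + flatProj (V q) q := fun q => by
    ext1 z; simp
  have hsmooth : ∀ x ∈ U, ContDiffAt ℝ ∞ P x := fun x hx => by
    rw [hsum (c x)]
    exact (hjet _ (hcX x hx) x hx (hc' x hx)).contDiffAt.add (hflats _ _)
  have hfderiv : ∀ q ∈ X, ∀ x ∈ U, ‖x - q‖ < 36 / 100 →
      ‖fderiv ℝ P x - (V q).starProjection‖ ≤ 1 / 1000 := fun q hq x hx hxq => by
    have h1 := ((hsmooth x hx).differentiableAt (by simp)).hasFDerivAt.sub (hflat q x)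
    have h2 : HasFDerivAt (fun z => P z - flatProj (V q) q z) _ x := h1
    rw [← h2.fderiv]
    exact ((hjet q hq x hx hxq).norm_fderiv_le zero_le_one).trans hs3
  refine ⟨M, P, G.isClosed_gluedSet, G.hausdorffEDist_gluedSet_le.trans
    (ENNReal.ofReal_le_ofReal (by rw [hη]; linarith)), ⟨by norm_num, hproj,
    fun x hx => (hsmooth x hx).contDiffWithinAt, fun p hp => ?_, fun p hp v hv hvn => ?_⟩,
    fun x hx y hy => ?_, fun k hk x hx => ?_⟩
  · have hpU : p ∈ U := Metric.self_subset_thickening (by norm_num) M hp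
    exact ⟨V (c p), hV _, G.approx.finrank_eq _ (hcX p hpU),
      (hfderiv _ (hcX p hpU) p hpU (hc' p hpU)).trans_lt (by norm_num)⟩
  · have hpU : p ∈ U := Metric.self_subset_thickening (by norm_num) M hp
    obtain ⟨q, hq, hpq⟩ := G.exists_norm_sub_le_of_mem_gluedSet hp
    obtain ⟨b, hb, hbq, rfl⟩ := G.exists_flat_of_mem_gluedSet hq hp (by linarith)
    set p := iterMap V S N b with hpdef
    have hxU : p + v ∈ U := Metric.mem_thickening_iff.2 ⟨p, hp, by simpa [dist_eq_norm] using hvn⟩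
    refine huniq _ hxU p hp (G.dist_lt_of_inner_eq_zero hq hs2 ?_ hb (by linarith) ?_ ?_)
    · rw [add_sub_right_comm]
      exact (norm_add_le _ _).trans_lt (by linarith)
    · rw [add_sub_cancel_left]; linarith
    · intro u hu
      obtain ⟨γ, hγ, hγ0, hγd⟩ := G.exists_isSmoothCurveIn hq hb (by linarith) hu
      rw [add_sub_cancel_left, ← hγd]
      refine Submodule.inner_left_of_mem_orthogonal (K := (fderiv ℝ P p).range) ?_ hv
      have h1 := fderiv_apply_deriv_of_isSmoothCurveIn (P := P)
        (fun p hp => hproj.apply_of_mem hp (Metric.self_subset_thickening (by norm_num) M hp))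
        (by rw [hγ0]; exact (hsmooth p hpU).differentiableAt (by simp)) hγ
      rw [hγ0] at h1
      exact ⟨_, h1⟩
  -- at small distances compare within one local projection, at large ones `‖z - P z‖ < 1 / 3`
  -- suffices
  · rcases lt_or_ge ‖x - y‖ (5 / 1000) with h | h
    · have hq := hcX x hx
      have hxq := hc x hx
      have hyq : ‖y - c x‖ < 36 / 100 := by
        have := norm_sub_le (x - c x) (x - y)
        rw [show x - c x - (x - y) = y - c x by abel] at this
        linarith
      set q := c x with hqdef
      have hfd : ∀ z ∈ Metric.ball q (36 / 100), HasFDerivAt (f q)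
          (fderiv ℝ (fun z => f q z - flatProj (V q) q z) z + (V q).starProjection) z := by
        intro z hz
        have h1 := (hf q hq z (mem_ball_iff_norm.1 hz)).2.2.differentiableAt.hasFDerivAt.add
          (hflat q z)
        exact h1.congr_of_eventuallyEq (Filter.Eventually.of_forall fun z => by simp)
      have h2 := (convex_ball q (36 / 100)).norm_image_sub_le_of_norm_hasFDerivWithin_le
        (C := 2) (fun z hz => (hfd z hz).hasFDerivWithinAt) (fun z hz => by
          have h3 := ((hf q hq z (mem_ball_iff_norm.1 hz)).2.2.norm_fderiv_le zero_le_one).trans hs3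
          have h4 := (V q).starProjection_norm_le
          exact (norm_add_le _ _).trans (by linarith))
        (mem_ball_iff_norm.2 hyq) (mem_ball_iff_norm.2 (hc' x hx))
      rw [hPf q hq x hx (hc' x hx), hPf q hq y hy hyq]
      linarith [norm_nonneg (x - y)]
    · have hd : ∀ z ∈ U, ‖z - P z‖ < 1 / 3 := fun z hz => by
        obtain ⟨p, hp, hzp⟩ := Metric.mem_thickening_iff.1 hz
        rw [← dist_eq_norm]
        exact (hproj.dist_le hz hp).trans_lt hzp
      have e : P x - P y = (y - P y) - (x - P x) + (x - y) := by abel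
      rw [e]
      have h1 := norm_add_le ((y - P y) - (x - P x)) (x - y)
      have h2 := norm_sub_le (y - P y) (x - P x)
      linarith [hd x hx, hd y hy]
  · have hq := hcX x hx
    have hxq := hc' x hx
    have hj := hjet _ hq x hx hxq
    have h1 := iteratedFDeriv_add_apply (hj.contDiffAt_nat k)
      ((jetBound_flatProj (V (c x)) (c x) x).contDiffAt_nat k)
    rw [← hsum] at h1
    have h2 : iteratedFDeriv ℝ k (flatProj (V (c x)) (c x)) x = 0 := by
      have e : flatProj (V (c x)) (c x) = fun z =>
          (c x - (V (c x)).starProjection (c x)) + (V (c x)).starProjection z := by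
        ext1 z
        simp only [flatProj, map_sub]; abel
      rw [e]
      exact iteratedFDeriv_const_add_clm _ _ _ hk
    rw [h1, h2, add_zero]
    refine (hj.2 k zero_le).trans_eq ?_
    rw [hη]; ring

end UnitScale

/-! ### Rescaling -/

section Rescaling

open scoped Pointwise

universe u

variable {E : Type u} [NormedAddCommGroup E] [InnerProductSpace ℝ E]

theorem hausdorffEDist_smul_le {s t : Set E} {c a : ℝ} (hc : 0 < c)
    (h : Metric.hausdorffEDist s t ≤ ENNReal.ofReal a) :
    Metric.hausdorffEDist (c • s) (c • t) ≤ ENNReal.ofReal (c * a) := by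
  have key : ∀ {s t : Set E}, Metric.hausdorffEDist s t ≤ ENNReal.ofReal a → ∀ x ∈ c • s,
      Metric.infEDist x (c • t) ≤ ENNReal.ofReal (c * a) := by
    rintro s t h _ ⟨y, hy, rfl⟩
    simp only
    rw [infEDist_smul₀ hc.ne', ENNReal.smul_def, smul_eq_mul, ENNReal.ofReal_mul hc.le]
    refine mul_le_mul' (le_of_eq ?_) ((Metric.infEDist_le_hausdorffEDist_of_mem hy).trans h)
    rw [Real.nnnorm_of_nonneg hc.le]
    exact (ENNReal.ofReal_eq_coe_nnreal hc.le).symm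
  exact Metric.hausdorffEDist_le_of_infEDist (key h)
    (key (by rwa [Metric.hausdorffEDist_comm]))

theorem IsCloseToFlats.inv_smul {n : ℕ} {δ r : ℝ} {X : Set E} (hr : 0 < r)
    (h : IsCloseToFlats n δ r X) : IsCloseToFlats n (δ / r) 1 (r⁻¹ • X) := by
  intro x hx
  have hx' : r • x ∈ X := (Set.mem_inv_smul_set_iff₀ hr.ne' _ _).1 hx
  obtain ⟨A, hxA, hfd, hrk, hd⟩ := h _ hx'
  refine ⟨AffineSubspace.mk' x A.direction, AffineSubspace.self_mem_mk' _ _, ?_, ?_, ?_⟩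
  · rw [AffineSubspace.direction_mk']; exact hfd
  · rw [AffineSubspace.direction_mk']; exact hrk
  · have hball : r⁻¹ • Metric.ball (r • x) r = Metric.ball x 1 := by
      rw [_root_.smul_ball (inv_ne_zero hr.ne'), inv_smul_smul₀ hr.ne', norm_inv,
        Real.norm_of_nonneg hr.le, inv_mul_cancel₀ hr.ne']
    have hA : r⁻¹ • (A : Set E) = (AffineSubspace.mk' x A.direction : Set E) := by
      ext y
      rw [Set.mem_inv_smul_set_iff₀ hr.ne', SetLike.mem_coe, SetLike.mem_coe,
        AffineSubspace.mem_mk', vsub_eq_sub, ← A.vsub_right_mem_direction_iff_mem hxA,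
        vsub_eq_sub, ← smul_sub]
      exact A.direction.smul_mem_iff hr.ne'
    have := hausdorffEDist_smul_le (inv_pos.2 hr) hd
    rw [Set.smul_set_inter₀ (inv_ne_zero hr.ne'), Set.smul_set_inter₀ (inv_ne_zero hr.ne'), hball,
      hA] at this
    rwa [div_eq_inv_mul]

theorem mem_thickening_smul_iff {M : Set E} {r ρ : ℝ} (hr : 0 < r) {x : E} :
    x ∈ Metric.thickening (r * ρ) (r • M) ↔ r⁻¹ • x ∈ Metric.thickening ρ M := by
  have key : ∀ y, dist x (r • y) = r * dist (r⁻¹ • x) y := fun y => by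
    nth_rewrite 1 [← smul_inv_smul₀ hr.ne' x]
    rw [dist_smul₀, Real.norm_of_nonneg hr.le]
  simp only [Metric.mem_thickening_iff]
  constructor
  · rintro ⟨_, ⟨y, hy, rfl⟩, h⟩
    simp only at h
    rw [key] at h
    exact ⟨y, hy, lt_of_mul_lt_mul_left h hr.le⟩
  · rintro ⟨y, hy, h⟩
    exact ⟨r • y, Set.smul_mem_smul_set hy, by rw [key]; exact mul_lt_mul_of_pos_left h hr⟩

theorem fderiv_smul_comp_inv_smul {P : E → E} {r : ℝ} (hr : 0 < r) {x : E}
    (hP : DifferentiableAt ℝ P (r⁻¹ • x)) :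
    fderiv ℝ (fun x => r • P (r⁻¹ • x)) x = fderiv ℝ P (r⁻¹ • x) := by
  have h1 : HasFDerivAt (fun x : E => r⁻¹ • x) (r⁻¹ • ContinuousLinearMap.id ℝ E) x :=
    (hasFDerivAt_id x).const_smul r⁻¹
  have h2 := (hP.hasFDerivAt.comp x h1).const_smul r
  have h3 : HasFDerivAt (fun x => r • P (r⁻¹ • x)) _ x := h2
  rw [h3.fderiv]
  ext v
  simp [smul_smul, hr.ne']

theorem norm_iteratedFDeriv_smul_comp_inv_smul_le {P : E → E} {U : Set E} (hU : IsOpen U)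
    (hP : ContDiffOn ℝ ∞ P U) {r : ℝ} (hr : 0 < r) {x : E} (hx : r⁻¹ • x ∈ U) (k : ℕ) :
    ‖iteratedFDeriv ℝ k (fun x => r • P (r⁻¹ • x)) x‖ ≤
      r / r ^ k * ‖iteratedFDeriv ℝ k P (r⁻¹ • x)‖ := by
  set g : E →L[ℝ] E := r⁻¹ • ContinuousLinearMap.id ℝ E with hg
  have hgn : ‖g‖ ≤ r⁻¹ := by
    rw [hg, norm_smul, Real.norm_of_nonneg (inv_nonneg.2 hr.le)]
    exact mul_le_of_le_one_right (inv_nonneg.2 hr.le) ContinuousLinearMap.norm_id_le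
  have hgU : IsOpen (g ⁻¹' U) := hU.preimage g.continuous
  have h1 : iteratedFDeriv ℝ k (P ∘ g) x =
      (iteratedFDeriv ℝ k P (g x)).compContinuousLinearMap fun _ => g := by
    rw [← iteratedFDerivWithin_of_isOpen k hgU (show x ∈ g ⁻¹' U from hx),
      ← iteratedFDerivWithin_of_isOpen k hU (show g x ∈ U from hx)]
    exact g.iteratedFDerivWithin_comp_right hP hU.uniqueDiffOn hgU.uniqueDiffOn hx
      (by exact_mod_cast le_top)
  have hc : ContDiffAt ℝ k (P ∘ g) x :=
    ((hP.contDiffAt (hU.mem_nhds hx)).of_le (by exact_mod_cast le_top)).comp x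
      g.contDiff.contDiffAt
  have h2 : iteratedFDeriv ℝ k (fun x => r • P (r⁻¹ • x)) x = r • iteratedFDeriv ℝ k (P ∘ g) x :=
    iteratedFDeriv_const_smul_apply hc
  rw [h2, h1, norm_smul, Real.norm_of_nonneg hr.le, div_mul_eq_mul_div, mul_div_assoc]
  refine mul_le_mul_of_nonneg_left ?_ hr.le
  refine (ContinuousMultilinearMap.norm_compContinuousLinearMap_le _ _).trans ?_
  rw [Finset.prod_const, Finset.card_univ, Fintype.card_fin, div_eq_mul_inv, ← inv_pow]
  have h3 : ‖g‖ ^ k ≤ r⁻¹ ^ k := by gcongr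
  exact mul_le_mul_of_nonneg_left h3 (norm_nonneg _)

theorem IsTubularProjection.smul {n : ℕ} {M : Set E} {P : E → E} {r ρ : ℝ} (hr : 0 < r)
    (h : IsTubularProjection n M P ρ) :
    IsTubularProjection n (r • M) (fun x => r • P (r⁻¹ • x)) (r * ρ) := by
  have hfd : ∀ p ∈ r • M, r⁻¹ • p ∈ M ∧
      fderiv ℝ (fun x => r • P (r⁻¹ • x)) p = fderiv ℝ P (r⁻¹ • p) := fun p hp => by
    have hp' := (Set.mem_smul_set_iff_inv_smul_mem₀ hr.ne' _ _).1 hp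
    exact ⟨hp', fderiv_smul_comp_inv_smul hr (h.differentiableAt (h.mem_thickening hp'))⟩
  refine ⟨mul_pos hr h.pos, fun x hx => ?_, ?_, fun p hp => ?_, fun p hp v hv hvn => ?_⟩
  · rw [mem_thickening_smul_iff hr] at hx
    refine ⟨Set.smul_mem_smul_set (h.apply_mem hx), ?_⟩
    rintro _ ⟨q, hq, rfl⟩ hne
    have h1 := (h.proj _ hx).2 q hq fun he => hne (by rw [he])
    have key : ∀ y, dist x (r • y) = r * dist (r⁻¹ • x) y := fun y => by
      nth_rewrite 1 [← smul_inv_smul₀ hr.ne' x]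
      rw [dist_smul₀, Real.norm_of_nonneg hr.le]
    simp only [key]
    exact mul_lt_mul_of_pos_left h1 hr
  · refine (h.smooth.comp (t := Metric.thickening ρ M) (contDiff_id.const_smul r⁻¹).contDiffOn
      fun x hx => ?_).const_smul r
    exact (mem_thickening_smul_iff hr).1 hx
  · rw [(hfd p hp).2]
    exact h.rank _ (hfd p hp).1
  · rw [(hfd p hp).2] at hv
    have h1 := h.normal _ (hfd p hp).1 (r⁻¹ • v) (Submodule.smul_mem _ _ hv) (by
      rw [norm_smul, norm_inv, Real.norm_of_nonneg hr.le, inv_mul_lt_iff₀ hr]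
      exact hvn)
    simp only [smul_add, h1]
    exact smul_inv_smul₀ hr.ne' p

/-- A set which is `δ`-close to flats at scale `r`, `δ / r` small, is `5 δ`-close to a closed set
with a tubular projection. This is the case of scale `1` applied to `r⁻¹ • X`. -/
theorem exists_isTubularProjection_of_isCloseToFlats (n : ℕ) :
    ∃ (σ₀ : ℝ) (B : ℕ → ℝ), 0 < σ₀ ∧
      ∀ (E : Type u) [NormedAddCommGroup E] [InnerProductSpace ℝ E] [CompleteSpace E] (X : Set E)
        (r δ : ℝ),
        0 < r → 0 < δ → δ < σ₀ * r → IsCloseToFlats n δ r X →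
        ∃ (M : Set E) (P : E → E), IsClosed M ∧
          Metric.hausdorffEDist X M ≤ ENNReal.ofReal (5 * δ) ∧
          IsTubularProjection n M P (r / 3) ∧
          (∀ x ∈ Metric.thickening (r / 3) M, ∀ y ∈ Metric.thickening (r / 3) M,
            ‖P x - P y‖ ≤ 200 * ‖x - y‖) ∧
          ∀ k : ℕ, 2 ≤ k → ∀ x ∈ Metric.thickening (r / 3) M,
            ‖iteratedFDeriv ℝ k P x‖ ≤ B k * δ / r ^ k := by
  obtain ⟨σ₀, B, hσ₀, hB⟩ := exists_isTubularProjection_of_isCloseToFlats_one n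
  refine ⟨σ₀, B, hσ₀, fun E _ _ _ X r δ hr hδ hδr hX => ?_⟩
  obtain ⟨M, P, hM, hXM, hP, hlip, hder⟩ := hB E (r⁻¹ • X) (δ / r) (div_pos hδ hr)
    ((div_lt_iff₀ hr).2 hδr) (hX.inv_smul hr)
  have hPr := hP.smul hr
  have hr3 : r * (1 / 3) = r / 3 := by ring
  have hthick : ∀ x, x ∈ Metric.thickening (r / 3) (r • M) →
      r⁻¹ • x ∈ Metric.thickening (1 / 3) M := fun x hx => by
    rw [← hr3] at hx; exact (mem_thickening_smul_iff hr).1 hx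
  rw [hr3] at hPr
  refine ⟨r • M, fun x => r • P (r⁻¹ • x), hM.smul₀ r, ?_, hPr, fun x hx y hy => ?_,
    fun k hk x hx => ?_⟩
  · have := hausdorffEDist_smul_le hr hXM
    rw [smul_inv_smul₀ hr.ne'] at this
    refine this.trans_eq (congrArg _ ?_)
    field_simp
  · rw [← smul_sub, norm_smul, Real.norm_of_nonneg hr.le]
    have h1 := hlip _ (hthick x hx) _ (hthick y hy)
    rw [← smul_sub, norm_smul, norm_inv, Real.norm_of_nonneg hr.le] at h1
    refine (mul_le_mul_of_nonneg_left h1 hr.le).trans_eq ?_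
    field_simp
  · refine (norm_iteratedFDeriv_smul_comp_inv_smul_le Metric.isOpen_thickening hP.smooth hr
      (hthick x hx) k).trans ?_
    refine (mul_le_mul_of_nonneg_left (hder k hk _ (hthick x hx)) (by positivity)).trans_eq ?_
    field_simp

end Rescaling

theorem theorem2 (n : ℕ) :
    ∃ (σ₀ C : ℝ) (Ck : ℕ → ℝ), 0 < σ₀ ∧
      ∀ (E : Type*) [NormedAddCommGroup E] [InnerProductSpace ℝ E] [CompleteSpace E]
        [TopologicalSpace.SeparableSpace E] (X : Set E) (r δ : ℝ),
        0 < r → 0 < δ → δ < σ₀ * r → IsCloseToFlats n δ r X →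
        ∃ M : Set E, IsClosed M ∧ IsSmoothSubmanifold n M ∧
          Metric.hausdorffEDist X M ≤ ENNReal.ofReal (5 * δ) ∧
          (∀ p ∈ M, ∃ B : tangentSpaceAt M p →ₗ[ℝ] tangentSpaceAt M p →ₗ[ℝ] E,
            IsSecondFundamentalForm M p B ∧
              ∀ u w : tangentSpaceAt M p, ‖B u w‖ ≤ C * δ / r ^ 2 * ‖u‖ * ‖w‖) ∧
          ENNReal.ofReal (r / 3) ≤ normalInjectivityRadius M ∧
          ∃ P : E → E, IsNormalProjectionOn M (Metric.thickening (r / 3) M) P ∧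
            ContDiffOn ℝ ∞ P (Metric.thickening (r / 3) M) ∧
            (∀ x ∈ Metric.thickening (r / 3) M, ∀ y ∈ Metric.thickening (r / 3) M,
              ‖P x - P y‖ ≤ C * ‖x - y‖) ∧
            ∀ k : ℕ, 2 ≤ k → ∀ x ∈ Metric.thickening (r / 3) M,
              ‖iteratedFDeriv ℝ k P x‖ < Ck k * δ / r ^ k := by
  obtain ⟨σ₀, B, hσ₀, hB⟩ := exists_isTubularProjection_of_isCloseToFlats n
  refine ⟨σ₀, max 200 (B 2), fun k => B k + 1, hσ₀, fun E _ _ _ _ X r δ hr hδ hδr hX => ?_⟩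
  obtain ⟨M, P, hM, hXM, hP, hlip, hder⟩ := hB E X r δ hr hδ hδr hX
  refine ⟨M, hM, hP.isSmoothSubmanifold, hXM, fun p hp => ?_, hP.le_normalInjectivityRadius, P,
    hP.proj, hP.smooth, fun x hx y hy => (hlip x hx y hy).trans ?_,
    fun k hk x hx => (hder k hk x hx).trans_lt ?_⟩
  · refine hP.exists_isSecondFundamentalForm hp
      ((hder 2 le_rfl p (hP.mem_thickening hp)).trans ?_)
    exact div_le_div_of_nonneg_right
      (mul_le_mul_of_nonneg_right (le_max_right _ _) hδ.le) (by positivity)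
  · exact mul_le_mul_of_nonneg_right (le_max_left _ _) (norm_nonneg _)
  · exact div_lt_div_of_pos_right (mul_lt_mul_of_pos_right (lt_add_one _) hδ) (by positivity)
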